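/- Let $T>0$, let $\mathcal M$ be a nonempty finite set and $\mathcal U$ a nonempty set (e.g. a subset of $\mathbb R^p$). For $m\in\mathcal M$ let $f^m:\mathbb R^d\times\mathcal U\to\mathbb R^d$, $\sigma^m:\mathbb R^d\times\mathcal U\to\mathbb R^{d\times d}$, $\delta^m,\ell^m:\mathbb R^d\times\mathcal U\to\mathbb R$ be maps, and let $\psi:\mathbb R^d\to\mathbb R$. Put $$\mathcal H(x,r,p,\Gamma)=\sup_{m\in\mathcal M,\,u\in\mathcal U}\Big\{\tfrac12\operatorname{tr}\big(\sigma^m(x,u)\sigma^m(x,u)^{\mathsf T}\Gamma\big)+f^m(x,u)\cdot p-\delta^m(x,u)r+\ell^m(x,u)\Big\},$$ assumed finite for all $x,r,p$ and all symmetric $\Gamma$, and consider the equation $$-\partial_t v-\mathcal H(x,v,Dv,D^2v)=0\ \text{ on }[0,T)\times\mathbb R^d,\qquad v(T,\cdot)=\psi. \tag{HJB}$$ Let $\underline f^m:\mathbb R^d\to\mathbb R^d$, $\underline\sigma^m:\mathbb R^d\to\mathbb R^{d\times d}$, $g^m:\mathbb R^d\times\mathcal U\to\mathbb R^d$, $\Sigma^m:\mathbb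 R^d\times\mathcal U\to\mathbb R^{d\times l}$ be such that $a^m=\underline\sigma^m(\underline\sigma^m)^{\mathsf T}$ is positive definite at every point, $f^m-\underline f^m=\underline\sigma^m g^m$ and $\sigma^m(\sigma^m)^{\mathsf T}-a^m=\underline\sigma^m\Sigma^m(\Sigma^m)^{\mathsf T}(\underline\sigma^m)^{\mathsf T}$. Assume that $\psi,\ell^m,\underline\sigma^m,\underline f^m,g^m,\Sigma^m$ are bounded, that $\delta^m$ is bounded below, that $\psi,\delta^m,\ell^m,\underline\sigma^m,\underline f^m,g^m,\Sigma^m$ are uniformly continuous in $x\in\mathbb R^d$, uniformly in $u\in\mathcal U$, and that $k\in\mathbb N$ satisfies $\operatorname{tr}(\Sigma^m(x,u)\Sigma^m(x,u)^{\mathsf T})\le 4k+2$ for all $m,x,u$. For $h=T/n$, $n\ge1$, let $W_h$ be a centered Gaussian vector of $\mathbb R^d$ with covariance $hI$, and $\hat X^m_x=x+\underline f^m(x)h+\underline\sigma^m(x)W_h$. With $\mu_+$, $\mu_-$ the coordinatewise positive and negative parts of a vector $\mu$ and $N$ a standard normal variable, put $$\mathcal P^1_g(w)=2(g_+\cdot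 w_++g_-\cdot w_-),\qquad \mathcal P^2_{\Sigma,k}(w)=\sum_{j=1}^{l}\|\Sigma_{\cdot j}\|_2^2\Big(\tfrac{1}{(4k+2)\mathbb E[N^{4k+2}]}\Big(\tfrac{[\Sigma^{\mathsf T}w]_j}{\|\Sigma_{\cdot j}\|_2}\Big)^{4k+2}-\tfrac1{4k+2}\Big),$$ where zero columns contribute $0$. The discretized equation for $v^h:\{0,h,\dots,T\}\times\mathbb R^d\to\mathbb R$ is $v^h(T,\cdot)=\psi$ and, for $t\in\{0,h,\dots,T-h\}$, $x\in\mathbb R^d$, with $r=v^h(t,x)$ and $\phi=v^h(t+h,\cdot)$, $$\sup_{m,u}\Big\{\tfrac{\mathbb E[\phi(\hat X^m_x)]-r}{h}+\ell^m(x,u)-\delta^m(x,u)r+\mathbb E\big[(\phi(\hat X^m_x)-r)\mathcal P^1_{g^m(x,u)}(h^{-1}W_h)\big]+\tfrac1h\mathbb E\big[\phi(\hat X^m_x)\mathcal P^2_{\Sigma^m(x,u),k}(h^{-1/2}W_h)\big]\Big\}=0.$$ Assume finally that (HJB) has the strong uniqueness property: every bounded upper semicontinuous viscosity subsolution on $[0,T]\times\mathbb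 R^d$ is everywhere at most every bounded lower semicontinuous viscosity supersolution, the terminal condition being understood in the viscosity sense (at $t=T$, $\min(-\partial_t\varphi-\mathcal H,\,w-\psi)\le0$ for subsolutions $w$ and $\max(-\partial_t\varphi-\mathcal H,\,w-\psi)\ge0$ for supersolutions $w$, for $C^2$ test functions $\varphi$). Then, for all $h=T/n$ small enough, the discretized equation has a unique solution $v^h$; (HJB) has a unique bounded continuous viscosity solution $v$; and, if $v^h$ is extended to $[0,T]\times\mathbb R^d$ as a function that is continuous and piecewise linear in $t$ (linear between consecutive grid times), then $v^h\to v$ locally uniformly on $[0,T]\times\mathbb R^d$ as $h\to0^+$. -/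

import Mathlib

open MeasureTheory ProbabilityTheory Filter Topology Set
open scoped Matrix

noncomputable section

/-- Data of the control problem: discrete controls `M`, continuum controls `U`, state space `ℝ^d`. -/
structure ControlProblem (d : ℕ) (M U : Type*) where
  /-- drift `f^m(x,u)` -/
  f : M → (Fin d → ℝ) → U → Fin d → ℝ
  /-- diffusion matrix `σ^m(x,u)` -/
  σ : M → (Fin d → ℝ) → U → Matrix (Fin d) (Fin d) ℝ
  /-- discount rate `δ^m(x,u)` -/
  δ : M → (Fin d → ℝ) → U → ℝ
  /-- running reward `ℓ^m(x,u)` -/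
  cost : M → (Fin d → ℝ) → U → ℝ
  /-- terminal reward `ψ` -/
  ψ : (Fin d → ℝ) → ℝ

/-- Data of the scheme: coefficients of the uncontrolled diffusions with generators `L^m`,
and the maps `g^m`, `Σ^m` expressing the remaining part of the Hamiltonian. -/
structure SchemeData (d l : ℕ) (M U : Type*) where
  /-- drift of the uncontrolled diffusion -/
  f₀ : M → (Fin d → ℝ) → Fin d → ℝ
  /-- diffusion matrix of the uncontrolled diffusion -/
  σ₀ : M → (Fin d → ℝ) → Matrix (Fin d) (Fin d) ℝ
  /-- the vector `g^m(x,u)` -/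
  g : M → (Fin d → ℝ) → U → Fin d → ℝ
  /-- the matrix `Σ^m(x,u)` -/
  S : M → (Fin d → ℝ) → U → Matrix (Fin d) (Fin l) ℝ

/-- `f^m - f₀^m = σ₀^m g^m` and `σ^m σ^mᵀ - a^m = σ₀^m Σ^m Σ^mᵀ σ₀^mᵀ`, where
`a^m = σ₀^m σ₀^mᵀ` is positive definite. -/
structure IsDecomposition {d l : ℕ} {M U : Type*}
    (P : ControlProblem d M U) (A : SchemeData d l M U) : Prop where
  posDef : ∀ m x, (A.σ₀ m x * (A.σ₀ m x)ᵀ).PosDef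
  drift : ∀ m x u, P.f m x u - A.f₀ m x = A.σ₀ m x *ᵥ A.g m x u
  diffusion : ∀ m x u,
    P.σ m x u * (P.σ m x u)ᵀ - A.σ₀ m x * (A.σ₀ m x)ᵀ
      = A.σ₀ m x * A.S m x u * (A.S m x u)ᵀ * (A.σ₀ m x)ᵀ

namespace ControlProblem

variable {d : ℕ} {M U : Type*}

/-- `H^{m,u}(x,r,p,Γ)`. -/
def hamiltonianAt (P : ControlProblem d M U) (m : M) (u : U)
    (x : Fin d → ℝ) (r : ℝ) (p : Fin d → ℝ) (Γ : Matrix (Fin d) (Fin d) ℝ) : ℝ :=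
  (1 / 2) * (P.σ m x u * (P.σ m x u)ᵀ * Γ).trace + P.f m x u ⬝ᵥ p - P.δ m x u * r + P.cost m x u

/-- The Hamiltonian `H(x,r,p,Γ)`, the supremum of `H^{m,u}(x,r,p,Γ)` over all `m` and `u`. -/
def hamiltonian (P : ControlProblem d M U)
    (x : Fin d → ℝ) (r : ℝ) (p : Fin d → ℝ) (Γ : Matrix (Fin d) (Fin d) ℝ) : ℝ :=
  ⨆ c : M × U, P.hamiltonianAt c.1 c.2 x r p Γ

/-- The Hamiltonian takes finite values. -/
def FiniteHamiltonian (P : ControlProblem d M U) : Prop :=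
  ∀ (x : Fin d → ℝ) (r : ℝ) (p : Fin d → ℝ) (Γ : Matrix (Fin d) (Fin d) ℝ), Γ.IsSymm →
    BddAbove (range fun c : M × U => P.hamiltonianAt c.1 c.2 x r p Γ)

end ControlProblem

/-! ### Viscosity solutions of the HJB equation -/

/-- The closed slab `[0,T] × ℝ^d`. -/
def slab (d : ℕ) (T : ℝ) : Set (ℝ × (Fin d → ℝ)) := Icc 0 T ×ˢ univ

/-- The gradient of `φ(t,·)` at `x`. -/
def spaceGrad {d : ℕ} (φ : ℝ × (Fin d → ℝ) → ℝ) (t : ℝ) (x : Fin d → ℝ) : Fin d → ℝ :=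
  fun i => fderiv ℝ (fun y => φ (t, y)) x (Pi.single i 1)

/-- The Hessian matrix of `φ(t,·)` at `x`. -/
def spaceHess {d : ℕ} (φ : ℝ × (Fin d → ℝ) → ℝ) (t : ℝ) (x : Fin d → ℝ) :
    Matrix (Fin d) (Fin d) ℝ :=
  Matrix.of fun i j =>
    iteratedFDeriv ℝ 2 (fun y => φ (t, y)) x ![Pi.single i 1, Pi.single j 1]

namespace ControlProblem

variable {d : ℕ} {M U : Type*}

/-- `-∂_t φ(t,x) - H(x, r, Dφ(t,x), D²φ(t,x))`. -/
def hjb (P : ControlProblem d M U) (φ : ℝ × (Fin d → ℝ) → ℝ) (t : ℝ) (x : Fin d → ℝ)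
    (r : ℝ) : ℝ :=
  -deriv (fun s => φ (s, x)) t - P.hamiltonian x r (spaceGrad φ t x) (spaceHess φ t x)

/-- Upper semicontinuous viscosity subsolution on `[0,T] × ℝ^d` of the HJB equation on
`[0,T) × ℝ^d` with terminal condition `ψ` at `T` understood in the (relaxed) viscosity sense. -/
structure IsSubsolution (P : ControlProblem d M U) (T : ℝ) (w : ℝ × (Fin d → ℝ) → ℝ) : Prop where
  usc : UpperSemicontinuousOn w (slab d T)
  interior : ∀ t ∈ Ico 0 T, ∀ x, ∀ φ : ℝ × (Fin d → ℝ) → ℝ, ContDiff ℝ 2 φ →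
    IsLocalMaxOn (fun q => w q - φ q) (slab d T) (t, x) → P.hjb φ t x (w (t, x)) ≤ 0
  terminal : ∀ x, ∀ φ : ℝ × (Fin d → ℝ) → ℝ, ContDiff ℝ 2 φ →
    IsLocalMaxOn (fun q => w q - φ q) (slab d T) (T, x) →
      min (P.hjb φ T x (w (T, x))) (w (T, x) - P.ψ x) ≤ 0

/-- Lower semicontinuous viscosity supersolution, with the same conventions. -/
structure IsSupersolution (P : ControlProblem d M U) (T : ℝ) (w : ℝ × (Fin d → ℝ) → ℝ) :
    Prop where
  lsc : LowerSemicontinuousOn w (slab d T)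
  interior : ∀ t ∈ Ico 0 T, ∀ x, ∀ φ : ℝ × (Fin d → ℝ) → ℝ, ContDiff ℝ 2 φ →
    IsLocalMinOn (fun q => w q - φ q) (slab d T) (t, x) → 0 ≤ P.hjb φ t x (w (t, x))
  terminal : ∀ x, ∀ φ : ℝ × (Fin d → ℝ) → ℝ, ContDiff ℝ 2 φ →
    IsLocalMinOn (fun q => w q - φ q) (slab d T) (T, x) →
      0 ≤ max (P.hjb φ T x (w (T, x))) (w (T, x) - P.ψ x)

/-- Bounded on `[0,T] × ℝ^d`. -/
def BoundedOnSlab (T : ℝ) (w : ℝ × (Fin d → ℝ) → ℝ) : Prop :=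
  ∃ C : ℝ, ∀ q ∈ slab d T, |w q| ≤ C

/-- Strong uniqueness property (comparison principle for bounded semicontinuous sub- and
supersolutions, terminal condition in the viscosity sense). -/
def StrongUniqueness (P : ControlProblem d M U) (T : ℝ) : Prop :=
  ∀ w₁ w₂ : ℝ × (Fin d → ℝ) → ℝ, BoundedOnSlab T w₁ → BoundedOnSlab T w₂ →
    P.IsSubsolution T w₁ → P.IsSupersolution T w₂ → ∀ q ∈ slab d T, w₁ q ≤ w₂ q

/-- Bounded continuous viscosity solution of the HJB equation with terminal value `ψ`. -/
structure IsViscositySolution (P : ControlProblem d M U) (T : ℝ) (v : ℝ × (Fin d → ℝ) → ℝ) :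
    Prop where
  continuousOn : ContinuousOn v (slab d T)
  bounded : BoundedOnSlab T v
  sub : P.IsSubsolution T v
  super : P.IsSupersolution T v
  terminal : ∀ x, v (T, x) = P.ψ x

end ControlProblem

/-! ### The probabilistic scheme -/

/-- Law of `W_{t+h} - W_t` for a `d`-dimensional Brownian motion `W`: independent centered
Gaussian coordinates of variance `h`. -/
def incrementLaw (d : ℕ) (h : ℝ) : Measure (Fin d → ℝ) :=
  Measure.pi fun _ => gaussianReal 0 h.toNNReal

/-- `P¹_g(w) = 2 (g₊ · w₊ + g₋ · w₋)`. -/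
def poly1 {d : ℕ} (g w : Fin d → ℝ) : ℝ :=
  2 * ∑ i, (max (g i) 0 * max (w i) 0 + (-min (g i) 0) * (-min (w i) 0))

/-- The Euclidean norm of the `j`th column. -/
def colNorm {d l : ℕ} (S : Matrix (Fin d) (Fin l) ℝ) (j : Fin l) : ℝ :=
  Real.sqrt (∑ i, S i j ^ 2)

/-- `d_k = 1 / (4k+2)`. -/
def dCoeff (k : ℕ) : ℝ := 1 / (4 * (k : ℝ) + 2)

/-- `c_k = 1 / ((4k+2) E[N^{4k+2}])` with `N` a standard normal variable. -/
def cCoeff (k : ℕ) : ℝ :=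
  1 / ((4 * (k : ℝ) + 2) * ∫ y : ℝ, y ^ (4 * k + 2) ∂(gaussianReal 0 1))

/-- `P²_{Σ,k}(w) = ∑_j ‖Σ_j‖² (c_k ([Σᵀ w]_j / ‖Σ_j‖)^{4k+2} - d_k)`; zero columns
contribute `0`. -/
def poly2 {d l : ℕ} (S : Matrix (Fin d) (Fin l) ℝ) (k : ℕ) (w : Fin d → ℝ) : ℝ :=
  ∑ j, colNorm S j ^ 2 * (cCoeff k * ((Sᵀ *ᵥ w) j / colNorm S j) ^ (4 * k + 2) - dCoeff k)

namespace SchemeData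

variable {d l : ℕ} {M U : Type*}

/-- One Euler step from `x` with Brownian increment `w`. -/
def eulerStep (A : SchemeData d l M U) (m : M) (h : ℝ) (x w : Fin d → ℝ) : Fin d → ℝ :=
  x + h • A.f₀ m x + A.σ₀ m x *ᵥ w

/-- `D⁰`; here and below `φ` is the function at time `t+h`. -/
def D0 (A : SchemeData d l M U) (m : M) (h : ℝ) (φ : (Fin d → ℝ) → ℝ) (x : Fin d → ℝ) : ℝ :=
  ∫ w, φ (A.eulerStep m h x w) ∂(incrementLaw d h)

/-- `D¹_g(r, φ)`. -/
def D1 (A : SchemeData d l M U) (m : M) (h : ℝ) (g : Fin d → ℝ) (r : ℝ)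
    (φ : (Fin d → ℝ) → ℝ) (x : Fin d → ℝ) : ℝ :=
  ∫ w, (φ (A.eulerStep m h x w) - r) * poly1 g (h⁻¹ • w) ∂(incrementLaw d h)

/-- `D²_{Σ,k}(φ)`. -/
def D2 (A : SchemeData d l M U) (m : M) (h : ℝ) (S : Matrix (Fin d) (Fin l) ℝ) (k : ℕ)
    (φ : (Fin d → ℝ) → ℝ) (x : Fin d → ℝ) : ℝ :=
  h⁻¹ * ∫ w, φ (A.eulerStep m h x w) * poly2 S k ((Real.sqrt h)⁻¹ • w) ∂(incrementLaw d h)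

/-- The scheme `K(h,t,x,r,φ)`, which depends on `φ` only through `φ(t+h,·)`. -/
def K (P : ControlProblem d M U) (A : SchemeData d l M U) (k : ℕ) (h : ℝ) (x : Fin d → ℝ)
    (r : ℝ) (φ : (Fin d → ℝ) → ℝ) : ℝ :=
  -⨆ c : M × U,
    (h⁻¹ * (A.D0 c.1 h φ x - r) + P.cost c.1 x c.2 - P.δ c.1 x c.2 * r
      + A.D1 c.1 h (A.g c.1 x c.2) r φ x + A.D2 c.1 h (A.S c.1 x c.2) k φ x)

/-- `w i x` is the value at `(i h, x)`, `h = T/n`, of a solution of the discretized HJB equation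
with terminal value `ψ`. -/
def IsDiscreteSolution (P : ControlProblem d M U) (A : SchemeData d l M U) (k : ℕ) (T : ℝ)
    (n : ℕ) (w : Fin (n + 1) → (Fin d → ℝ) → ℝ) : Prop :=
  (∀ x, w (Fin.last n) x = P.ψ x) ∧
    ∀ (i : Fin n) (x : Fin d → ℝ), K P A k (T / n) x (w i.castSucc x) (w i.succ) = 0

end SchemeData

/-- The interpolation on `[0,T] × ℝ^d`, continuous and piecewise linear in `t`, of grid values
`w i x` at times `i T / n`, written with hat functions. -/
def timeInterp {d : ℕ} (T : ℝ) (n : ℕ) (w : Fin (n + 1) → (Fin d → ℝ) → ℝ)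
    (q : ℝ × (Fin d → ℝ)) : ℝ :=
  ∑ i : Fin (n + 1), max 0 (1 - |q.1 * n / T - (i : ℝ)|) * w i q.2

/-- Boundedness of `ψ, ℓ^m, σ₀^m, f₀^m, g^m, Σ^m` and lower boundedness of `δ^m`. -/
structure BoundedData {d l : ℕ} {M U : Type*}
    (P : ControlProblem d M U) (A : SchemeData d l M U) : Prop where
  ψ : ∃ C : ℝ, ∀ x, |P.ψ x| ≤ C
  cost : ∀ m, ∃ C : ℝ, ∀ x u, |P.cost m x u| ≤ C
  σ₀ : ∀ m, ∃ C : ℝ, ∀ x i j, |A.σ₀ m x i j| ≤ C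
  f₀ : ∀ m, ∃ C : ℝ, ∀ x i, |A.f₀ m x i| ≤ C
  g : ∀ m, ∃ C : ℝ, ∀ x u i, |A.g m x u i| ≤ C
  S : ∀ m, ∃ C : ℝ, ∀ x u i j, |A.S m x u i j| ≤ C
  δ : ∀ m, ∃ C : ℝ, ∀ x u, C ≤ P.δ m x u

/-- Uniform continuity in `x`, uniformly in `u`, of `ψ, δ^m, ℓ^m, σ₀^m, f₀^m, g^m, Σ^m`. -/
structure UniformlyContinuousData {d l : ℕ} {M U : Type*}
    (P : ControlProblem d M U) (A : SchemeData d l M U) : Prop where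
  ψ : UniformContinuous P.ψ
  δ : ∀ m, UniformEquicontinuous fun (u : U) x => P.δ m x u
  cost : ∀ m, UniformEquicontinuous fun (u : U) x => P.cost m x u
  σ₀ : ∀ m, UniformContinuous (A.σ₀ m)
  f₀ : ∀ m, UniformContinuous (A.f₀ m)
  g : ∀ m, UniformEquicontinuous fun (u : U) x => A.g m x u
  S : ∀ m, UniformEquicontinuous fun (u : U) x => A.S m x u

end

/-! The scheme is monotone, stable and consistent, and convergence follows by the half-relaxed
limits method of Barles and Souganidis.

With `W_h = √h z`, `z` standard Gaussian, the expression under the supremum becomes `h⁻¹ * mean +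
cost - (h⁻¹ * mass + disc) * r`. Here `mean` integrates `φ` after one Euler step against `1 + √h
P¹(z) + P²(z)`, and `mass` is the integral of this weight (`K_eq_iSup_step`).

Monotonicity: `P¹ ≥ 0`, and the bound on the trace gives `1 + P² ≥ 0` (`one_add_poly2_nonneg`), so
the weight is nonnegative.

Stability: for small `h` the coefficient of `r` is positive and the equation is solved by a supremum
of quotients (`iSup_sub_mul_eq_zero_iff`, `CoefBound.K_eq_zero_iff`). The mass is only known to be
`1 + O(√h)`, but it enters numerator and denominator alike, so a step multiplies sup norms by `1 +
O(h)` and adds `O(h)` (`CoefBound.abs_nextFun_le`). Hence `n = T/h` steps stay bounded.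

Consistency: Gaussian integration by parts gives `E[P²] = 0`, `E[z zᵀ P²] = Σ Σᵀ` and `E[z P¹] = g`.
In the Taylor expansion of a test function the term of order `h^(-1/2)` is odd in `z` and has mean
zero; the rest converges by domination to the time derivative plus the Hamiltonian of the given
control (`Coef.step_tendsto`). No topology on `U` is used to pass to the supremum: at a fixed point
the coefficients form a bounded set in a finite-dimensional space, and continuous convergence is
uniform on its compact closure (`tendstoUniformly_comp_of_continuous_convergence`).

Comparing the scheme with test functions at near-maximizers, the upper and lower half-relaxed limits
of the discrete solutions are a subsolution and a supersolution (`upperLim_subsolution`,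
`lowerLim_supersolution`). Strong uniqueness puts the upper limit below the lower one, so they
agree; the common limit is continuous, is the viscosity solution, and is approached locally
uniformly. -/

noncomputable section

/-! ### Moments of the standard Gaussian vector -/

lemma integrable_pow_gaussianReal (n : ℕ) :
    Integrable (fun y : ℝ => y ^ n) (gaussianReal 0 1) := by
  rcases Nat.eq_zero_or_pos n with rfl | hn
  · simp
  · have h := (memLp_id_gaussianReal' (μ := 0) (v := 1) (n : ENNReal) (by simp)).integrable_norm_pow
      hn.ne'
    refine h.mono (by fun_prop) (Eventually.of_forall fun y => ?_)
    simp

/-- Integration by parts in one variable: the density times `y ^ (n + 1)` is integrable with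
integrable derivative, so the derivative has integral zero. -/
lemma integral_pow_add_two_gaussianReal (n : ℕ) :
    ∫ y : ℝ, y ^ (n + 2) ∂(gaussianReal 0 1) = (n + 1) * ∫ y : ℝ, y ^ n ∂(gaussianReal 0 1) := by
  have key : ∀ k : ℕ, Integrable (fun y : ℝ => gaussianPDFReal 0 1 y * y ^ k) := by
    intro k
    have h := integrable_pow_gaussianReal k
    rw [gaussianReal_of_var_ne_zero 0 one_ne_zero] at h
    rw [integrable_withDensity_iff_integrable_smul₀' (by fun_prop)
      (Eventually.of_forall fun _ => gaussianPDF_lt_top)] at h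
    simpa [toReal_gaussianPDF] using h
  have hd : ∀ y : ℝ, HasDerivAt (fun y => gaussianPDFReal 0 1 y * y ^ (n + 1))
      ((n + 1) * (gaussianPDFReal 0 1 y * y ^ n) - gaussianPDFReal 0 1 y * y ^ (n + 2)) y := by
    intro y
    have h1 : HasDerivAt (fun y => gaussianPDFReal 0 1 y) (gaussianPDFReal 0 1 y * (-y)) y := by
      simp only [gaussianPDFReal_def]
      have := (((hasDerivAt_id y).sub_const 0).pow 2).neg.div_const (2 * ((1 : NNReal) : ℝ))
      refine (this.exp.const_mul ((√(2 * Real.pi * ((1 : NNReal) : ℝ)))⁻¹)).congr_deriv ?_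
      simp
      ring
    have h2 := (hasDerivAt_id y).pow (n + 1)
    refine (h1.mul h2).congr_deriv ?_
    simp
    ring
  have h0 := integral_eq_zero_of_hasDerivAt_of_integrable hd
    (((key n).const_mul _).sub (key (n + 2))) (key (n + 1))
  rw [integral_sub ((key n).const_mul _) (key (n + 2)), integral_const_mul] at h0
  rw [integral_gaussianReal_eq_integral_smul one_ne_zero,
    integral_gaussianReal_eq_integral_smul one_ne_zero]
  simp only [smul_eq_mul]
  linarith

/-- The standard Gaussian law on `ℝ^d`. -/
abbrev stdLaw (d : ℕ) : Measure (Fin d → ℝ) := Measure.pi fun _ => gaussianReal 0 1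

lemma integrable_monomial_stdLaw {d : ℕ} (s : Fin d → ℕ) :
    Integrable (fun z : Fin d → ℝ => ∏ i, z i ^ s i) (stdLaw d) :=
  Integrable.fintype_prod (f := fun i (y : ℝ) => y ^ s i)
    fun i => integrable_pow_gaussianReal (s i)

lemma integrable_eval_stdLaw {d : ℕ} (p : MvPolynomial (Fin d) ℝ) :
    Integrable (fun z : Fin d → ℝ => MvPolynomial.eval z p) (stdLaw d) := by
  induction p using MvPolynomial.induction_on' with
  | monomial s a =>
    simp only [MvPolynomial.eval_monomial, Finsupp.prod_pow]
    exact (integrable_monomial_stdLaw _).const_mul a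
  | add p q hp hq =>
    simp only [map_add]
    exact hp.add hq

/-- Gaussian integration by parts for polynomials. -/
lemma integral_mul_eval_stdLaw {d : ℕ} (a : Fin d) (p : MvPolynomial (Fin d) ℝ) :
    ∫ z, z a * MvPolynomial.eval z p ∂(stdLaw d)
      = ∫ z, MvPolynomial.eval z (MvPolynomial.pderiv a p) ∂(stdLaw d) := by
  have hInt : ∀ q : MvPolynomial (Fin d) ℝ,
      Integrable (fun z : Fin d → ℝ => z a * MvPolynomial.eval z q) (stdLaw d) := fun q => by
    have := integrable_eval_stdLaw (MvPolynomial.X a * q)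
    simpa only [map_mul, MvPolynomial.eval_X] using this
  have hmon : ∀ s : Fin d → ℕ, ∫ z, ∏ i, z i ^ s i ∂(stdLaw d)
      = ∏ i, ∫ y : ℝ, y ^ s i ∂(gaussianReal 0 1) := fun s =>
    integral_fintype_prod_eq_prod (fun i (y : ℝ) => y ^ s i)
  induction p using MvPolynomial.induction_on' with
  | monomial s c =>
    simp only [MvPolynomial.pderiv_monomial, MvPolynomial.eval_monomial, Finsupp.prod_pow]
    have h1 : ∀ z : Fin d → ℝ, z a * (c * ∏ i, z i ^ s i)
        = c * ∏ i, z i ^ (s + Finsupp.single a 1 : Fin d →₀ ℕ) i := by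
      intro z
      rw [mul_left_comm]
      congr 1
      simp only [Finsupp.add_apply, pow_add, Finset.prod_mul_distrib]
      rw [mul_comm]
      congr 1
      rw [Finset.prod_eq_single a] <;> simp +contextual [eq_comm]
    simp only [h1, integral_const_mul, hmon]
    rw [mul_assoc]
    congr 1
    rw [← Finset.mul_prod_erase _ _ (Finset.mem_univ a),
      ← Finset.mul_prod_erase (Finset.univ) (fun i => ∫ y : ℝ,
        y ^ (s - Finsupp.single a 1 : Fin d →₀ ℕ) i ∂(gaussianReal 0 1)) (Finset.mem_univ a),
      ← mul_assoc]
    congr 1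
    · simp only [Finsupp.add_apply, Finsupp.single_eq_same, Finsupp.tsub_apply]
      -- For exponent zero the truncated subtraction is harmless: the derivative carries the factor
      -- `s a = 0`, and the left side is the mean of a centered Gaussian.
      rcases h : s a with _ | n
      · simp
      · rw [integral_pow_add_two_gaussianReal]
        simp
    · refine Finset.prod_congr rfl fun i hi => ?_
      have : a ≠ i := (Finset.ne_of_mem_erase hi).symm
      simp [this]
  | add p q hp hq =>
    simp only [map_add, mul_add]
    rw [integral_add (hInt p) (hInt q), hp, hq,
      integral_add (integrable_eval_stdLaw _) (integrable_eval_stdLaw _)]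

/-- The sup norm is attained at some coordinate, so its power is at most the sum of the powers of
the coordinates. -/
lemma integrable_norm_pow_stdLaw {d : ℕ} (n : ℕ) :
    Integrable (fun z : Fin d → ℝ => ‖z‖ ^ n) (stdLaw d) := by
  rcases Nat.eq_zero_or_pos n with rfl | hn
  · simp
  have h : Integrable (fun z : Fin d → ℝ => ∑ i, |z i| ^ n) (stdLaw d) := by
    refine integrable_finsetSum _ fun i _ => ?_
    have := (integrable_eval_stdLaw (d := d) (MvPolynomial.X i ^ n)).abs
    simpa [abs_pow] using this
  refine h.mono (by fun_prop) (Eventually.of_forall fun z => ?_)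
  rw [Real.norm_of_nonneg (by positivity), Real.norm_of_nonneg (by positivity)]
  rcases isEmpty_or_nonempty (Fin d) with hd | hd
  · simp [Subsingleton.elim z 0, hn.ne']
  · obtain ⟨i, hi⟩ := exists_eq_ciSup_of_finite (f := fun i => ‖z i‖)
    have : ‖z‖ = |z i| := by
      rw [← Real.norm_eq_abs, hi]
      refine le_antisymm ?_ (ciSup_le fun j => norm_le_pi_norm z j)
      exact (pi_norm_le_iff_of_nonneg (Real.iSup_nonneg fun _ => norm_nonneg _)).2
        fun j => le_ciSup (f := fun i => ‖z i‖) (Finite.bddAbove_range _) j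
    rw [this]
    exact Finset.single_le_sum (f := fun i => |z i| ^ n) (fun _ _ => by positivity)
      (Finset.mem_univ i)

lemma integrable_one_add_norm_pow_stdLaw {d : ℕ} (n : ℕ) :
    Integrable (fun z : Fin d → ℝ => (1 + ‖z‖) ^ n) (stdLaw d) := by
  simp only [add_comm (1 : ℝ), add_pow, one_pow, mul_one]
  exact integrable_finsetSum _ fun i _ => (integrable_norm_pow_stdLaw i).mul_const _

lemma integrable_of_norm_le_pow {d : ℕ} {f : (Fin d → ℝ) → ℝ} (hf : Measurable f) (C : ℝ) (n : ℕ)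
    (h : ∀ z, |f z| ≤ C * (1 + ‖z‖) ^ n) : Integrable f (stdLaw d) :=
  ((integrable_one_add_norm_pow_stdLaw n).const_mul C).mono' hf.aestronglyMeasurable
    (Eventually.of_forall h)

lemma measurePreserving_neg_stdLaw (d : ℕ) :
    MeasurePreserving (fun z : Fin d → ℝ => -z) (stdLaw d) (stdLaw d) := by
  have h : ∀ _ : Fin d, MeasurePreserving (fun y : ℝ => -y) (gaussianReal 0 1) (gaussianReal 0 1) :=
    fun _ => ⟨measurable_neg, by simpa using gaussianReal_map_neg (μ := 0) (v := 1)⟩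
  exact measurePreserving_pi (fun _ : Fin d => gaussianReal 0 1) (fun _ => gaussianReal 0 1) h

lemma integral_eq_zero_of_odd {d : ℕ} {f : (Fin d → ℝ) → ℝ} (hf : ∀ z, f (-z) = -f z) :
    ∫ z, f z ∂(stdLaw d) = 0 := by
  have h := (measurePreserving_neg_stdLaw d).integral_comp'
    (f := MeasurableEquiv.neg (Fin d → ℝ)) f
  change ∫ z, f (-z) ∂(stdLaw d) = _ at h
  simp only [hf, integral_neg] at h
  linarith

lemma integral_incrementLaw {d : ℕ} {h : ℝ} (hh : 0 < h) (f : (Fin d → ℝ) → ℝ) :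
    ∫ w, f w ∂(incrementLaw d h) = ∫ z, f (Real.sqrt h • z) ∂(stdLaw d) := by
  have hs : Real.sqrt h ≠ 0 := (Real.sqrt_pos.2 hh).ne'
  have h1 : ∀ _ : Fin d, MeasurePreserving (fun y : ℝ => Real.sqrt h * y) (gaussianReal 0 1)
      (gaussianReal 0 h.toNNReal) := fun _ => ⟨by fun_prop, by
    rw [gaussianReal_map_const_mul]
    congr 1
    · simp
    · ext; simp [Real.sq_sqrt hh.le, hh.le]⟩
  have h2 : MeasurePreserving (MeasurableEquiv.smul₀ (α := Fin d → ℝ) (Real.sqrt h) hs)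
      (stdLaw d) (incrementLaw d h) :=
    measurePreserving_pi (fun _ : Fin d => gaussianReal 0 1) (fun _ => gaussianReal 0 h.toNNReal) h1
  exact (h2.integral_comp' f).symm

/-! ### The polynomial weights -/

/-- The linear form `η · X` as a polynomial. -/
def linPoly {d : ℕ} (η : Fin d → ℝ) : MvPolynomial (Fin d) ℝ :=
  ∑ i, MvPolynomial.C (η i) * MvPolynomial.X i

lemma eval_linPoly {d : ℕ} (η z : Fin d → ℝ) :
    MvPolynomial.eval z (linPoly η) = ∑ i, η i * z i := by
  simp [linPoly]

lemma pderiv_linPoly {d : ℕ} (η : Fin d → ℝ) (a : Fin d) :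
    MvPolynomial.pderiv a (linPoly η) = MvPolynomial.C (η a) := by
  simp [linPoly, MvPolynomial.pderiv_X, Pi.single_apply]

lemma integrable_linear_pow {d : ℕ} (η : Fin d → ℝ) (p : ℕ) :
    Integrable (fun z : Fin d → ℝ => (∑ i, η i * z i) ^ p) (stdLaw d) := by
  have := integrable_eval_stdLaw (linPoly η ^ p)
  simpa only [map_pow, eval_linPoly] using this

lemma integral_mul_linear_pow_succ {d : ℕ} (η : Fin d → ℝ) (p : ℕ) (a : Fin d) :
    ∫ z, z a * (∑ i, η i * z i) ^ (p + 1) ∂(stdLaw d)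
      = (p + 1) * η a * ∫ z, (∑ i, η i * z i) ^ p ∂(stdLaw d) := by
  have h := integral_mul_eval_stdLaw a (linPoly η ^ (p + 1))
  simp only [map_pow, eval_linPoly, MvPolynomial.pderiv_pow, pderiv_linPoly, map_mul,
    MvPolynomial.eval_C, map_natCast] at h
  rw [h, ← integral_const_mul]
  refine integral_congr_ae (Eventually.of_forall fun z => ?_)
  simp
  ring

/-- Expand one factor `η · z` and integrate by parts in each coordinate. For a unit vector this is
the moment recursion of one standard normal variable, which identifies the even moments of `η · z`
without computing its law. -/
lemma integral_linear_pow_add_two {d : ℕ} {η : Fin d → ℝ} (hη : ∑ i, η i ^ 2 = 1) (p : ℕ) :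
    ∫ z, (∑ i, η i * z i) ^ (p + 2) ∂(stdLaw d)
      = (p + 1) * ∫ z, (∑ i, η i * z i) ^ p ∂(stdLaw d) := by
  have h : ∀ z : Fin d → ℝ, (∑ i, η i * z i) ^ (p + 2)
      = ∑ a, η a * (z a * (∑ i, η i * z i) ^ (p + 1)) := by
    intro z
    rw [pow_succ', Finset.sum_mul]
    exact Finset.sum_congr rfl fun a _ => by ring
  have hInt : ∀ a, Integrable (fun z : Fin d → ℝ => η a * (z a * (∑ i, η i * z i) ^ (p + 1)))
      (stdLaw d) := by
    intro a
    have := (integrable_eval_stdLaw (MvPolynomial.X a * linPoly η ^ (p + 1))).const_mul (η a)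
    simpa only [map_mul, map_pow, MvPolynomial.eval_X, eval_linPoly] using this
  simp only [h]
  rw [integral_finsetSum _ fun a _ => hInt a]
  simp only [integral_const_mul, integral_mul_linear_pow_succ]
  calc _ = ∑ a, η a ^ 2 * ((p + 1) * ∫ z, (∑ i, η i * z i) ^ p ∂(stdLaw d)) :=
        Finset.sum_congr rfl fun a _ => by ring
    _ = _ := by rw [← Finset.sum_mul, hη, one_mul]

lemma integral_linear_pow_two_mul {d : ℕ} {η : Fin d → ℝ} (hη : ∑ i, η i ^ 2 = 1) (q : ℕ) :
    ∫ z, (∑ i, η i * z i) ^ (2 * q) ∂(stdLaw d) = ∫ y : ℝ, y ^ (2 * q) ∂(gaussianReal 0 1) := by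
  induction q with
  | zero => simp
  | succ q ih =>
    rw [mul_add, mul_one, integral_linear_pow_add_two hη, integral_pow_add_two_gaussianReal, ih]

lemma integral_pow_two_mul_gaussianReal_pos (q : ℕ) :
    0 < ∫ y : ℝ, y ^ (2 * q) ∂(gaussianReal 0 1) := by
  induction q with
  | zero => simp
  | succ q ih =>
    rw [mul_add, mul_one, integral_pow_add_two_gaussianReal]
    positivity

/-- Integrating `z a` by parts, the derivative hits either `z b` or the power; a second integration
by parts and the moment recursion bring both contributions back to the same moment. -/
lemma integral_mul_mul_linear_pow {d : ℕ} {η : Fin d → ℝ} (hη : ∑ i, η i ^ 2 = 1) (p : ℕ)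
    (a b : Fin d) :
    ∫ z, z a * z b * (∑ i, η i * z i) ^ (p + 2) ∂(stdLaw d)
      = ((if a = b then 1 else 0) + (p + 2) * η a * η b)
        * ∫ z, (∑ i, η i * z i) ^ (p + 2) ∂(stdLaw d) := by
  have h := integral_mul_eval_stdLaw a (MvPolynomial.X b * linPoly η ^ (p + 2))
  simp only [map_mul, map_pow, eval_linPoly, MvPolynomial.eval_X, Derivation.leibniz,
    MvPolynomial.pderiv_pow, pderiv_linPoly, MvPolynomial.pderiv_X, smul_eq_mul, map_add,
    MvPolynomial.eval_C, map_natCast] at h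
  simp only [mul_assoc]
  rw [h]
  have hInt : Integrable (fun z : Fin d → ℝ => ((p : ℝ) + 2) * η a
      * (z b * (∑ i, η i * z i) ^ (p + 1))) (stdLaw d) := by
    have := (integrable_eval_stdLaw (MvPolynomial.X b * linPoly η ^ (p + 1))).const_mul
      (((p : ℝ) + 2) * η a)
    simpa only [map_mul, map_pow, MvPolynomial.eval_X, eval_linPoly] using this
  have hsplit : ∀ z : Fin d → ℝ,
      z b * (((p + 2 : ℕ) : ℝ) * (∑ i, η i * z i) ^ (p + 2 - 1) * η a)
        + (∑ i, η i * z i) ^ (p + 2) *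
          MvPolynomial.eval z (Pi.single (M := fun _ => MvPolynomial (Fin d) ℝ) a 1 b)
      = ((p : ℝ) + 2) * η a * (z b * (∑ i, η i * z i) ^ (p + 1))
        + (if a = b then 1 else 0) * (∑ i, η i * z i) ^ (p + 2) := by
    intro z
    rw [Pi.single_apply]
    simp only [eq_comm (a := a)]
    by_cases hab : b = a <;> simp [hab] <;> ring
  simp only [hsplit]
  rw [integral_add hInt ((integrable_linear_pow η (p + 2)).const_mul _), integral_const_mul,
    integral_const_mul, integral_mul_linear_pow_succ, integral_linear_pow_add_two hη]
  ring

lemma integral_mul_stdLaw {d : ℕ} (a b : Fin d) :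
    ∫ z, z a * z b ∂(stdLaw d) = if a = b then 1 else 0 := by
  have h := integral_mul_eval_stdLaw a (MvPolynomial.X b)
  simp only [MvPolynomial.eval_X, MvPolynomial.pderiv_X, Pi.single_apply] at h
  rw [h]
  simp only [eq_comm (a := a)]
  by_cases hab : b = a <;> simp [hab]

/-- The linear part carries the drift correction `g`. The part with absolute values makes the weight
nonnegative, and being even in `w` it does not contribute to the first moments. -/
lemma poly1_eq {d : ℕ} (g w : Fin d → ℝ) : poly1 g w = ∑ i, (g i * w i + |g i| * |w i|) := by
  rw [poly1, Finset.mul_sum]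
  refine Finset.sum_congr rfl fun i _ => ?_
  rcases le_total 0 (g i) with h1 | h1 <;> rcases le_total 0 (w i) with h2 | h2 <;>
    simp [h1, h2, abs_of_nonneg, abs_of_nonpos] <;> ring

lemma poly1_nonneg {d : ℕ} (g w : Fin d → ℝ) : 0 ≤ poly1 g w := by
  rw [poly1_eq]
  refine Finset.sum_nonneg fun i _ => ?_
  rw [← abs_mul]
  linarith [neg_abs_le (g i * w i)]

lemma poly1_smul {d : ℕ} {c : ℝ} (hc : 0 ≤ c) (g w : Fin d → ℝ) :
    poly1 g (c • w) = c * poly1 g w := by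
  simp only [poly1_eq, Finset.mul_sum, Pi.smul_apply, smul_eq_mul, abs_mul, abs_of_nonneg hc]
  exact Finset.sum_congr rfl fun i _ => by ring

lemma poly1_le {d : ℕ} (g w : Fin d → ℝ) : poly1 g w ≤ 2 * d * ‖g‖ * ‖w‖ := by
  rw [poly1_eq]
  calc _ ≤ ∑ _i : Fin d, 2 * (‖g‖ * ‖w‖) := by
        refine Finset.sum_le_sum fun i _ => ?_
        have h : |g i| * |w i| ≤ ‖g‖ * ‖w‖ :=
          mul_le_mul (norm_le_pi_norm g i) (norm_le_pi_norm w i) (abs_nonneg _) (norm_nonneg _)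
        have := le_abs_self (g i * w i)
        rw [abs_mul] at this
        linarith
    _ = _ := by simp; ring

lemma continuous_poly1 {d : ℕ} :
    Continuous fun q : (Fin d → ℝ) × (Fin d → ℝ) => poly1 q.1 q.2 := by
  simp only [poly1_eq]
  fun_prop

lemma integrable_coord_mul_poly1 {d : ℕ} (g : Fin d → ℝ) (a : Fin d) :
    Integrable (fun z => z a * poly1 g z) (stdLaw d) := by
  have hm : Measurable fun z : Fin d → ℝ => z a * poly1 g z := by
    simp only [poly1_eq]
    fun_prop
  refine integrable_of_norm_le_pow hm (2 * d * ‖g‖) 2 fun z => ?_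
  rw [abs_mul, abs_of_nonneg (poly1_nonneg g z)]
  calc |z a| * poly1 g z ≤ ‖z‖ * (2 * d * ‖g‖ * ‖z‖) :=
        mul_le_mul (norm_le_pi_norm z a) (poly1_le g z) (poly1_nonneg g z) (norm_nonneg _)
    _ = 2 * d * ‖g‖ * ‖z‖ ^ 2 := by ring
    _ ≤ _ := by gcongr; linarith

lemma integral_coord_mul_poly1 {d : ℕ} (g : Fin d → ℝ) (a : Fin d) :
    ∫ z, z a * poly1 g z ∂(stdLaw d) = g a := by
  have hlin : ∀ b, Integrable (fun z : Fin d → ℝ => g b * (z a * z b)) (stdLaw d) := fun b => by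
    have := (integrable_eval_stdLaw (MvPolynomial.X a * MvPolynomial.X b)).const_mul (g b)
    simpa only [map_mul, MvPolynomial.eval_X] using this
  have habs : ∀ b, Integrable (fun z : Fin d → ℝ => |g b| * (z a * |z b|)) (stdLaw d) := fun b => by
    refine integrable_of_norm_le_pow (by fun_prop) |g b| 2 fun z => ?_
    rw [abs_mul, abs_abs, abs_mul, abs_abs]
    have h1 : |z a| ≤ 1 + ‖z‖ := (norm_le_pi_norm z a).trans (by linarith)
    have h2 : |z b| ≤ 1 + ‖z‖ := (norm_le_pi_norm z b).trans (by linarith)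
    rw [pow_two]
    gcongr
  have h : ∀ z : Fin d → ℝ, z a * poly1 g z
      = ∑ b, (g b * (z a * z b) + |g b| * (z a * |z b|)) := by
    intro z
    rw [poly1_eq, Finset.mul_sum]
    exact Finset.sum_congr rfl fun b _ => by ring
  simp only [h]
  rw [integral_finsetSum]
  swap
  · exact fun b _ => (hlin b).add (habs b)
  calc _ = ∑ b, g b * (if a = b then 1 else 0) := by
        refine Finset.sum_congr rfl fun b _ => ?_
        rw [integral_add (hlin b) (habs b), integral_const_mul, integral_const_mul,
          integral_mul_stdLaw, integral_eq_zero_of_odd (f := fun z => z a * |z b|) (by simp)]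
        simp
    _ = g a := by simp

lemma dCoeff_pos (k : ℕ) : 0 < dCoeff k := by
  unfold dCoeff
  positivity

/-- This normalization makes `poly2` centered. -/
lemma cCoeff_mul (k : ℕ) :
    cCoeff k * ∫ y : ℝ, y ^ (4 * k + 2) ∂(gaussianReal 0 1) = dCoeff k := by
  have h := integral_pow_two_mul_gaussianReal_pos (2 * k + 1)
  rw [show 2 * (2 * k + 1) = 4 * k + 2 by ring] at h
  rw [cCoeff, dCoeff]
  field_simp

lemma cCoeff_pos (k : ℕ) : 0 < cCoeff k := by
  have h := integral_pow_two_mul_gaussianReal_pos (2 * k + 1)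
  rw [show 2 * (2 * k + 1) = 4 * k + 2 by ring] at h
  unfold cCoeff
  positivity

lemma colNorm_sq {d l : ℕ} (S : Matrix (Fin d) (Fin l) ℝ) (j : Fin l) :
    colNorm S j ^ 2 = ∑ i, S i j ^ 2 :=
  Real.sq_sqrt (Finset.sum_nonneg fun _ _ => sq_nonneg _)

lemma sum_colNorm_sq {d l : ℕ} (S : Matrix (Fin d) (Fin l) ℝ) :
    ∑ j, colNorm S j ^ 2 = (S * Sᵀ).trace := by
  simp only [colNorm_sq, Matrix.trace, Matrix.diag, Matrix.mul_apply, Matrix.transpose_apply]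
  rw [Finset.sum_comm]
  simp [pow_two]

lemma ratio_eq {d l : ℕ} (S : Matrix (Fin d) (Fin l) ℝ) (j : Fin l) (z : Fin d → ℝ) :
    (Sᵀ *ᵥ z) j / colNorm S j = ∑ i, (S i j / colNorm S j) * z i := by
  simp only [Matrix.mulVec, dotProduct, Matrix.transpose_apply, Finset.sum_div]
  exact Finset.sum_congr rfl fun i _ => by ring

lemma sum_ratio_sq {d l : ℕ} {S : Matrix (Fin d) (Fin l) ℝ} {j : Fin l} (h : colNorm S j ≠ 0) :
    ∑ i, (S i j / colNorm S j) ^ 2 = 1 := by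
  simp only [div_pow]
  rw [← Finset.sum_div, ← colNorm_sq]
  field_simp

lemma ratio_sq_le {d l : ℕ} (S : Matrix (Fin d) (Fin l) ℝ) (j : Fin l) (z : Fin d → ℝ) :
    ((Sᵀ *ᵥ z) j / colNorm S j) ^ 2 ≤ d * ‖z‖ ^ 2 := by
  by_cases h : colNorm S j = 0
  · rw [h]
    simp
    positivity
  · rw [ratio_eq]
    refine (Finset.sum_mul_sq_le_sq_mul_sq _ _ _).trans ?_
    rw [sum_ratio_sq h, one_mul]
    calc ∑ i, z i ^ 2 ≤ ∑ _i : Fin d, ‖z‖ ^ 2 :=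
          Finset.sum_le_sum fun i _ => by
            rw [← sq_abs]
            exact pow_le_pow_left₀ (abs_nonneg _) (norm_le_pi_norm z i) 2
      _ = _ := by simp

lemma ratio_pow_nonneg {d l : ℕ} (S : Matrix (Fin d) (Fin l) ℝ) (j : Fin l) (z : Fin d → ℝ)
    (k : ℕ) : 0 ≤ ((Sᵀ *ᵥ z) j / colNorm S j) ^ (4 * k + 2) :=
  Even.pow_nonneg ⟨2 * k + 1, by ring⟩ _

lemma ratio_pow_le {d l : ℕ} (S : Matrix (Fin d) (Fin l) ℝ) (j : Fin l) (z : Fin d → ℝ) (k : ℕ) :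
    ((Sᵀ *ᵥ z) j / colNorm S j) ^ (4 * k + 2) ≤ (d * ‖z‖ ^ 2) ^ (2 * k + 1) := by
  rw [show 4 * k + 2 = 2 * (2 * k + 1) by ring, pow_mul]
  exact pow_le_pow_left₀ (sq_nonneg _) (ratio_sq_le S j z) _

/-- The powers in `poly2` are even, so only the constants `-d_k` are negative. They add up to minus
the trace divided by `4k+2`, which is at least `-1`. -/
lemma one_add_poly2_nonneg {d l : ℕ} {S : Matrix (Fin d) (Fin l) ℝ} {k : ℕ}
    (hS : (S * Sᵀ).trace ≤ 4 * (k : ℝ) + 2) (z : Fin d → ℝ) : 0 ≤ 1 + poly2 S k z := by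
  have h1 : -(∑ j, colNorm S j ^ 2 * dCoeff k) ≤ poly2 S k z := by
    rw [poly2, ← Finset.sum_neg_distrib]
    refine Finset.sum_le_sum fun j _ => ?_
    have := mul_nonneg (sq_nonneg (colNorm S j))
      (mul_nonneg (cCoeff_pos k).le (ratio_pow_nonneg S j z k))
    linarith
  rw [← Finset.sum_mul, sum_colNorm_sq] at h1
  have h2 : (S * Sᵀ).trace * dCoeff k ≤ 1 := by
    rw [dCoeff, mul_one_div]
    exact div_le_one_of_le₀ hS (by positivity)
  linarith

lemma abs_poly2_term_le {d l : ℕ} (S : Matrix (Fin d) (Fin l) ℝ) (k : ℕ) (z : Fin d → ℝ)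
    (j : Fin l) :
    |colNorm S j ^ 2 * (cCoeff k * ((Sᵀ *ᵥ z) j / colNorm S j) ^ (4 * k + 2) - dCoeff k)|
      ≤ colNorm S j ^ 2 * (cCoeff k * (d * ‖z‖ ^ 2) ^ (2 * k + 1) + dCoeff k) := by
  rw [abs_mul, abs_of_nonneg (sq_nonneg _)]
  refine mul_le_mul_of_nonneg_left ?_ (sq_nonneg _)
  refine (abs_sub _ _).trans ?_
  rw [abs_of_nonneg (mul_nonneg (cCoeff_pos k).le (ratio_pow_nonneg S j z k)),
    abs_of_pos (dCoeff_pos k)]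
  exact add_le_add_left (mul_le_mul_of_nonneg_left (ratio_pow_le S j z k) (cCoeff_pos k).le) _

/-- The constant in the growth bound for `poly2`. -/
def poly2Bound (d k : ℕ) : ℝ := cCoeff k * (d : ℝ) ^ (2 * k + 1) + dCoeff k

lemma abs_poly2_le {d l : ℕ} (S : Matrix (Fin d) (Fin l) ℝ) (k : ℕ) (z : Fin d → ℝ) :
    |poly2 S k z| ≤ (∑ j, colNorm S j ^ 2) * poly2Bound d k * (1 + ‖z‖) ^ (4 * k + 2) := by
  have hc := (cCoeff_pos k).le
  have hd := (dCoeff_pos k).le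
  refine (Finset.abs_sum_le_sum_abs _ _).trans
    ((Finset.sum_le_sum fun j _ => abs_poly2_term_le S k z j).trans ?_)
  rw [← Finset.sum_mul, mul_assoc]
  refine mul_le_mul_of_nonneg_left ?_ (Finset.sum_nonneg fun _ _ => sq_nonneg _)
  have h1 : (1 : ℝ) ≤ (1 + ‖z‖) ^ (4 * k + 2) := one_le_pow₀ (by linarith [norm_nonneg z])
  have h2 : (‖z‖ ^ 2) ^ (2 * k + 1) ≤ (1 + ‖z‖) ^ (4 * k + 2) := by
    rw [← pow_mul, show 2 * (2 * k + 1) = 4 * k + 2 by ring]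
    exact pow_le_pow_left₀ (norm_nonneg _) (by linarith) _
  rw [poly2Bound, mul_pow, add_mul, ← mul_assoc]
  have h3 := mul_le_mul_of_nonneg_left h2 (mul_nonneg hc (by positivity : (0 : ℝ) ≤ (d : ℝ) ^ (2 * k + 1)))
  have h4 := mul_le_mul_of_nonneg_left h1 hd
  linarith

lemma measurable_poly2 {d l : ℕ} (S : Matrix (Fin d) (Fin l) ℝ) (k : ℕ) :
    Measurable (poly2 S k) := by
  unfold poly2
  simp only [ratio_eq]
  fun_prop

lemma poly2_neg {d l : ℕ} (S : Matrix (Fin d) (Fin l) ℝ) (k : ℕ) (z : Fin d → ℝ) :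
    poly2 S k (-z) = poly2 S k z := by
  unfold poly2
  refine Finset.sum_congr rfl fun j _ => ?_
  rw [Matrix.mulVec_neg, Pi.neg_apply, neg_div, Even.neg_pow ⟨2 * k + 1, by ring⟩]

lemma continuous_colNorm {d l : ℕ} (j : Fin l) :
    Continuous fun S : Fin d → Fin l → ℝ => colNorm (Matrix.of S) j := by
  unfold colNorm
  simp only [Matrix.of_apply]
  fun_prop

/-- The normalized column is discontinuous where a column vanishes. There the summand is controlled
by the squared column norm times a quantity depending only on `z`, so it tends to `0`, its value at
a zero column. -/
lemma continuous_poly2 {d l : ℕ} (k : ℕ) (z : Fin d → ℝ) :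
    Continuous fun S : Fin d → Fin l → ℝ => poly2 (Matrix.of S) k z := by
  unfold poly2
  refine continuous_finsetSum _ fun j _ => continuous_iff_continuousAt.2 fun S₀ => ?_
  by_cases h : colNorm (Matrix.of S₀) j = 0
  · have hzero : colNorm (Matrix.of S₀) j ^ 2 * (cCoeff k * (((Matrix.of S₀)ᵀ *ᵥ z) j
        / colNorm (Matrix.of S₀) j) ^ (4 * k + 2) - dCoeff k) = 0 := by simp [h]
    rw [ContinuousAt, hzero]
    refine squeeze_zero_norm (fun S => abs_poly2_term_le (Matrix.of S) k z j) ?_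
    have hc : Continuous fun S : Fin d → Fin l → ℝ => colNorm (Matrix.of S) j ^ 2
        * (cCoeff k * (d * ‖z‖ ^ 2) ^ (2 * k + 1) + dCoeff k) :=
      ((continuous_colNorm j).pow 2).mul continuous_const
    have := hc.tendsto S₀
    simpa [h] using this
  · have hn : Continuous fun S : Fin d → Fin l → ℝ => ((Matrix.of S)ᵀ *ᵥ z) j := by
      simp only [Matrix.mulVec, dotProduct, Matrix.transpose_apply, Matrix.of_apply]
      fun_prop
    have hcn := (continuous_colNorm (d := d) j).continuousAt (x := S₀)
    exact (hcn.pow 2).mul ((continuousAt_const.mul ((hn.continuousAt.div hcn h).pow _)).sub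
      continuousAt_const)

lemma integrable_poly2 {d l : ℕ} (S : Matrix (Fin d) (Fin l) ℝ) (k : ℕ) :
    Integrable (poly2 S k) (stdLaw d) :=
  integrable_of_norm_le_pow (measurable_poly2 S k) _ _ (abs_poly2_le S k)

lemma integral_poly2 {d l : ℕ} (S : Matrix (Fin d) (Fin l) ℝ) (k : ℕ) :
    ∫ z, poly2 S k z ∂(stdLaw d) = 0 := by
  unfold poly2
  simp only [ratio_eq]
  have hInt : ∀ j, Integrable (fun z : Fin d → ℝ => cCoeff k *
      (∑ i, S i j / colNorm S j * z i) ^ (4 * k + 2)) (stdLaw d) := fun j =>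
    (integrable_linear_pow _ _).const_mul _
  rw [integral_finsetSum]
  swap
  · exact fun j _ => ((hInt j).sub (integrable_const _)).const_mul _
  refine Finset.sum_eq_zero fun j _ => ?_
  by_cases h : colNorm S j = 0
  · simp [h]
  · rw [integral_const_mul, integral_sub (hInt j) (integrable_const _), integral_const_mul,
      show 4 * k + 2 = 2 * (2 * k + 1) by ring, integral_linear_pow_two_mul (sum_ratio_sq h),
      show 2 * (2 * k + 1) = 4 * k + 2 by ring, cCoeff_mul]
    simp

lemma integrable_coord_mul_coord_mul_poly2 {d l : ℕ} (S : Matrix (Fin d) (Fin l) ℝ) (k : ℕ)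
    (a b : Fin d) : Integrable (fun z => z a * z b * poly2 S k z) (stdLaw d) := by
  refine integrable_of_norm_le_pow (by have := measurable_poly2 S k; fun_prop)
    ((∑ j, colNorm S j ^ 2) * poly2Bound d k) (1 + 1 + (4 * k + 2)) fun z => ?_
  have h1 : |z a| ≤ 1 + ‖z‖ := (norm_le_pi_norm z a).trans (by linarith)
  have h2 : |z b| ≤ 1 + ‖z‖ := (norm_le_pi_norm z b).trans (by linarith)
  have h3 := abs_poly2_le S k z
  rw [abs_mul, abs_mul, pow_add, pow_add, pow_one]
  calc _ ≤ ((1 + ‖z‖) * (1 + ‖z‖)) * ((∑ j, colNorm S j ^ 2) * poly2Bound d k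
        * (1 + ‖z‖) ^ (4 * k + 2)) := by gcongr
    _ = _ := by ring

/-- For a nonzero column with unit direction `η`, the fourth-order moment formula yields an identity
part and an `η ηᵀ` part. The constant `d_k` cancels the identity part because `c_k E[N^(4k+2)] =
d_k`, and `(4k+2) d_k = 1` leaves exactly the column times its transpose. -/
lemma integral_coord_mul_coord_mul_poly2 {d l : ℕ} (S : Matrix (Fin d) (Fin l) ℝ) (k : ℕ)
    (a b : Fin d) : ∫ z, z a * z b * poly2 S k z ∂(stdLaw d) = (S * Sᵀ) a b := by
  unfold poly2
  simp only [ratio_eq, Finset.mul_sum]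
  have h2 : Integrable (fun z : Fin d → ℝ => z a * z b) (stdLaw d) := by
    have := integrable_eval_stdLaw (MvPolynomial.X a * MvPolynomial.X b)
    simpa only [map_mul, MvPolynomial.eval_X] using this
  have h3 : ∀ η : Fin d → ℝ, Integrable (fun z : Fin d → ℝ =>
      z a * z b * (∑ i, η i * z i) ^ (4 * k + 2)) (stdLaw d) := fun η => by
    have := integrable_eval_stdLaw (MvPolynomial.X a * MvPolynomial.X b * linPoly η ^ (4 * k + 2))
    simpa only [map_mul, map_pow, MvPolynomial.eval_X, eval_linPoly] using this
  have hre : ∀ (j : Fin l) (z : Fin d → ℝ), z a * z b * (colNorm S j ^ 2 *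
      (cCoeff k * (∑ i, S i j / colNorm S j * z i) ^ (4 * k + 2) - dCoeff k))
      = colNorm S j ^ 2 * cCoeff k * (z a * z b * (∑ i, S i j / colNorm S j * z i) ^ (4 * k + 2))
        - colNorm S j ^ 2 * dCoeff k * (z a * z b) := fun j z => by ring
  simp only [hre]
  rw [integral_finsetSum]
  swap
  · exact fun j _ => ((h3 _).const_mul _).sub (h2.const_mul _)
  rw [Matrix.mul_apply]
  refine Finset.sum_congr rfl fun j _ => ?_
  rw [integral_sub ((h3 _).const_mul _) (h2.const_mul _), integral_const_mul, integral_const_mul,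
    integral_mul_stdLaw, Matrix.transpose_apply]
  by_cases h : colNorm S j = 0
  · have hz : S a j = 0 := by
      have h4 := colNorm_sq S j
      rw [h, zero_pow two_ne_zero, eq_comm,
        Finset.sum_eq_zero_iff_of_nonneg fun _ _ => sq_nonneg _] at h4
      simpa using h4 a (Finset.mem_univ a)
    simp [h, hz]
  · rw [integral_mul_mul_linear_pow (sum_ratio_sq h),
      show 4 * k + 2 = 2 * (2 * k + 1) by ring, integral_linear_pow_two_mul (sum_ratio_sq h),
      show 2 * (2 * k + 1) = 4 * k + 2 by ring]
    have hc := cCoeff_mul k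
    have hd : (4 * (k : ℝ) + 2) * dCoeff k = 1 := by
      rw [dCoeff]
      field_simp
    have e : ∀ (i x y I : ℝ), colNorm S j ^ 2 * cCoeff k * ((i + x * (S a j / colNorm S j)
        * (S b j / colNorm S j)) * I) - colNorm S j ^ 2 * dCoeff k * i
        = colNorm S j ^ 2 * i * (cCoeff k * I - dCoeff k)
          + x * (cCoeff k * I) * (S a j * S b j) := by
      intro i x y I
      field_simp
      ring
    rw [e _ _ 0, hc]
    push_cast
    rw [hd]
    ring

/-! ### Suprema of parametrized families -/

/-- Continuous convergence is uniform near a compact set. Applied to the closure of the set of limit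
parameters, it gives uniformity over the index set `C`, which need not carry any topology. -/
lemma tendstoUniformly_comp_of_continuous_convergence {ι C Θ : Type*} [PseudoMetricSpace Θ]
    [ProperSpace Θ] {L : Filter ι} {F : ι → Θ → ℝ} {F' : Θ → ℝ} {θ : ι → C → Θ} {θ' : C → Θ}
    (hF' : Continuous F')
    (hF : ∀ a, Tendsto (fun q : ι × Θ => F q.1 q.2) (L ×ˢ 𝓝 a) (𝓝 (F' a)))
    (hθ : TendstoUniformly θ θ' L) (hb : Bornology.IsBounded (range θ')) :
    TendstoUniformly (fun i c => F i (θ i c)) (fun c => F' (θ' c)) L := by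
  rw [Metric.tendstoUniformly_iff]
  intro ε hε
  have key : ∃ η > 0, ∀ᶠ i in L, ∀ a ∈ closure (range θ'), ∀ b, dist b a < η →
      dist (F' a) (F i b) < ε := by
    refine hb.isCompact_closure.induction_on
      (p := fun s => ∃ η > 0, ∀ᶠ i in L, ∀ a ∈ s, ∀ b, dist b a < η → dist (F' a) (F i b) < ε)
      ⟨1, one_pos, by simp⟩ ?_ ?_ ?_
    · rintro s t hst ⟨η, hη, h⟩
      exact ⟨η, hη, h.mono fun i hi a ha => hi a (hst ha)⟩
    · rintro s t ⟨η, hη, h⟩ ⟨η', hη', h'⟩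
      refine ⟨min η η', lt_min hη hη', ?_⟩
      filter_upwards [h, h'] with i hi hi'
      rintro a (ha | ha) b hb
      · exact hi a ha b (hb.trans_le (min_le_left _ _))
      · exact hi' a ha b (hb.trans_le (min_le_right _ _))
    · intro a₀ _
      have h1 := (Metric.tendsto_nhds.1 (hF a₀)) (ε / 2) (by positivity)
      obtain ⟨p, hp, q, hq, hpq⟩ := eventually_prod_iff.1 h1
      obtain ⟨η₁, hη₁, hball⟩ := Metric.eventually_nhds_iff.1 hq
      obtain ⟨η₂, hη₂, hcont⟩ := Metric.continuousAt_iff.1 (hF'.continuousAt (x := a₀)) (ε / 2)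
        (by positivity)
      refine ⟨Metric.ball a₀ (min (η₁ / 2) η₂), mem_nhdsWithin_of_mem_nhds
        (Metric.ball_mem_nhds _ (by positivity)), η₁ / 2, by positivity, ?_⟩
      filter_upwards [hp] with i hi a ha b hb
      rw [Metric.mem_ball, lt_min_iff] at ha
      have h2 : dist (F i b) (F' a₀) < ε / 2 := hpq hi (hball (by
        linarith [dist_triangle b a a₀]))
      have h3 := hcont ha.2
      rw [dist_comm] at h2
      linarith [dist_triangle (F' a) (F' a₀) (F i b)]
  obtain ⟨η, hη, hkey⟩ := key
  filter_upwards [hkey, Metric.tendstoUniformly_iff.1 hθ η hη] with i hi hi' c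
  exact hi _ (subset_closure ⟨c, rfl⟩) _ (by rw [dist_comm]; exact hi' c)

lemma tendsto_iSup_of_tendstoUniformly {ι C : Type*} [Nonempty C] {L : Filter ι} {f : ι → C → ℝ}
    {g : C → ℝ} (h : TendstoUniformly f g L) (hg : BddAbove (range g)) :
    Tendsto (fun i => ⨆ c, f i c) L (𝓝 (⨆ c, g c)) := by
  rw [Metric.tendsto_nhds]
  intro ε hε
  filter_upwards [Metric.tendstoUniformly_iff.1 h (ε / 2) (by positivity)] with i hi
  have h1 : ∀ c, |g c - f i c| < ε / 2 := hi
  have hle : ∀ c, f i c ≤ (⨆ c, g c) + ε / 2 := fun c => by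
    linarith [le_ciSup hg c, (abs_lt.1 (h1 c)).1]
  have hf : BddAbove (range (f i)) := ⟨_, by rintro _ ⟨c, rfl⟩; exact hle c⟩
  have hge : ⨆ c, g c ≤ (⨆ c, f i c) + ε / 2 := ciSup_le fun c => by
    linarith [le_ciSup hf c, (abs_lt.1 (h1 c)).2]
  rw [Real.dist_eq, abs_lt]
  constructor <;> linarith [ciSup_le hle]

/-- All the affine functions decrease in `r` with slopes between two positive constants, so their
supremum vanishes exactly at the supremum of their zeros. The upper bound on the slopes is what
prevents the supremum from being negative at that point. -/
lemma iSup_sub_mul_eq_zero_iff {C : Type*} [Nonempty C] {a b : C → ℝ} {b₀ b₁ : ℝ} (hb₀ : 0 < b₀)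
    (hb : ∀ c, b₀ ≤ b c) (hb' : ∀ c, b c ≤ b₁) (ha : BddAbove (range a)) (r : ℝ) :
    ⨆ c, (a c - b c * r) = 0 ↔ r = ⨆ c, a c / b c := by
  obtain ⟨R, hR⟩ := ha
  have hR' : ∀ c, a c ≤ R := fun c => hR ⟨c, rfl⟩
  have hbpos : ∀ c, 0 < b c := fun c => hb₀.trans_le (hb c)
  have hdiv : BddAbove (range fun c => a c / b c) := by
    refine ⟨max R 0 / b₀, ?_⟩
    rintro _ ⟨c, rfl⟩
    exact div_le_div₀ (le_max_right _ _) ((hR' c).trans (le_max_left _ _)) hb₀ (hb c)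
  have hsub : ∀ r : ℝ, BddAbove (range fun c => a c - b c * r) := by
    refine fun r => ⟨R + b₁ * |r|, ?_⟩
    rintro _ ⟨c, rfl⟩
    have h1 : -(b c * r) ≤ b c * |r| := by
      rw [← mul_neg]
      exact mul_le_mul_of_nonneg_left (neg_le_abs r) (hbpos c).le
    have h2 := mul_le_mul_of_nonneg_right (hb' c) (abs_nonneg r)
    have := hR' c
    simp only
    linarith
  set ρ := ⨆ c, a c / b c with hρ
  have hle : ∀ c, a c ≤ b c * ρ := fun c => by
    rw [mul_comm]
    exact (div_le_iff₀ (hbpos c)).1 (le_ciSup hdiv c)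
  constructor
  · intro h
    refine le_antisymm ?_ (ciSup_le fun c => ?_)
    · by_contra hlt
      push Not at hlt
      have : ⨆ c, (a c - b c * r) ≤ b₀ * (ρ - r) := ciSup_le fun c => by
        have := mul_le_mul_of_nonneg_right (hb c) (sub_nonneg.2 hlt.le)
        linarith [hle c]
      nlinarith
    · rw [div_le_iff₀ (hbpos c)]
      linarith [le_ciSup (hsub r) c, mul_comm r (b c)]
  · rintro rfl
    refine le_antisymm (ciSup_le fun c => by linarith [hle c]) ?_
    refine le_of_forall_pos_le_add fun ε hε => ?_
    have hb₁ : 0 < b₁ := (hbpos (Classical.arbitrary C)).trans_le (hb' _)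
    -- A quotient within `ε / b₁` of the supremum leaves, after multiplication by its denominator,
    -- an error of at most `ε`.
    obtain ⟨c, hc⟩ := exists_lt_of_lt_ciSup
      (show ρ - ε / b₁ < ⨆ c, a c / b c from sub_lt_self _ (by positivity))
    rw [lt_div_iff₀ (hbpos c)] at hc
    have h1 := le_ciSup (hsub ρ) c
    have h2 : ε / b₁ * b c ≤ ε := by
      rw [div_mul_eq_mul_div, div_le_iff₀ hb₁]
      exact mul_le_mul_of_nonneg_left (hb' c) hε.le
    linarith [mul_comm ρ (b c)]

/-- Second order Taylor formula with Lagrange remainder. -/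
lemma exists_taylor_two {E : Type*} [NormedAddCommGroup E] [NormedSpace ℝ E] {Φ : E → ℝ}
    (hΦ : ContDiff ℝ 2 Φ) (q v : E) :
    ∃ s ∈ Icc (0 : ℝ) 1, Φ (q + v) = Φ q + fderiv ℝ Φ q v
      + (1 / 2) * fderiv ℝ (fderiv ℝ Φ) (q + s • v) v v := by
  have hd : Differentiable ℝ Φ := hΦ.differentiable (by norm_num)
  have hd' : Differentiable ℝ (fderiv ℝ Φ) :=
    (hΦ.fderiv_right (m := 1) (by norm_num)).differentiable (by norm_num)
  have hline : ∀ s : ℝ, HasDerivAt (fun s : ℝ => q + s • v) v s := fun s => by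
    simpa using ((hasDerivAt_id s).smul_const v).const_add q
  have h1 : ∀ s : ℝ, HasDerivAt (fun s : ℝ => Φ (q + s • v)) (fderiv ℝ Φ (q + s • v) v) s :=
    fun s => (hd _).hasFDerivAt.comp_hasDerivAt s (hline s)
  have h2 : ∀ s : ℝ, HasDerivAt (fun s : ℝ => fderiv ℝ Φ (q + s • v) v)
      (fderiv ℝ (fderiv ℝ Φ) (q + s • v) v v) s := fun s => by
    have := (hd' _).hasFDerivAt.comp_hasDerivAt s (hline s)
    exact this.clm_apply (hasDerivAt_const s v) |>.congr_deriv (by simp)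
  set f : ℝ → ℝ := fun s => Φ (q + s • v) with hf
  have e1 : deriv f = fun s => fderiv ℝ Φ (q + s • v) v := funext fun s => (h1 s).deriv
  have hfc : ContDiff ℝ 2 f := hΦ.comp (by fun_prop)
  obtain ⟨s, hs, h⟩ := taylor_mean_remainder_lagrange_iteratedDeriv (n := 1) (f := f)
    (x₀ := 0) (x := 1) zero_ne_one hfc.contDiffOn
  have hw : derivWithin f (uIcc 0 1) 0 = fderiv ℝ Φ q v := by
    rw [(h1 0).differentiableAt.derivWithin (uniqueDiffOn_uIcc zero_ne_one 0 left_mem_uIcc)]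
    simpa using congrFun e1 0
  have e2 : iteratedDeriv 2 f s = fderiv ℝ (fderiv ℝ Φ) (q + s • v) v v := by
    rw [iteratedDeriv_succ, iteratedDeriv_one, e1]
    exact (h2 s).deriv
  rw [taylorWithinEval_succ, taylor_within_zero_eval, iteratedDerivWithin_one, hw, e2] at h
  rw [uIoo_of_lt zero_lt_one] at hs
  refine ⟨s, ⟨hs.1.le, hs.2.le⟩, ?_⟩
  simp [hf] at h
  linarith

/-! ### One step of the scheme, in terms of a standard Gaussian vector -/

/-- The tuple `(f₀, σ₀, g, Σ, δ, ℓ)` of coefficients at one point and one control. -/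
abbrev Coef (d l : ℕ) : Type :=
  (Fin d → ℝ) × (Fin d → Fin d → ℝ) × (Fin d → ℝ) × (Fin d → Fin l → ℝ) × ℝ × ℝ

namespace Coef

variable {d l : ℕ}

/-- The uncontrolled drift. -/
abbrev drift (θ : Coef d l) : Fin d → ℝ := θ.1
/-- The uncontrolled diffusion matrix. -/
abbrev diff (θ : Coef d l) : Matrix (Fin d) (Fin d) ℝ := Matrix.of θ.2.1
/-- The vector `g`. -/
abbrev g (θ : Coef d l) : Fin d → ℝ := θ.2.2.1
/-- The matrix `Σ`. -/
abbrev S (θ : Coef d l) : Matrix (Fin d) (Fin l) ℝ := Matrix.of θ.2.2.2.1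
/-- The discount rate. -/
abbrev disc (θ : Coef d l) : ℝ := θ.2.2.2.2.1
/-- The running reward. -/
abbrev cost (θ : Coef d l) : ℝ := θ.2.2.2.2.2

/-- The Euler step driven by a standard Gaussian vector. -/
def move (h : ℝ) (θ : Coef d l) (x z : Fin d → ℝ) : Fin d → ℝ :=
  x + h • θ.drift + Real.sqrt h • (θ.diff *ᵥ z)

/-- The total weight of the scheme. -/
def weight (k : ℕ) (h : ℝ) (θ : Coef d l) (z : Fin d → ℝ) : ℝ :=
  1 + Real.sqrt h * poly1 θ.g z + poly2 θ.S k z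

/-- The total mass of the weight. -/
def mass (h : ℝ) (θ : Coef d l) : ℝ := 1 + Real.sqrt h * ∫ z, poly1 θ.g z ∂(stdLaw d)

/-- The weighted mean of `φ` after one step. -/
def mean (k : ℕ) (h : ℝ) (θ : Coef d l) (x : Fin d → ℝ) (φ : (Fin d → ℝ) → ℝ) : ℝ :=
  ∫ z, φ (θ.move h x z) * θ.weight k h z ∂(stdLaw d)

/-- The expression whose supremum over the controls is the scheme. -/
def step (k : ℕ) (h : ℝ) (θ : Coef d l) (x : Fin d → ℝ) (r : ℝ) (φ : (Fin d → ℝ) → ℝ) : ℝ :=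
  (h⁻¹ * θ.mean k h x φ + θ.cost) - (h⁻¹ * θ.mass h + θ.disc) * r

/-- A constant for the growth of the weight. -/
def weightBound (k : ℕ) (h : ℝ) (θ : Coef d l) : ℝ :=
  1 + Real.sqrt h * (2 * d * ‖θ.g‖) + (∑ j, colNorm θ.S j ^ 2) * poly2Bound d k

lemma measurable_move (h : ℝ) (θ : Coef d l) (x : Fin d → ℝ) : Measurable (θ.move h x) := by
  unfold move
  have : Continuous fun z : Fin d → ℝ => θ.diff *ᵥ z := by fun_prop
  exact (continuous_const.add (this.const_smul (Real.sqrt h))).measurable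

lemma measurable_poly1 (g : Fin d → ℝ) : Measurable (poly1 g) :=
  (continuous_poly1.comp (Continuous.prodMk_right g)).measurable

lemma measurable_weight (k : ℕ) (h : ℝ) (θ : Coef d l) : Measurable (θ.weight k h) := by
  unfold weight
  have := measurable_poly1 θ.g
  have := measurable_poly2 θ.S k
  fun_prop

lemma integrable_poly1 (g : Fin d → ℝ) : Integrable (poly1 g) (stdLaw d) := by
  refine integrable_of_norm_le_pow (measurable_poly1 g) (2 * d * ‖g‖) 1 fun z => ?_
  rw [abs_of_nonneg (poly1_nonneg g z), pow_one]
  refine (poly1_le g z).trans (mul_le_mul_of_nonneg_left (by linarith) (by positivity))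

lemma abs_weight_le (k : ℕ) (h : ℝ) (θ : Coef d l) (z : Fin d → ℝ) :
    |θ.weight k h z| ≤ θ.weightBound k h * (1 + ‖z‖) ^ (4 * k + 2) := by
  have h1 : (1 : ℝ) ≤ (1 + ‖z‖) ^ (4 * k + 2) := one_le_pow₀ (by linarith [norm_nonneg z])
  have h2 : ‖z‖ ≤ (1 + ‖z‖) ^ (4 * k + 2) :=
    (by linarith : ‖z‖ ≤ 1 + ‖z‖).trans (le_self_pow₀ (by linarith [norm_nonneg z]) (by omega))
  have h3 : |Real.sqrt h * poly1 θ.g z|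
      ≤ Real.sqrt h * (2 * d * ‖θ.g‖) * (1 + ‖z‖) ^ (4 * k + 2) := by
    rw [abs_of_nonneg (mul_nonneg (Real.sqrt_nonneg h) (poly1_nonneg _ _)), mul_assoc]
    refine mul_le_mul_of_nonneg_left ((poly1_le _ _).trans ?_) (Real.sqrt_nonneg h)
    exact mul_le_mul_of_nonneg_left h2 (by positivity)
  have h4 := abs_poly2_le θ.S k z
  unfold weight
  refine (abs_add_le _ _).trans ((add_le_add ((abs_add_le _ _).trans (add_le_add le_rfl h3))
    h4).trans ?_)
  rw [weightBound, abs_one]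
  linarith

lemma integrable_weight (k : ℕ) (h : ℝ) (θ : Coef d l) :
    Integrable (θ.weight k h) (stdLaw d) :=
  integrable_of_norm_le_pow (measurable_weight k h θ) _ _ (abs_weight_le k h θ)

lemma integral_weight (k : ℕ) (h : ℝ) (θ : Coef d l) :
    ∫ z, θ.weight k h z ∂(stdLaw d) = θ.mass h := by
  unfold weight mass
  have h1 := (integrable_poly1 θ.g).const_mul (Real.sqrt h)
  have h2 : Integrable (fun z => 1 + Real.sqrt h * poly1 θ.g z) (stdLaw d) :=
    (integrable_const _).add h1
  rw [integral_add h2 (integrable_poly2 _ _),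
    integral_add (integrable_const _) h1, integral_const_mul, integral_poly2]
  simp

lemma one_le_mass (h : ℝ) (θ : Coef d l) : 1 ≤ θ.mass h := by
  have := mul_nonneg (Real.sqrt_nonneg h)
    (integral_nonneg (μ := stdLaw d) fun z => poly1_nonneg θ.g z)
  unfold mass
  linarith

/-- Nonnegativity of the weight is what makes the scheme monotone in `φ`. -/
lemma weight_nonneg {k : ℕ} {θ : Coef d l} (hθ : (θ.S * θ.Sᵀ).trace ≤ 4 * (k : ℝ) + 2) (h : ℝ)
    (z : Fin d → ℝ) : 0 ≤ θ.weight k h z := by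
  have h1 := one_add_poly2_nonneg hθ z
  have h2 := mul_nonneg (Real.sqrt_nonneg h) (poly1_nonneg θ.g z)
  unfold weight
  linarith

lemma integrable_mean (k : ℕ) (h : ℝ) (θ : Coef d l) (x : Fin d → ℝ) {φ : (Fin d → ℝ) → ℝ}
    (hφ : Measurable φ) {B : ℝ} (hB : ∀ y, |φ y| ≤ B) :
    Integrable (fun z => φ (θ.move h x z) * θ.weight k h z) (stdLaw d) :=
  (integrable_weight k h θ).bdd_mul (hφ.comp (measurable_move h θ x)).aestronglyMeasurable
    (Eventually.of_forall fun _ => hB _)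

lemma mean_mono {k : ℕ} {θ : Coef d l} (hθ : (θ.S * θ.Sᵀ).trace ≤ 4 * (k : ℝ) + 2) (h : ℝ)
    (x : Fin d → ℝ) {φ₁ φ₂ : (Fin d → ℝ) → ℝ} (hφ₁ : Measurable φ₁) (hφ₂ : Measurable φ₂)
    {B₁ B₂ : ℝ} (hB₁ : ∀ y, |φ₁ y| ≤ B₁) (hB₂ : ∀ y, |φ₂ y| ≤ B₂) (hle : ∀ y, φ₁ y ≤ φ₂ y) :
    θ.mean k h x φ₁ ≤ θ.mean k h x φ₂ :=
  integral_mono (integrable_mean k h θ x hφ₁ hB₁) (integrable_mean k h θ x hφ₂ hB₂)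
    fun z => mul_le_mul_of_nonneg_right (hle _) (weight_nonneg hθ h z)

lemma mean_const (k : ℕ) (h : ℝ) (θ : Coef d l) (x : Fin d → ℝ) (B : ℝ) :
    θ.mean k h x (fun _ => B) = B * θ.mass h := by
  unfold mean
  rw [integral_const_mul, integral_weight]

lemma mean_add_const (k : ℕ) (h : ℝ) (θ : Coef d l) (x : Fin d → ℝ) {φ : (Fin d → ℝ) → ℝ}
    (hφ : Measurable φ) {B : ℝ} (hB : ∀ y, |φ y| ≤ B) (c : ℝ) :
    θ.mean k h x (fun y => φ y + c) = θ.mean k h x φ + c * θ.mass h := by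
  unfold mean
  simp only [add_mul]
  rw [integral_add (integrable_mean k h θ x hφ hB) ((integrable_weight k h θ).const_mul c),
    integral_const_mul, integral_weight]

lemma abs_mean_le {k : ℕ} {θ : Coef d l} (hθ : (θ.S * θ.Sᵀ).trace ≤ 4 * (k : ℝ) + 2) (h : ℝ)
    (x : Fin d → ℝ) {φ : (Fin d → ℝ) → ℝ} (hφ : Measurable φ) {B : ℝ} (hB : ∀ y, |φ y| ≤ B) :
    |θ.mean k h x φ| ≤ B * θ.mass h := by
  rw [← mean_const k h θ x, abs_le, ← neg_one_mul, ← mul_comm, mul_neg_one]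
  constructor
  · rw [neg_le, mean_const]
    have := mean_mono hθ h x (measurable_const (a := -B)) hφ (fun _ => le_rfl) hB
      (fun y => (abs_le.1 (hB y)).1)
    rw [mean_const] at this
    linarith
  · exact mean_mono hθ h x hφ measurable_const hB (fun _ => le_rfl) fun y => (abs_le.1 (hB y)).2

lemma weight_tendsto {ι : Type*} {L : Filter ι} {k : ℕ} {h : ι → ℝ} {θ : ι → Coef d l} {h₀ : ℝ}
    {θ₀ : Coef d l} (hh : Tendsto h L (𝓝 h₀)) (hθ : Tendsto θ L (𝓝 θ₀)) (z : Fin d → ℝ) :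
    Tendsto (fun i => (θ i).weight k (h i) z) L (𝓝 (θ₀.weight k h₀ z)) := by
  have hc : Continuous fun q : ℝ × Coef d l => q.2.weight k q.1 z := by
    unfold weight
    have h1 : Continuous fun q : ℝ × Coef d l => poly1 q.2.g z :=
      continuous_poly1.comp (f := fun q : ℝ × Coef d l => (q.2.g, z)) (by fun_prop)
    have h2 : Continuous fun q : ℝ × Coef d l => poly2 q.2.S k z :=
      (continuous_poly2 k z).comp (by fun_prop)
    have h3 : Continuous fun q : ℝ × Coef d l => Real.sqrt q.1 := by fun_prop
    exact (continuous_const.add (h3.mul h1)).add h2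
  exact (hc.tendsto (h₀, θ₀)).comp (hh.prodMk_nhds hθ)

lemma weightBound_eventually {ι : Type*} {L : Filter ι} {k : ℕ} {h : ι → ℝ} {θ : ι → Coef d l}
    {h₀ : ℝ} {θ₀ : Coef d l} (hh : Tendsto h L (𝓝 h₀)) (hθ : Tendsto θ L (𝓝 θ₀)) :
    ∀ᶠ i in L, (θ i).weightBound k (h i) ≤ θ₀.weightBound k h₀ + 1 := by
  have hc : Continuous fun q : ℝ × Coef d l => q.2.weightBound k q.1 := by
    unfold weightBound
    have h2 : ∀ j, Continuous fun q : ℝ × Coef d l => colNorm q.2.S j := fun j =>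
      (continuous_colNorm j).comp (f := fun q : ℝ × Coef d l => q.2.2.2.2.1) (by fun_prop)
    fun_prop
  exact ((hc.tendsto (h₀, θ₀)).comp (hh.prodMk_nhds hθ)).eventually_le_const (by simp)

lemma move_tendsto {ι : Type*} {L : Filter ι} {h : ι → ℝ} {θ : ι → Coef d l} {x : ι → Fin d → ℝ}
    {h₀ : ℝ} {θ₀ : Coef d l} {x₀ : Fin d → ℝ} (hh : Tendsto h L (𝓝 h₀)) (hθ : Tendsto θ L (𝓝 θ₀))
    (hx : Tendsto x L (𝓝 x₀)) (z : Fin d → ℝ) :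
    Tendsto (fun i => (θ i).move (h i) (x i) z) L (𝓝 (θ₀.move h₀ x₀ z)) := by
  have hc : Continuous fun q : (ℝ × Coef d l) × (Fin d → ℝ) => q.1.2.move q.1.1 q.2 z := by
    unfold move
    refine continuous_pi fun i => ?_
    simp only [Pi.add_apply, Pi.smul_apply, Matrix.mulVec, dotProduct, Matrix.of_apply]
    fun_prop
  exact (hc.tendsto ((h₀, θ₀), x₀)).comp ((hh.prodMk_nhds hθ).prodMk_nhds hx)

lemma mean_tendsto {ι : Type*} {L : Filter ι} [L.IsCountablyGenerated] {k : ℕ} {h : ℝ}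
    {θ : ι → Coef d l} {x : ι → Fin d → ℝ} {θ₀ : Coef d l} {x₀ : Fin d → ℝ}
    (hθ : Tendsto θ L (𝓝 θ₀)) (hx : Tendsto x L (𝓝 x₀)) {φ : (Fin d → ℝ) → ℝ}
    (hφ : Continuous φ) {B : ℝ} (hB : ∀ y, |φ y| ≤ B) :
    Tendsto (fun i => (θ i).mean k h (x i) φ) L (𝓝 (θ₀.mean k h x₀ φ)) := by
  refine tendsto_integral_filter_of_dominated_convergence
    (fun z => B * ((θ₀.weightBound k h + 1) * (1 + ‖z‖) ^ (4 * k + 2))) ?_ ?_ ?_ ?_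
  · exact Eventually.of_forall fun i => (integrable_mean k h _ _ hφ.measurable hB).1
  · filter_upwards [weightBound_eventually (k := k) (tendsto_const_nhds (x := h)) hθ] with i hi
    refine Eventually.of_forall fun z => ?_
    rw [norm_mul]
    exact mul_le_mul (hB _) ((abs_weight_le k h (θ i) z).trans
      (mul_le_mul_of_nonneg_right hi (by positivity))) (norm_nonneg _)
      ((abs_nonneg _).trans (hB 0))
  · exact ((integrable_one_add_norm_pow_stdLaw _).const_mul _).const_mul _
  · exact Eventually.of_forall fun z => ((hφ.tendsto _).comp
      (move_tendsto tendsto_const_nhds hθ hx z)).mul (weight_tendsto tendsto_const_nhds hθ z)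

lemma continuous_mass (h : ℝ) : Continuous fun θ : Coef d l => θ.mass h := by
  refine continuous_iff_continuousAt.2 fun θ₀ => ?_
  -- The mass is the weighted mean of the constant `1`, so the continuity of `mean` applies.
  have := mean_tendsto (k := 0) (h := h) (L := 𝓝 θ₀) tendsto_id (tendsto_const_nhds (x := 0))
    (continuous_const (y := (1 : ℝ))) (B := 1) (by simp)
  simp only [mean_const, one_mul, id] at this
  exact this

lemma mass_le (h : ℝ) (θ : Coef d l) :
    θ.mass h ≤ 1 + Real.sqrt h * (2 * d * ‖θ.g‖ * ∫ z, ‖z‖ ∂(stdLaw d)) := by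
  have hn : Integrable (fun z : Fin d → ℝ => ‖z‖) (stdLaw d) := by
    simpa using integrable_norm_pow_stdLaw (d := d) 1
  unfold mass
  have h1 : ∫ z, poly1 θ.g z ∂(stdLaw d) ≤ 2 * d * ‖θ.g‖ * ∫ z, ‖z‖ ∂(stdLaw d) := by
    rw [← integral_const_mul]
    exact integral_mono (integrable_poly1 _) (hn.const_mul _) fun z => poly1_le _ _
  have := mul_le_mul_of_nonneg_left h1 (Real.sqrt_nonneg h)
  linarith

end Coef

/-- The coefficients of the scheme at the control `c` and the point `x`. -/
def coef {d l : ℕ} {M U : Type*} (P : ControlProblem d M U) (A : SchemeData d l M U) (c : M × U)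
    (x : Fin d → ℝ) : Coef d l :=
  (A.f₀ c.1 x, fun i j => A.σ₀ c.1 x i j, A.g c.1 x c.2, fun i j => A.S c.1 x c.2 i j,
    P.δ c.1 x c.2, P.cost c.1 x c.2)

/-- Substitute `w = √h z`: `poly1` is positively homogeneous, and the argument of `poly2` becomes
`z` itself. The `r` inside `D1` joins the `r` of the time difference to form the mass. Measurability
and boundedness of `φ` allow the integrals to be split. -/
lemma K_eq_iSup_step {d l : ℕ} {M U : Type*} (P : ControlProblem d M U) (A : SchemeData d l M U)
    (k : ℕ) {h : ℝ} (hh : 0 < h) (x : Fin d → ℝ) (r : ℝ) {φ : (Fin d → ℝ) → ℝ}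
    (hφ : Measurable φ) {B : ℝ} (hB : ∀ y, |φ y| ≤ B) :
    SchemeData.K P A k h x r φ = -⨆ c, (coef P A c x).step k h x r φ := by
  unfold SchemeData.K
  congr 1
  refine iSup_congr fun c => ?_
  set θ := coef P A c x with hθ
  have hs : 0 < Real.sqrt h := Real.sqrt_pos.2 hh

  have hmove : ∀ z, A.eulerStep c.1 h x (Real.sqrt h • z) = θ.move h x z := fun z => by
    simp only [SchemeData.eulerStep, Coef.move, Matrix.mulVec_smul]
    rfl
  have hφm : Measurable fun z => φ (θ.move h x z) := hφ.comp (Coef.measurable_move h θ x)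
  have i0 : Integrable (fun z => φ (θ.move h x z)) (stdLaw d) := by
    have := (integrable_const (μ := stdLaw d) (1 : ℝ)).bdd_mul hφm.aestronglyMeasurable
      (Eventually.of_forall fun z => hB _)
    simpa using this
  have i1 : Integrable (fun z => φ (θ.move h x z) * poly1 θ.g z) (stdLaw d) :=
    (Coef.integrable_poly1 θ.g).bdd_mul hφm.aestronglyMeasurable (Eventually.of_forall fun z => hB _)
  have i2 : Integrable (fun z => φ (θ.move h x z) * poly2 θ.S k z) (stdLaw d) :=
    (integrable_poly2 θ.S k).bdd_mul hφm.aestronglyMeasurable (Eventually.of_forall fun z => hB _)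
  have e0 : A.D0 c.1 h φ x = ∫ z, φ (θ.move h x z) ∂(stdLaw d) := by
    rw [SchemeData.D0, integral_incrementLaw hh]
    simp only [hmove]
  have e1 : A.D1 c.1 h (A.g c.1 x c.2) r φ x = h⁻¹ * Real.sqrt h *
      (∫ z, φ (θ.move h x z) * poly1 θ.g z ∂(stdLaw d) - r * ∫ z, poly1 θ.g z ∂(stdLaw d)) := by
    rw [SchemeData.D1, integral_incrementLaw hh, ← integral_const_mul,
      ← integral_sub i1 ((Coef.integrable_poly1 θ.g).const_mul r), ← integral_const_mul]
    refine integral_congr_ae (Eventually.of_forall fun z => ?_)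
    simp only [hmove, smul_smul]
    rw [poly1_smul (by positivity)]
    change _ * (_ * poly1 θ.g z) = _
    ring
  have e2 : A.D2 c.1 h (A.S c.1 x c.2) k φ x
      = h⁻¹ * ∫ z, φ (θ.move h x z) * poly2 θ.S k z ∂(stdLaw d) := by
    rw [SchemeData.D2, integral_incrementLaw hh]
    simp only [hmove, smul_smul, inv_mul_cancel₀ hs.ne', one_smul]
    rfl
  have em : θ.mean k h x φ = ∫ z, φ (θ.move h x z) ∂(stdLaw d)
      + Real.sqrt h * ∫ z, φ (θ.move h x z) * poly1 θ.g z ∂(stdLaw d)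
      + ∫ z, φ (θ.move h x z) * poly2 θ.S k z ∂(stdLaw d) := by
    have i3 : Integrable (fun z => φ (θ.move h x z)
        + Real.sqrt h * (φ (θ.move h x z) * poly1 θ.g z)) (stdLaw d) := i0.add (i1.const_mul _)
    rw [← integral_const_mul, ← integral_add i0 (i1.const_mul _), ← integral_add i3 i2]
    refine integral_congr_ae (Eventually.of_forall fun z => ?_)
    simp only [Coef.weight]
    ring
  rw [e0, e1, e2, Coef.step, em, Coef.mass]
  change _ + θ.cost - θ.disc * r + _ + _ = _
  ring

/-! ### Solution of the discretized equation -/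

lemma exists_forall_of_finite {M : Type*} [Finite M] {p : M → ℝ → Prop}
    (hp : ∀ m C C', C ≤ C' → p m C → p m C') (h : ∀ m, ∃ C, p m C) : ∃ C, ∀ m, p m C := by
  choose C hC using h
  obtain ⟨B, hB⟩ := (Set.finite_range C).bddAbove
  exact ⟨B, fun m => hp m _ _ (hB ⟨m, rfl⟩) (hC m)⟩

/-- Uniform bounds for the coefficients of the scheme, and the condition on `k`. -/
structure CoefBound {d l : ℕ} {M U : Type*} (P : ControlProblem d M U) (A : SchemeData d l M U)
    (k : ℕ) (R : ℝ) : Prop where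
  nonneg : 0 ≤ R
  ψ : ∀ x, |P.ψ x| ≤ R
  drift : ∀ c x, ‖(coef P A c x).1‖ ≤ R
  diff : ∀ c x, ‖(coef P A c x).2.1‖ ≤ R
  g : ∀ c x, ‖(coef P A c x).2.2.1‖ ≤ R
  S : ∀ c x, ‖(coef P A c x).2.2.2.1‖ ≤ R
  disc : ∀ c x, -R ≤ (coef P A c x).disc
  disc' : ∀ x, ∃ D, ∀ c, (coef P A c x).disc ≤ D
  cost : ∀ c x, |(coef P A c x).cost| ≤ R
  trace : ∀ c x, ((coef P A c x).S * (coef P A c x).Sᵀ).trace ≤ 4 * (k : ℝ) + 2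

lemma exists_coefBound {d l : ℕ} {M U : Type*} [Finite M] {P : ControlProblem d M U}
    {A : SchemeData d l M U} {k : ℕ} (hfin : P.FiniteHamiltonian) (hbdd : BoundedData P A)
    (hk : ∀ m x u, (A.S m x u * (A.S m x u)ᵀ).trace ≤ 4 * (k : ℝ) + 2) :
    ∃ R, CoefBound P A k R := by
  obtain ⟨Cψ, hψ⟩ := hbdd.ψ
  have hM : ∃ C, ∀ m, 0 ≤ C ∧ (∀ x u, |P.cost m x u| ≤ C) ∧ (∀ x i j, |A.σ₀ m x i j| ≤ C) ∧
      (∀ x i, |A.f₀ m x i| ≤ C) ∧ (∀ x u i, |A.g m x u i| ≤ C) ∧ (∀ x u i j, |A.S m x u i j| ≤ C) ∧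
      ∀ x u, -C ≤ P.δ m x u := by
    refine exists_forall_of_finite ?_ fun m => ?_
    · rintro m C C' hC ⟨h0, h1, h2, h3, h4, h5, h6⟩
      exact ⟨h0.trans hC, fun x u => (h1 x u).trans hC, fun x i j => (h2 x i j).trans hC,
        fun x i => (h3 x i).trans hC, fun x u i => (h4 x u i).trans hC,
        fun x u i j => (h5 x u i j).trans hC, fun x u => (neg_le_neg hC).trans (h6 x u)⟩
    · obtain ⟨C1, h1⟩ := hbdd.cost m
      obtain ⟨C2, h2⟩ := hbdd.σ₀ m
      obtain ⟨C3, h3⟩ := hbdd.f₀ m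
      obtain ⟨C4, h4⟩ := hbdd.g m
      obtain ⟨C5, h5⟩ := hbdd.S m
      obtain ⟨C6, h6⟩ := hbdd.δ m
      have e1 := le_abs_self C1
      have e2 := le_abs_self C2
      have e3 := le_abs_self C3
      have e4 := le_abs_self C4
      have e5 := le_abs_self C5
      have e6 := neg_abs_le C6
      have p1 := abs_nonneg C1
      have p2 := abs_nonneg C2
      have p3 := abs_nonneg C3
      have p4 := abs_nonneg C4
      have p5 := abs_nonneg C5
      have p6 := abs_nonneg C6
      refine ⟨|C1| + |C2| + |C3| + |C4| + |C5| + |C6|, by positivity,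
        fun x u => (h1 x u).trans (by linarith), fun x i j => (h2 x i j).trans (by linarith),
        fun x i => (h3 x i).trans (by linarith), fun x u i => (h4 x u i).trans (by linarith),
        fun x u i j => (h5 x u i j).trans (by linarith), fun x u => le_trans (by linarith) (h6 x u)⟩
  obtain ⟨C, hC⟩ := hM
  set R := max (max C Cψ) 0 with hR
  have hCR : C ≤ R := (le_max_left _ _).trans (le_max_left _ _)
  have hR0 : 0 ≤ R := le_max_right _ _
  refine ⟨R, hR0, fun x => (hψ x).trans ((le_max_right _ _).trans (le_max_left _ _)), ?_, ?_, ?_,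
    ?_, ?_, ?_, ?_, ?_⟩
  · exact fun c x => (pi_norm_le_iff_of_nonneg hR0).2 fun i =>
      ((hC c.1).2.2.2.1 x i).trans hCR
  · exact fun c x => (pi_norm_le_iff_of_nonneg hR0).2 fun i =>
      (pi_norm_le_iff_of_nonneg hR0).2 fun j => ((hC c.1).2.2.1 x i j).trans hCR
  · exact fun c x => (pi_norm_le_iff_of_nonneg hR0).2 fun i =>
      ((hC c.1).2.2.2.2.1 x c.2 i).trans hCR
  · exact fun c x => (pi_norm_le_iff_of_nonneg hR0).2 fun i =>
      (pi_norm_le_iff_of_nonneg hR0).2 fun j => ((hC c.1).2.2.2.2.2.1 x c.2 i j).trans hCR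
  · exact fun c x => (neg_le_neg hCR).trans ((hC c.1).2.2.2.2.2.2 x c.2)
  · intro x
    -- No upper bound on the discount rate is assumed. At `r = -1`, `p = 0`, `Γ = 0` finiteness of
    -- the Hamiltonian bounds `δ + ℓ` from above at the point `x`, and `ℓ` is bounded.
    obtain ⟨D, hD⟩ := hfin x (-1) 0 0 (by simp [Matrix.IsSymm])
    refine ⟨D + R, fun c => ?_⟩
    have h1 := hD ⟨c, rfl⟩
    simp only [ControlProblem.hamiltonianAt, mul_zero, Matrix.trace_zero, dotProduct_zero] at h1
    have h2 := (abs_le.1 (((hC c.1).2.1 x c.2).trans hCR)).1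
    change P.δ c.1 x c.2 ≤ _
    linarith
  · exact fun c x => ((hC c.1).2.1 x c.2).trans hCR
  · exact fun c x => hk c.1 x c.2

lemma tendstoUniformly_of_equicontinuousAt {M U X β : Type*} [Finite M] [TopologicalSpace X]
    [UniformSpace β] {F : M → U → X → β} {x₀ : X} (h : ∀ m, EquicontinuousAt (F m) x₀) :
    TendstoUniformly (fun x (c : M × U) => F c.1 c.2 x) (fun c => F c.1 c.2 x₀) (𝓝 x₀) := by
  intro V hV
  filter_upwards [eventually_all.2 fun m => h m V hV] with x hx
  exact fun c => hx c.1 c.2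

/-- Uniformity in `u` is the equicontinuity assumption; uniformity in `m` uses that `M` is finite.
-/
lemma tendstoUniformly_coef {d l : ℕ} {M U : Type*} [Finite M] {P : ControlProblem d M U}
    {A : SchemeData d l M U} (hcont : UniformlyContinuousData P A) (x₀ : Fin d → ℝ) :
    TendstoUniformly (fun x c => coef P A c x) (fun c => coef P A c x₀) (𝓝 x₀) := by
  have h1 := tendstoUniformly_of_equicontinuousAt (U := U) (F := fun m _ x => A.f₀ m x)
    (x₀ := x₀) fun m V hV =>
      ((hcont.f₀ m).continuous.continuousAt.eventually (UniformSpace.ball_mem_nhds _ hV)).mono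
        fun x hx _ => hx
  have hσ : ∀ m, UniformContinuous fun x => (A.σ₀ m x : Fin d → Fin d → ℝ) := hcont.σ₀
  have h2 := tendstoUniformly_of_equicontinuousAt (U := U)
    (F := fun m _ x => (A.σ₀ m x : Fin d → Fin d → ℝ)) (x₀ := x₀) fun m V hV =>
      ((hσ m).continuous.continuousAt.eventually (UniformSpace.ball_mem_nhds _ hV)).mono
        fun x hx _ => hx
  have h3 := tendstoUniformly_of_equicontinuousAt fun m => (hcont.g m).equicontinuous x₀
  have hS : ∀ m, UniformEquicontinuous fun (u : U) x => (A.S m x u : Fin d → Fin l → ℝ) := hcont.S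
  have h4 := tendstoUniformly_of_equicontinuousAt fun m => (hS m).equicontinuous x₀
  have h5 := tendstoUniformly_of_equicontinuousAt fun m => (hcont.δ m).equicontinuous x₀
  have h6 := tendstoUniformly_of_equicontinuousAt fun m => (hcont.cost m).equicontinuous x₀
  have key : ∀ {β γ : Type} [UniformSpace β] [UniformSpace γ] {F : (Fin d → ℝ) → M × U → β}
      {F' : M × U → β} {G : (Fin d → ℝ) → M × U → γ} {G' : M × U → γ},
      TendstoUniformly F F' (𝓝 x₀) → TendstoUniformly G G' (𝓝 x₀) →
      TendstoUniformly (fun x c => (F x c, G x c)) (fun c => (F' c, G' c)) (𝓝 x₀) := by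
    intro β γ _ _ F F' G G' hF hG V hV
    rw [uniformity_prod_eq_prod, mem_map, mem_prod_iff] at hV
    obtain ⟨V1, hV1, V2, hV2, hV⟩ := hV
    filter_upwards [hF V1 hV1, hG V2 hV2] with x hx hx' c
    exact hV (show ((F' c, F x c), (G' c, G x c)) ∈ V1 ×ˢ V2 from ⟨hx c, hx' c⟩)
  exact key h1 (key h2 (key h3 (key h4 (key h5 h6))))

lemma CoefBound.isBounded_range {d l : ℕ} {M U : Type*} {P : ControlProblem d M U}
    {A : SchemeData d l M U} {k : ℕ} {R : ℝ} (hR : CoefBound P A k R) (x : Fin d → ℝ) :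
    Bornology.IsBounded (range fun c => coef P A c x) := by
  obtain ⟨D, hD⟩ := hR.disc' x
  refine isBounded_iff_forall_norm_le.2 ⟨max R D, ?_⟩
  rintro _ ⟨c, rfl⟩
  have hm := le_max_left R D
  simp only [Prod.norm_def, sup_le_iff]
  refine ⟨(hR.drift c x).trans hm, (hR.diff c x).trans hm, (hR.g c x).trans hm,
    (hR.S c x).trans hm, ?_, (hR.cost c x).trans hm⟩
  rw [Real.norm_eq_abs, abs_le]
  exact ⟨by linarith [hR.disc c x], (hD c).trans (le_max_right _ _)⟩

/-- The solution of one step of the scheme. -/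
def nextFun {d l : ℕ} {M U : Type*} (P : ControlProblem d M U) (A : SchemeData d l M U) (k : ℕ)
    (h : ℝ) (φ : (Fin d → ℝ) → ℝ) (x : Fin d → ℝ) : ℝ :=
  ⨆ c, (h⁻¹ * (coef P A c x).mean k h x φ + (coef P A c x).cost)
    / (h⁻¹ * (coef P A c x).mass h + (coef P A c x).disc)

/-! ### Solvability, stability and continuity of one backward step. -/

section NextFun

variable {d l : ℕ} {M U : Type*} {P : ControlProblem d M U} {A : SchemeData d l M U} {k : ℕ}
  {R h B : ℝ} {φ : (Fin d → ℝ) → ℝ}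

/-- The mass is at least `1`, and for small `h` the term `h⁻¹` dominates a possibly negative
discount rate. -/
lemma CoefBound.le_denom (hR : CoefBound P A k R) (hh : 0 < h) (hRh : R * h ≤ 1 / 2) (c : M × U)
    (x : Fin d → ℝ) : h⁻¹ / 2 ≤ h⁻¹ * (coef P A c x).mass h + (coef P A c x).disc := by
  have h1 : h⁻¹ * 1 ≤ h⁻¹ * (coef P A c x).mass h :=
    mul_le_mul_of_nonneg_left ((coef P A c x).one_le_mass h) (by positivity)
  have h2 := hR.disc c x
  have h3 : R ≤ h⁻¹ / 2 := by
    rw [le_div_iff₀ two_pos, ← one_div, le_div_iff₀ hh]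
    linarith
  linarith

lemma CoefBound.abs_numer_le (hR : CoefBound P A k R) (hh : 0 < h) (hφ : Measurable φ)
    (hB : ∀ y, |φ y| ≤ B) (c : M × U) (x : Fin d → ℝ) :
    |h⁻¹ * (coef P A c x).mean k h x φ + (coef P A c x).cost|
      ≤ h⁻¹ * (B * (coef P A c x).mass h) + R := by
  refine (abs_add_le _ _).trans (add_le_add ?_ (hR.cost c x))
  rw [abs_mul, abs_of_pos (inv_pos.2 hh)]
  exact mul_le_mul_of_nonneg_left (Coef.abs_mean_le (hR.trace c x) h x hφ hB) (inv_pos.2 hh).le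

lemma CoefBound.mass_le (hR : CoefBound P A k R) (h : ℝ) (c : M × U) (x : Fin d → ℝ) :
    (coef P A c x).mass h ≤ 1 + Real.sqrt h * (2 * d * R * ∫ z, ‖z‖ ∂(stdLaw d)) := by
  refine (Coef.mass_le h _).trans ?_
  have h1 := hR.g c x
  have h2 : 0 ≤ ∫ z : Fin d → ℝ, ‖z‖ ∂(stdLaw d) := integral_nonneg fun z => norm_nonneg z
  gcongr

lemma CoefBound.bddAbove_numer (hR : CoefBound P A k R) (hh : 0 < h) (hφ : Measurable φ)
    (hB : ∀ y, |φ y| ≤ B) (x : Fin d → ℝ) : BddAbove (range fun c =>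
      h⁻¹ * (coef P A c x).mean k h x φ + (coef P A c x).cost) := by
  have hB0 : 0 ≤ B := (abs_nonneg _).trans (hB 0)
  refine ⟨h⁻¹ * (B * (1 + Real.sqrt h * (2 * d * R * ∫ z, ‖z‖ ∂(stdLaw d)))) + R, ?_⟩
  rintro _ ⟨c, rfl⟩
  refine (le_abs_self _).trans ((hR.abs_numer_le hh hφ hB c x).trans ?_)
  have := hR.mass_le h c x
  gcongr

lemma CoefBound.exists_denom_le (hR : CoefBound P A k R) (hh : 0 < h) (x : Fin d → ℝ) :
    ∃ b, ∀ c, h⁻¹ * (coef P A c x).mass h + (coef P A c x).disc ≤ b := by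
  obtain ⟨D, hD⟩ := hR.disc' x
  refine ⟨h⁻¹ * (1 + Real.sqrt h * (2 * d * R * ∫ z, ‖z‖ ∂(stdLaw d))) + D, fun c => ?_⟩
  have := hR.mass_le h c x
  have := hD c
  gcongr

lemma CoefBound.bddAbove_step (hR : CoefBound P A k R) (hh : 0 < h)
    (hφ : Measurable φ) (hB : ∀ y, |φ y| ≤ B) (x : Fin d → ℝ) (r : ℝ) :
    BddAbove (range fun c => (coef P A c x).step k h x r φ) := by
  obtain ⟨a, ha⟩ := hR.bddAbove_numer hh hφ hB x
  obtain ⟨b, hb⟩ := hR.exists_denom_le hh x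
  refine ⟨a + max (b * |r|) (R * |r|), ?_⟩
  rintro _ ⟨c, rfl⟩
  have h1 := ha ⟨c, rfl⟩
  have h2 : -R ≤ h⁻¹ * (coef P A c x).mass h + (coef P A c x).disc := by
    have := mul_nonneg (inv_pos.2 hh).le (zero_le_one.trans ((coef P A c x).one_le_mass h))
    linarith [hR.disc c x]
  have h3 : -((h⁻¹ * (coef P A c x).mass h + (coef P A c x).disc) * r)
      ≤ max (b * |r|) (R * |r|) := by
    rcases le_total 0 r with hr | hr
    · refine le_trans ?_ (le_max_right _ _)
      rw [abs_of_nonneg hr]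
      nlinarith
    · refine le_trans ?_ (le_max_left _ _)
      rw [abs_of_nonpos hr]
      nlinarith [hb c]
  simp only [Coef.step]
  linarith

/-- Although the equation is implicit in `r`, it is solved in closed form: the coefficient of `r` is
positive and bounded over the controls. -/
lemma CoefBound.K_eq_zero_iff [Nonempty M] [Nonempty U] (hR : CoefBound P A k R) (hh : 0 < h)
    (hRh : R * h ≤ 1 / 2) (hφ : Measurable φ) (hB : ∀ y, |φ y| ≤ B) (x : Fin d → ℝ) (r : ℝ) :
    SchemeData.K P A k h x r φ = 0 ↔ r = nextFun P A k h φ x := by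
  obtain ⟨b, hb⟩ := hR.exists_denom_le hh x
  rw [K_eq_iSup_step P A k hh x r hφ hB, neg_eq_zero]
  exact iSup_sub_mul_eq_zero_iff (b₀ := h⁻¹ / 2) (by positivity)
    (fun c => hR.le_denom hh hRh c x) hb (hR.bddAbove_numer hh hφ hB x) r

/-- With `μ` the mass and `ε = R h`, every quotient is at most `(B μ + ε) / (μ - ε)` in absolute
value. Since `μ` occurs above and below, its `O(√h)` excess over `1` cancels; otherwise `n` steps
could amplify by `exp (c √n)`. -/
lemma CoefBound.abs_nextFun_le [Nonempty M] [Nonempty U] (hR : CoefBound P A k R) (hh : 0 < h)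
    (hRh : R * h ≤ 1 / 2) (hφ : Measurable φ) (hB : ∀ y, |φ y| ≤ B) (x : Fin d → ℝ) :
    |nextFun P A k h φ x| ≤ (1 + 2 * (R * h)) * (B + R * h) := by
  have hB0 : 0 ≤ B := (abs_nonneg _).trans (hB 0)
  have hε : 0 ≤ R * h := mul_nonneg hR.nonneg hh.le
  have key : ∀ c, |(h⁻¹ * (coef P A c x).mean k h x φ + (coef P A c x).cost)
      / (h⁻¹ * (coef P A c x).mass h + (coef P A c x).disc)|
      ≤ (1 + 2 * (R * h)) * (B + R * h) := by
    intro c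
    have hden : 0 < h⁻¹ * (coef P A c x).mass h + (coef P A c x).disc :=
      lt_of_lt_of_le (by positivity) (hR.le_denom hh hRh c x)
    rw [abs_div, abs_of_pos hden, div_le_iff₀ hden]
    refine (hR.abs_numer_le hh hφ hB c x).trans ?_
    have hμ := (coef P A c x).one_le_mass h
    set μ := (coef P A c x).mass h
    set ε := R * h with hεdef
    have e1 : h⁻¹ * (B * μ) + R = h⁻¹ * (B * μ + ε) := by
      rw [hεdef]
      field_simp
    have e2 : h⁻¹ * (μ - ε) ≤ h⁻¹ * μ + (coef P A c x).disc := by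
      have : h⁻¹ * (μ - ε) = h⁻¹ * μ - R := by
        rw [hεdef]
        field_simp
      linarith [hR.disc c x]
    have e3 : B * μ + ε ≤ (1 + 2 * ε) * (B + ε) * (μ - ε) := by
      -- The difference of the two sides is `ε (2 μ - 1 - 2 ε)`, nonnegative because `μ ≥ 1` and `ε
      -- ≤ 1/2`.
      have h1 : μ ≤ (1 + 2 * ε) * (μ - ε) := by nlinarith
      have h2 : (B + ε) * μ ≤ (B + ε) * ((1 + 2 * ε) * (μ - ε)) :=
        mul_le_mul_of_nonneg_left h1 (by positivity)
      nlinarith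
    rw [e1]
    calc h⁻¹ * (B * μ + ε) ≤ h⁻¹ * ((1 + 2 * ε) * (B + ε) * (μ - ε)) := by gcongr
      _ = (1 + 2 * ε) * (B + ε) * (h⁻¹ * (μ - ε)) := by ring
      _ ≤ _ := by gcongr
  have hbdd : BddAbove (range fun c : M × U =>
      (h⁻¹ * (coef P A c x).mean k h x φ + (coef P A c x).cost)
      / (h⁻¹ * (coef P A c x).mass h + (coef P A c x).disc)) :=
    ⟨_, by rintro _ ⟨c, rfl⟩; exact (abs_le.1 (key c)).2⟩
  rw [abs_le]
  constructor
  · have c : M × U := Classical.arbitrary _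
    exact (abs_le.1 (key c)).1.trans (le_ciSup hbdd c)
  · exact ciSup_le fun c => (abs_le.1 (key c)).2

/-- The quotient whose supremum is `nextFun`, made continuous by truncating the denominator. -/
def stepRatio (k : ℕ) (h : ℝ) (φ : (Fin d → ℝ) → ℝ) (x : Fin d → ℝ) (θ : Coef d l) : ℝ :=
  (h⁻¹ * θ.mean k h x φ + θ.cost) / max (h⁻¹ * θ.mass h + θ.disc) (h⁻¹ / 2)

lemma stepRatio_tendsto (hh : 0 < h) (hφ : Continuous φ) (hB : ∀ y, |φ y| ≤ B) (x : Fin d → ℝ)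
    (θ : Coef d l) : Tendsto (fun q : (Fin d → ℝ) × Coef d l => stepRatio k h φ q.1 q.2)
      (𝓝 x ×ˢ 𝓝 θ) (𝓝 (stepRatio k h φ x θ)) := by
  have hpos : 0 < h⁻¹ / 2 := by positivity
  have hm := Coef.mean_tendsto (k := k) (h := h) (tendsto_snd (f := 𝓝 x) (g := 𝓝 θ))
    tendsto_fst hφ hB
  have hd : Continuous fun θ : Coef d l => max (h⁻¹ * θ.mass h + θ.disc) (h⁻¹ / 2) :=
    ((continuous_const.mul (Coef.continuous_mass h)).add (by fun_prop)).max continuous_const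
  have hc : Continuous fun θ : Coef d l => θ.cost := by fun_prop
  have hc' : Tendsto (fun q : (Fin d → ℝ) × Coef d l => q.2.cost) (𝓝 x ×ˢ 𝓝 θ) (𝓝 θ.cost) :=
    (hc.tendsto θ).comp tendsto_snd
  have hd' : Tendsto (fun q : (Fin d → ℝ) × Coef d l =>
      max (h⁻¹ * q.2.mass h + q.2.disc) (h⁻¹ / 2)) (𝓝 x ×ˢ 𝓝 θ)
      (𝓝 (max (h⁻¹ * θ.mass h + θ.disc) (h⁻¹ / 2))) := (hd.tendsto θ).comp tendsto_snd
  exact ((hm.const_mul _).add hc').div hd' (hpos.trans_le (le_max_right _ _)).ne'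

lemma CoefBound.nextFun_eq (hR : CoefBound P A k R) (hh : 0 < h) (hRh : R * h ≤ 1 / 2)
    (x : Fin d → ℝ) : nextFun P A k h φ x = ⨆ c, stepRatio k h φ x (coef P A c x) :=
  iSup_congr fun c => by rw [stepRatio, max_eq_left (hR.le_denom hh hRh c x)]

/-- Continuity provides measurability for the next integration, which is not automatic for a
supremum over an arbitrary set of controls. The quotients converge uniformly in the control, hence
so do their suprema. -/
lemma CoefBound.continuous_nextFun [Finite M] [Nonempty M] [Nonempty U] (hR : CoefBound P A k R)
    (hcont : UniformlyContinuousData P A) (hh : 0 < h) (hRh : R * h ≤ 1 / 2) (hφ : Continuous φ)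
    (hB : ∀ y, |φ y| ≤ B) : Continuous (nextFun P A k h φ) := by
  refine continuous_iff_continuousAt.2 fun x₀ => ?_
  have hpos : 0 < h⁻¹ / 2 := by positivity
  have hF' : Continuous (stepRatio (l := l) k h φ x₀) := by
    refine continuous_iff_continuousAt.2 fun θ => ?_
    have h1 : Tendsto (fun θ : Coef d l => (x₀, θ)) (𝓝 θ) (𝓝 x₀ ×ˢ 𝓝 θ) :=
      tendsto_const_nhds.prodMk tendsto_id
    have h2 := (stepRatio_tendsto (k := k) hh hφ hB x₀ θ).comp h1
    simp only [Function.comp_def] at h2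
    exact h2
  have hu := tendstoUniformly_comp_of_continuous_convergence hF'
    (stepRatio_tendsto hh hφ hB x₀) (tendstoUniformly_coef hcont x₀) (hR.isBounded_range x₀)
  have hbd : BddAbove (range fun c => stepRatio k h φ x₀ (coef P A c x₀)) := by
    obtain ⟨a, ha⟩ := hR.bddAbove_numer hh hφ.measurable hB x₀
    refine ⟨max a 0 / (h⁻¹ / 2), ?_⟩
    rintro _ ⟨c, rfl⟩
    exact div_le_div₀ (le_max_right _ _) ((ha ⟨c, rfl⟩).trans (le_max_left _ _)) hpos
      (le_max_right _ _)
  rw [ContinuousAt, hR.nextFun_eq hh hRh x₀]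
  exact (tendsto_iSup_of_tendstoUniformly hu hbd).congr fun x => (hR.nextFun_eq hh hRh x).symm

/-- A discrete Gronwall argument: each step multiplies the bound by at most `exp (2 R h)` and adds a
source of order `R h`. -/
lemma CoefBound.iterate_nextFun [Finite M] [Nonempty M] [Nonempty U] (hR : CoefBound P A k R)
    (hcont : UniformlyContinuousData P A) (hh : 0 < h) (hRh : R * h ≤ 1 / 2) (j : ℕ) :
    Continuous ((nextFun P A k h)^[j] P.ψ) ∧ ∀ x, |(nextFun P A k h)^[j] P.ψ x|
      ≤ Real.exp (2 * (R * h) * j) * (R + R * h * j) := by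
  have hε : 0 ≤ R * h := mul_nonneg hR.nonneg hh.le
  induction j with
  | zero => simpa using ⟨hcont.ψ.continuous, hR.ψ⟩
  | succ j ih =>
    rw [Function.iterate_succ_apply']
    refine ⟨hR.continuous_nextFun hcont hh hRh ih.1 ih.2, fun x => ?_⟩
    refine (hR.abs_nextFun_le hh hRh ih.1.measurable ih.2 x).trans ?_
    set ε := R * h
    have h1 : 1 + 2 * ε ≤ Real.exp (2 * ε) := by linarith [Real.add_one_le_exp (2 * ε)]
    have h2 : 1 ≤ Real.exp (2 * ε * j) := Real.one_le_exp (by positivity)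
    have h3 : Real.exp (2 * ε * (j + 1 : ℕ)) = Real.exp (2 * ε) * Real.exp (2 * ε * j) := by
      rw [← Real.exp_add]
      push_cast
      ring_nf
    rw [h3, mul_assoc (Real.exp (2 * ε))]
    have hR0 := hR.nonneg
    refine mul_le_mul h1 ?_ (by positivity) (by positivity)
    push_cast
    linarith [mul_le_mul_of_nonneg_right h2 hε]

end NextFun

/-- The solution of the discretized equation. -/
def gridSol {d l : ℕ} {M U : Type*} (P : ControlProblem d M U) (A : SchemeData d l M U) (k : ℕ)
    (T : ℝ) (n : ℕ) (i : Fin (n + 1)) : (Fin d → ℝ) → ℝ :=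
  (nextFun P A k (T / n))^[n - i] P.ψ

section GridSol

variable {d l : ℕ} {M U : Type*} [Finite M] [Nonempty M] [Nonempty U] {P : ControlProblem d M U}
  {A : SchemeData d l M U} {k : ℕ} {R T : ℝ} {n : ℕ}

lemma gridSol_continuous (hR : CoefBound P A k R) (hcont : UniformlyContinuousData P A)
    (hT : 0 < T) (hn : 0 < n) (hRh : R * (T / n) ≤ 1 / 2) (i : Fin (n + 1)) :
    Continuous (gridSol P A k T n i) :=
  (hR.iterate_nextFun hcont (by positivity) hRh _).1

lemma abs_gridSol_le (hR : CoefBound P A k R) (hcont : UniformlyContinuousData P A)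
    (hT : 0 < T) (hn : 0 < n) (hRh : R * (T / n) ≤ 1 / 2) (i : Fin (n + 1)) (x : Fin d → ℝ) :
    |gridSol P A k T n i x| ≤ Real.exp (2 * (R * T)) * (R + R * T) := by
  refine ((hR.iterate_nextFun hcont (by positivity) hRh _).2 x).trans ?_
  have hR0 := hR.nonneg
  have h1 : R * (T / n) * ((n - i : ℕ) : ℝ) ≤ R * T := by
    rw [mul_assoc]
    refine mul_le_mul_of_nonneg_left ?_ hR0
    rw [div_mul_eq_mul_div, div_le_iff₀ (by positivity)]
    exact mul_le_mul_of_nonneg_left (by exact_mod_cast Nat.sub_le _ _) hT.le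
  refine mul_le_mul (Real.exp_le_exp.2 (by linarith)) (by linarith) ?_ (Real.exp_pos _).le
  positivity

/-- No regularity of `w` is assumed. Going backward from the terminal time, the later value has
already been identified with a bounded continuous function when the one-step equation is solved, so
uniqueness holds among all functions. -/
lemma isDiscreteSolution_iff (hR : CoefBound P A k R) (hcont : UniformlyContinuousData P A)
    (hT : 0 < T) (hn : 0 < n) (hRh : R * (T / n) ≤ 1 / 2) (w : Fin (n + 1) → (Fin d → ℝ) → ℝ) :
    SchemeData.IsDiscreteSolution P A k T n w ↔ w = gridSol P A k T n := by
  have hh : 0 < T / n := by positivity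
  have hlast : gridSol P A k T n (Fin.last n) = P.ψ := by simp [gridSol]
  have hstep : ∀ i : Fin n, gridSol P A k T n i.castSucc
      = nextFun P A k (T / n) (gridSol P A k T n i.succ) := fun i => by
    have : n - (i : ℕ) = (n - (i + 1)) + 1 := by omega
    simp only [gridSol, Fin.val_castSucc, Fin.val_succ, this, Function.iterate_succ_apply']
  have hK := fun i x r => hR.K_eq_zero_iff hh hRh
    (gridSol_continuous hR hcont hT hn hRh i).measurable (abs_gridSol_le hR hcont hT hn hRh i) x r
  constructor
  · rintro ⟨h1, h2⟩
    funext i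
    induction i using Fin.reverseInduction with
    | last => rw [hlast]; exact funext h1
    | cast i ih =>
      funext x
      have := h2 i x
      rw [ih, hK] at this
      rw [this, hstep]
  · rintro rfl
    refine ⟨fun x => by rw [hlast], fun i x => ?_⟩
    rw [hK, hstep]

end GridSol

/-! ### Half-relaxed limits -/

section HalfRelaxed

variable {E : Type*} [MetricSpace E]

/-- The filter of the pairs `(n, p)` with `p ∈ D n`, `n → ∞` and `p → q`. -/
def relFilter (D : ℕ → Set E) (q : E) : Filter (ℕ × E) :=
  (atTop ×ˢ 𝓝 q) ⊓ 𝓟 {z | z.2 ∈ D z.1}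

/-- The upper half-relaxed limit of `V n` on `D n`. -/
def upperLim (D : ℕ → Set E) (V : ℕ → E → ℝ) (q : E) : ℝ :=
  limsup (fun z => V z.1 z.2) (relFilter D q)

lemma eventually_relFilter_iff {D : ℕ → Set E} {q : E} {P : ℕ × E → Prop} :
    (∀ᶠ z in relFilter D q, P z) ↔
      ∃ N : ℕ, ∃ ε > 0, ∀ n ≥ N, ∀ p ∈ D n, dist p q < ε → P (n, p) := by
  rw [relFilter, eventually_inf_principal, eventually_prod_iff]
  constructor
  · rintro ⟨p₁, h₁, p₂, h₂, h⟩
    obtain ⟨N, hN⟩ := eventually_atTop.1 h₁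
    obtain ⟨ε, hε, hball⟩ := Metric.eventually_nhds_iff.1 h₂
    exact ⟨N, ε, hε, fun n hn p hp hpq => h (hN n hn) (hball hpq) hp⟩
  · rintro ⟨N, ε, hε, h⟩
    exact ⟨fun n => N ≤ n, eventually_ge_atTop N, fun p => dist p q < ε,
      Metric.eventually_nhds_iff.2 ⟨ε, hε, fun _ h => h⟩, fun hn p hpq hp => h _ hn _ hp hpq⟩

variable {D : ℕ → Set E} {V : ℕ → E → ℝ} {C : ℝ} {Ω : Set E}

lemma eventually_abs_le_relFilter (hV : ∀ᶠ n in atTop, ∀ p ∈ D n, |V n p| ≤ C) (q : E) :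
    ∀ᶠ z in relFilter D q, |V z.1 z.2| ≤ C := by
  obtain ⟨N, hN⟩ := eventually_atTop.1 hV
  exact eventually_relFilter_iff.2 ⟨N, 1, one_pos, fun n hn p hp _ => hN n hn p hp⟩

lemma isBoundedUnder_le_relFilter (hV : ∀ᶠ n in atTop, ∀ p ∈ D n, |V n p| ≤ C) (q : E) :
    IsBoundedUnder (· ≤ ·) (relFilter D q) fun z => V z.1 z.2 :=
  ⟨C, eventually_map.2 ((eventually_abs_le_relFilter hV q).mono fun _ h => (abs_le.1 h).2)⟩

lemma isBoundedUnder_ge_relFilter (hV : ∀ᶠ n in atTop, ∀ p ∈ D n, |V n p| ≤ C) (q : E) :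
    IsBoundedUnder (· ≥ ·) (relFilter D q) fun z => V z.1 z.2 :=
  ⟨-C, eventually_map.2 ((eventually_abs_le_relFilter hV q).mono fun _ h => (abs_le.1 h).1)⟩

lemma eventually_lt_of_upperLim_lt (hV : ∀ᶠ n in atTop, ∀ p ∈ D n, |V n p| ≤ C) {q : E} {a : ℝ}
    (h : upperLim D V q < a) : ∀ᶠ z in relFilter D q, V z.1 z.2 < a :=
  eventually_lt_of_limsup_lt h (isBoundedUnder_le_relFilter hV q)

lemma frequently_lt_of_lt_upperLim (hV : ∀ᶠ n in atTop, ∀ p ∈ D n, |V n p| ≤ C) {q : E}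
    [(relFilter D q).NeBot] {a : ℝ} (h : a < upperLim D V q) :
    ∃ᶠ z in relFilter D q, a < V z.1 z.2 :=
  frequently_lt_of_lt_limsup (isBoundedUnder_ge_relFilter hV q).isCoboundedUnder_le h

lemma upperLim_le (hV : ∀ᶠ n in atTop, ∀ p ∈ D n, |V n p| ≤ C) {q : E}
    [(relFilter D q).NeBot] {a : ℝ} (h : ∀ᶠ z in relFilter D q, V z.1 z.2 ≤ a) :
    upperLim D V q ≤ a :=
  limsup_le_of_le (isBoundedUnder_ge_relFilter hV q).isCoboundedUnder_le h

lemma abs_upperLim_le (hV : ∀ᶠ n in atTop, ∀ p ∈ D n, |V n p| ≤ C) (q : E)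
    [(relFilter D q).NeBot] : |upperLim D V q| ≤ C := by
  refine abs_le.2 ⟨?_, upperLim_le hV
    ((eventually_abs_le_relFilter hV q).mono fun _ h => (abs_le.1 h).2)⟩
  by_contra! h
  obtain ⟨z, h1, h2⟩ := ((eventually_lt_of_upperLim_lt hV h).and
    (eventually_abs_le_relFilter hV q)).exists
  linarith [(abs_le.1 h2).1]

lemma upperSemicontinuousOn_upperLim (hV : ∀ᶠ n in atTop, ∀ p ∈ D n, |V n p| ≤ C)
    (hD : ∀ q ∈ Ω, (relFilter D q).NeBot) : UpperSemicontinuousOn (upperLim D V) Ω := by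
  intro q₀ _ y hy
  obtain ⟨a, ha, hay⟩ := exists_between hy
  obtain ⟨N, ε, hε, h⟩ := eventually_relFilter_iff.1 (eventually_lt_of_upperLim_lt hV ha)
  filter_upwards [mem_nhdsWithin_of_mem_nhds (Metric.ball_mem_nhds q₀ hε), self_mem_nhdsWithin]
    with q hq hqΩ
  have := hD q hqΩ
  refine (upperLim_le hV (eventually_relFilter_iff.2
    ⟨N, ε - dist q q₀, sub_pos.2 hq, fun n hn p hp hpq => (h n hn p hp ?_).le⟩)).trans_lt hay
  linarith [dist_triangle p q q₀]

lemma neg_upperLim_neg_le (hV : ∀ᶠ n in atTop, ∀ p ∈ D n, |V n p| ≤ C) (q : E)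
    [(relFilter D q).NeBot] : -upperLim D (fun n p => -V n p) q ≤ upperLim D V q := by
  by_contra! h
  obtain ⟨a, ha, ha'⟩ := exists_between h
  have hV' : ∀ᶠ n in atTop, ∀ p ∈ D n, |-V n p| ≤ C := by simpa only [abs_neg] using hV
  obtain ⟨z, h1, h2⟩ := ((eventually_lt_of_upperLim_lt hV ha).and
    (eventually_lt_of_upperLim_lt hV' (lt_neg.1 ha'))).exists
  linarith

lemma tendsto_relFilter (hV : ∀ᶠ n in atTop, ∀ p ∈ D n, |V n p| ≤ C) {q : E} {v : ℝ}
    (h1 : upperLim D V q = v) (h2 : -upperLim D (fun n p => -V n p) q = v) :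
    Tendsto (fun z : ℕ × E => V z.1 z.2) (relFilter D q) (𝓝 v) := by
  have hV' : ∀ᶠ n in atTop, ∀ p ∈ D n, |-V n p| ≤ C := by simpa only [abs_neg] using hV
  rw [Metric.tendsto_nhds]
  intro ε hε
  filter_upwards [eventually_lt_of_upperLim_lt hV (show upperLim D V q < v + ε by linarith),
    eventually_lt_of_upperLim_lt hV'
      (show upperLim D (fun n p => -V n p) q < -v + ε by linarith)] with z hz hz'
  rw [Real.dist_eq, abs_lt]
  constructor <;> linarith

/-- Near-maximizers of `V n - Φ` converge to a strict maximizer of `upperLim D V - Φ`. -/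
lemma exists_near_maximizers [ProperSpace E] (hV : ∀ᶠ n in atTop, ∀ p ∈ D n, |V n p| ≤ C)
    (hΩ : IsClosed Ω) (hDΩ : ∀ n, D n ⊆ Ω) {q₀ : E} [(relFilter D q₀).NeBot]
    {Φ : E → ℝ} (hΦ : Continuous Φ) {b ρ Bl : ℝ} (hb : upperLim D V q₀ - Φ q₀ = b)
    (hstrict : ∀ q ∈ Ω, q ≠ q₀ → upperLim D V q - Φ q < b)
    (hout : ∀ q, ρ ≤ dist q q₀ → C - Φ q ≤ b - 1) (hBl : ∀ q, Bl ≤ Φ q)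
    {ε : ℕ → ℝ} (hε : ∀ᶠ n in atTop, 0 < ε n) (hε0 : Tendsto ε atTop (𝓝 0)) :
    ∃ (ν : ℕ → ℕ) (p : ℕ → E), Tendsto ν atTop atTop ∧ (∀ j, p j ∈ D (ν j)) ∧
      Tendsto p atTop (𝓝 q₀) ∧ Tendsto (fun j => V (ν j) (p j)) atTop (𝓝 (upperLim D V q₀)) ∧
      ∀ j, ∀ p' ∈ D (ν j), V (ν j) p' - Φ p' ≤ V (ν j) (p j) - Φ (p j) + ε (ν j) := by
  -- uniform gap away from `q₀`
  have gap : ∀ r > 0, ∃ κ > 0, ∀ᶠ n in atTop, ∀ p ∈ D n, r ≤ dist p q₀ →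
      V n p - Φ p < b - κ := by
    intro r hr
    have hK : IsCompact (Ω ∩ Metric.closedBall q₀ ρ ∩ {p | r ≤ dist p q₀}) :=
      ((isCompact_closedBall q₀ ρ).inter_left hΩ).inter_right
        (isClosed_le continuous_const (by fun_prop))
    obtain ⟨κ, hκ, h⟩ := hK.induction_on
      (p := fun s => ∃ κ > 0, ∀ᶠ n in atTop, ∀ p ∈ D n, p ∈ s → V n p - Φ p < b - κ)
      ⟨1, one_pos, by simp⟩ (by
        rintro s t hst ⟨κ, hκ, h⟩
        exact ⟨κ, hκ, h.mono fun n hn p hp hps => hn p hp (hst hps)⟩) (by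
        rintro s t ⟨κ, hκ, h⟩ ⟨κ', hκ', h'⟩
        refine ⟨min κ κ', lt_min hκ hκ', ?_⟩
        filter_upwards [h, h'] with n hn hn' p hp hps
        rcases hps with hps | hps
        · linarith [hn p hp hps, min_le_left κ κ']
        · linarith [hn' p hp hps, min_le_right κ κ']) (by
        rintro q ⟨⟨hqΩ, _⟩, hq⟩
        have hne : q ≠ q₀ := by
          rintro rfl
          simp only [mem_ofPred_eq, dist_self] at hq
          linarith
        have hlt := hstrict q hqΩ hne
        set κ := (b - (upperLim D V q - Φ q)) / 4 with hκ
        have hκ0 : 0 < κ := by rw [hκ]; linarith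
        obtain ⟨N, r₁, hr₁, h1⟩ := eventually_relFilter_iff.1
          (eventually_lt_of_upperLim_lt hV (show upperLim D V q < upperLim D V q + κ by linarith))
        obtain ⟨r₂, hr₂, h2⟩ := Metric.continuousAt_iff.1 (hΦ.continuousAt (x := q)) κ hκ0
        refine ⟨Metric.ball q (min r₁ r₂), mem_nhdsWithin_of_mem_nhds
          (Metric.ball_mem_nhds _ (lt_min hr₁ hr₂)), κ, hκ0, ?_⟩
        filter_upwards [eventually_ge_atTop N] with n hn p hp hpq
        rw [Metric.mem_ball, lt_min_iff] at hpq
        have e1 := h1 n hn p hp hpq.1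
        have e2 := (abs_lt.1 (h2 hpq.2)).1
        simp only at e1
        linarith)
    -- The compact annulus gives the gap `κ`. Beyond radius `ρ` the values are at most `b - 1`,
    -- hence below `b - 1/2`.
    refine ⟨min κ (1 / 2), by positivity, ?_⟩
    filter_upwards [h, hV] with n hn hVn p hp hpr
    by_cases hpρ : dist p q₀ ≤ ρ
    · linarith [hn p hp ⟨⟨hDΩ n hp, hpρ⟩, hpr⟩, min_le_left κ (1 / 2)]
    · linarith [hout p (not_le.1 hpρ).le, (abs_le.1 (hVn p hp)).2, min_le_right κ (1 / 2)]
  -- a near-maximizer close to `q₀`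
  have main : ∀ j : ℕ, ∃ (n : ℕ) (p : E), j ≤ n ∧ p ∈ D n ∧ dist p q₀ < 1 / ((j : ℝ) + 1) ∧
      |V n p - Φ p - b| < 1 / ((j : ℝ) + 1) ∧
      ∀ p' ∈ D n, V n p' - Φ p' ≤ V n p - Φ p + ε n := by
    intro j
    set τ : ℝ := 1 / ((j : ℝ) + 1) with hτ
    have hτ0 : 0 < τ := by positivity
    have hup : ∀ᶠ z in relFilter D q₀, V z.1 z.2 - Φ z.2 < b + τ := by
      obtain ⟨N, r₁, hr₁, h1⟩ := eventually_relFilter_iff.1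
        (eventually_lt_of_upperLim_lt hV
          (show upperLim D V q₀ < upperLim D V q₀ + τ / 2 by linarith))
      obtain ⟨r₂, hr₂, h2⟩ := Metric.continuousAt_iff.1 (hΦ.continuousAt (x := q₀)) (τ / 2)
        (by positivity)
      refine eventually_relFilter_iff.2 ⟨N, min r₁ r₂, lt_min hr₁ hr₂, fun n hn p hp hpq => ?_⟩
      rw [lt_min_iff] at hpq
      have e1 := h1 n hn p hp hpq.1
      have e2 := (abs_lt.1 (h2 hpq.2)).1
      simp only at e1 ⊢
      linarith
    obtain ⟨N₁, r₁, hr₁, hup⟩ := eventually_relFilter_iff.1 hup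
    -- Radius `τ` forces the near-maximizer towards `q₀`, and radius `r₁` keeps it where the upper
    -- bound `b + τ` holds.
    obtain ⟨κ, hκ, hgap⟩ := gap (min τ r₁) (lt_min hτ0 hr₁)
    set κ' := min κ τ with hκ'
    have hκ'0 : 0 < κ' := lt_min hκ hτ0
    have hfreq : ∃ᶠ z in relFilter D q₀, b - κ' / 2 < V z.1 z.2 - Φ z.2 := by
      have h1 := frequently_lt_of_lt_upperLim hV
        (show upperLim D V q₀ - κ' / 4 < upperLim D V q₀ by linarith)
      obtain ⟨r₂, hr₂, h2⟩ := Metric.continuousAt_iff.1 (hΦ.continuousAt (x := q₀)) (κ' / 4)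
        (by positivity)
      have h3 : ∀ᶠ z in relFilter D q₀, dist (Φ z.2) (Φ q₀) < κ' / 4 :=
        eventually_relFilter_iff.2 ⟨0, r₂, hr₂, fun n _ p _ hpq => h2 hpq⟩
      refine (h1.and_eventually h3).mono fun z hz => ?_
      have := (abs_lt.1 hz.2).2
      linarith [hz.1]
    have hlarge : ∀ᶠ n in atTop, N₁ ≤ n ∧ j ≤ n ∧ 0 < ε n ∧ ε n < κ' / 2 ∧
        (∀ p ∈ D n, |V n p| ≤ C) ∧ ∀ p ∈ D n, min τ r₁ ≤ dist p q₀ → V n p - Φ p < b - κ := by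
      filter_upwards [eventually_ge_atTop N₁, eventually_ge_atTop j, hε,
        hε0.eventually_lt_const (show 0 < κ' / 2 by positivity), hV, hgap]
        with n h1 h2 h3 h4 h5 h6
      exact ⟨h1, h2, h3, h4, h5, h6⟩
    obtain ⟨N, hN⟩ := eventually_atTop.1 hlarge
    have hev : ∀ᶠ z in relFilter D q₀, N ≤ z.1 ∧ z.2 ∈ D z.1 :=
      eventually_relFilter_iff.2 ⟨N, 1, one_pos, fun n hn p hp _ => ⟨hn, hp⟩⟩
    obtain ⟨⟨n, q⟩, hq, hnN, hqD⟩ := (hfreq.and_eventually hev).exists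
    simp only at hq hnN hqD
    obtain ⟨hn1, hnj, hεn, hεn', hVn, hgapn⟩ := hN n hnN
    set s := (fun p => V n p - Φ p) '' D n with hs
    have hsne : s.Nonempty := ⟨_, q, hqD, rfl⟩
    have hsb : BddAbove s := by
      refine ⟨C - Bl, ?_⟩
      rintro _ ⟨p, hp, rfl⟩
      simp only
      linarith [(abs_le.1 (hVn p hp)).2, hBl p]
    obtain ⟨_, ⟨p, hp, rfl⟩, hps⟩ := exists_lt_of_lt_csSup hsne (show sSup s - ε n < sSup s by linarith)
    have hmax : ∀ p' ∈ D n, V n p' - Φ p' ≤ V n p - Φ p + ε n := fun p' hp' => by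
      have := le_csSup hsb ⟨p', hp', rfl⟩
      simp only at this hps
      linarith
    -- The point `q` has value above `b - κ'/2`, and near-maximality loses at most `ε n < κ'/2`. A
    -- value above `b - κ'` excludes points outside the ball by the gap.
    have hlow : b - κ' < V n p - Φ p := by linarith [hmax q hqD]
    have hclose : dist p q₀ < min τ r₁ := by
      by_contra! hfar
      linarith [hgapn p hp hfar, min_le_left κ τ]
    rw [lt_min_iff] at hclose
    have hhigh := hup n hn1 p hp hclose.2
    simp only at hhigh
    refine ⟨n, p, hnj, hp, hclose.1, abs_lt.2 ⟨?_, by linarith⟩, hmax⟩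
    linarith [min_le_right κ τ]
  choose ν p hν hp hdist hval hmax using main
  have hp0 : Tendsto p atTop (𝓝 q₀) := by
    rw [tendsto_iff_dist_tendsto_zero]
    exact squeeze_zero (fun _ => dist_nonneg) (fun j => (hdist j).le)
      tendsto_one_div_add_atTop_nhds_zero_nat
  refine ⟨ν, p, tendsto_atTop_mono hν tendsto_id, hp, hp0, ?_, hmax⟩
  have h1 : Tendsto (fun j => V (ν j) (p j) - Φ (p j) - b) atTop (𝓝 0) :=
    squeeze_zero_norm (fun j => (hval j).le) tendsto_one_div_add_atTop_nhds_zero_nat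
  have h2 := (h1.add ((hΦ.tendsto q₀).comp hp0)).add_const b
  have e : upperLim D V q₀ = 0 + Φ q₀ + b := by linarith
  rw [e]
  refine h2.congr fun j => ?_
  simp only [Function.comp]
  ring

end HalfRelaxed

/-! ### Test functions -/

section TestFunctions

variable {d : ℕ}

/-- The squared Euclidean distance on `ℝ × ℝ^d`. -/
def sqDist (q₀ q : ℝ × (Fin d → ℝ)) : ℝ := (q.1 - q₀.1) ^ 2 + ∑ i, (q.2 i - q₀.2 i) ^ 2

lemma contDiff_sqDist (q₀ : ℝ × (Fin d → ℝ)) : ContDiff ℝ 3 (sqDist q₀) := by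
  unfold sqDist
  fun_prop

lemma sqDist_nonneg (q₀ q : ℝ × (Fin d → ℝ)) : 0 ≤ sqDist q₀ q :=
  add_nonneg (sq_nonneg _) (Finset.sum_nonneg fun _ _ => sq_nonneg _)

lemma sqDist_self (q₀ : ℝ × (Fin d → ℝ)) : sqDist q₀ q₀ = 0 := by simp [sqDist]

lemma sqDist_pos {q₀ q : ℝ × (Fin d → ℝ)} (h : q ≠ q₀) : 0 < sqDist q₀ q := by
  refine lt_of_le_of_ne (sqDist_nonneg q₀ q) fun h0 => h ?_
  have h1 : 0 ≤ ∑ i, (q.2 i - q₀.2 i) ^ 2 := Finset.sum_nonneg fun _ _ => sq_nonneg _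
  have h2 := sq_nonneg (q.1 - q₀.1)
  unfold sqDist at h0
  have h3 : ∑ i, (q.2 i - q₀.2 i) ^ 2 = 0 := by linarith
  have h4 : (q.1 - q₀.1) ^ 2 = 0 := by linarith
  rw [Finset.sum_eq_zero_iff_of_nonneg fun _ _ => sq_nonneg _] at h3
  refine Prod.ext (sub_eq_zero.1 (pow_eq_zero_iff two_ne_zero |>.1 h4)) (funext fun i => ?_)
  exact sub_eq_zero.1 (pow_eq_zero_iff two_ne_zero |>.1 (h3 i (Finset.mem_univ i)))

lemma fderiv_sqDist_self (q₀ : ℝ × (Fin d → ℝ)) : fderiv ℝ (sqDist q₀) q₀ = 0 :=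
  IsLocalMin.fderiv_eq_zero (Eventually.of_forall fun q => by
    rw [sqDist_self]; exact sqDist_nonneg q₀ q)

lemma fderiv_sqDist_sq (q₀ : ℝ × (Fin d → ℝ)) : fderiv ℝ (fun q => sqDist q₀ q ^ 2)
    = fun q => (2 * sqDist q₀ q) • fderiv ℝ (sqDist q₀) q := by
  funext q
  have := ((contDiff_sqDist q₀).differentiable (by norm_num) q).hasFDerivAt.pow 2
  simpa using this.fderiv

/-- The derivative of the squared function is a product of two factors that both vanish at `q₀`. The
quartic can therefore make a maximum strict without changing the second-order jet. -/
lemma fderiv_fderiv_sqDist_sq (q₀ : ℝ × (Fin d → ℝ)) :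
    fderiv ℝ (fderiv ℝ fun q => sqDist q₀ q ^ 2) q₀ = 0 := by
  rw [fderiv_sqDist_sq]
  have h1 := ((contDiff_sqDist q₀).differentiable (by norm_num) q₀).hasFDerivAt.const_mul 2
  have h2 := (((contDiff_sqDist q₀).fderiv_right (m := 2) (by norm_num)).differentiable
    (by norm_num) q₀).hasFDerivAt
  have := (h1.smul h2).fderiv
  rw [sqDist_self, fderiv_sqDist_self] at this
  refine Eq.trans this ?_
  simp

/-- Replacement of a local test function by one that is constant near infinity and makes the
maximum strict, without changing the derivatives at the maximum point. -/
lemma exists_global_test {w φ : ℝ × (Fin d → ℝ) → ℝ} {Ω : Set (ℝ × (Fin d → ℝ))}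
    {q₀ : ℝ × (Fin d → ℝ)} {C : ℝ} (hw : ∀ q ∈ Ω, |w q| ≤ C) (hφ : ContDiff ℝ 2 φ)
    (hmax : IsLocalMaxOn (fun q => w q - φ q) Ω q₀) :
    ∃ (Φ : ℝ × (Fin d → ℝ) → ℝ) (c ρ : ℝ), ContDiff ℝ 2 Φ ∧
      HasCompactSupport (fun q => Φ q - c) ∧ Φ q₀ = φ q₀ ∧ fderiv ℝ Φ q₀ = fderiv ℝ φ q₀ ∧
      fderiv ℝ (fderiv ℝ Φ) q₀ = fderiv ℝ (fderiv ℝ φ) q₀ ∧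
      (∀ q ∈ Ω, q ≠ q₀ → w q - Φ q < w q₀ - φ q₀) ∧
      ∀ q, ρ ≤ dist q q₀ → C - Φ q ≤ w q₀ - φ q₀ - 1 := by
  obtain ⟨ρ, hρ, hball⟩ := Metric.mem_nhdsWithin_iff.1 hmax
  set b := w q₀ - φ q₀ with hb
  -- With this constant, `C - Φ = C - c = b - 1` wherever the cutoff vanishes.
  set c := C - b + 1 with hc
  let η : ContDiffBump q₀ := ⟨ρ / 2, ρ, by positivity, by linarith⟩
  set φ' : ℝ × (Fin d → ℝ) → ℝ := fun q => φ q + sqDist q₀ q ^ 2 with hφ'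
  set Φ : ℝ × (Fin d → ℝ) → ℝ := fun q => η q * (φ' q - c) + c with hΦ
  have hQ : ContDiff ℝ 2 fun q => sqDist q₀ q ^ 2 := ((contDiff_sqDist q₀).pow 2).of_le (by norm_num)
  have hφ'c : ContDiff ℝ 2 φ' := hφ.add hQ
  have hΦc : ContDiff ℝ 2 Φ := (η.contDiff.mul (hφ'c.sub contDiff_const)).add contDiff_const
  have heq : Φ =ᶠ[𝓝 q₀] φ' := by
    filter_upwards [η.eventuallyEq_one] with q hq
    simp only [hΦ, hq, Pi.one_apply]
    ring
  have hd1 : fderiv ℝ φ' = fun q => fderiv ℝ φ q + fderiv ℝ (fun q => sqDist q₀ q ^ 2) q :=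
    funext fun q => fderiv_fun_add (hφ.differentiable (by norm_num) q)
      (hQ.differentiable (by norm_num) q)
  have hout : ∀ q, ρ ≤ dist q q₀ → η q = 0 := fun q hq => η.zero_of_le_dist hq
  refine ⟨Φ, c, ρ, hΦc, ?_, ?_, ?_, ?_, ?_, ?_⟩
  · simp only [hΦ, add_sub_cancel_right]
    exact η.hasCompactSupport.mul_right
  · rw [heq.eq_of_nhds]
    simp [hφ', sqDist_self]
  · rw [heq.fderiv_eq, hd1, fderiv_sqDist_sq]
    simp [sqDist_self]
  · rw [heq.fderiv.fderiv_eq, hd1, fderiv_fun_add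
      ((hφ.fderiv_right (m := 1) (by norm_num)).differentiable (by norm_num) q₀)
      ((hQ.fderiv_right (m := 1) (by norm_num)).differentiable (by norm_num) q₀),
      fderiv_fderiv_sqDist_sq, add_zero]
  · intro q hq hne
    have hwC := (abs_le.1 (hw q hq)).2
    by_cases hqρ : dist q q₀ < ρ
    · have h1 : w q - φ q ≤ b := hball ⟨hqρ, hq⟩
      have h2 : 0 < sqDist q₀ q ^ 2 := pow_pos (sqDist_pos hne) 2
      have h3 : 0 ≤ η q := η.nonneg
      have h4 : η q ≤ 1 := η.le_one
      -- A convex combination: the first value is at most `b` minus the positive quartic, the second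
      -- at most `b - 1`. The result is below `b` whether or not `η q` vanishes.
      have e : w q - Φ q = η q * (w q - φ q - sqDist q₀ q ^ 2) + (1 - η q) * (w q - c) := by
        simp only [hΦ, hφ']
        ring
      have h5 := mul_le_mul_of_nonneg_left h1 h3
      have h6 : (1 - η q) * (w q - c) ≤ (1 - η q) * (b - 1) :=
        mul_le_mul_of_nonneg_left (by linarith) (by linarith)
      rw [e]
      rcases h3.eq_or_lt with h0 | h0
      · rw [← h0] at h6 ⊢
        linarith
      · linarith [mul_pos h0 h2]
    · have := hout q (not_lt.1 hqρ)
      simp only [hΦ, this]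
      linarith
  · intro q hq
    simp only [hΦ, hout q hq]
    linarith

/-! ### Time derivative, gradient and Hessian as components of the full derivatives. -/

variable {φ : ℝ × (Fin d → ℝ) → ℝ}

lemma deriv_time_eq (hφ : ContDiff ℝ 2 φ) (t : ℝ) (x : Fin d → ℝ) :
    deriv (fun s => φ (s, x)) t = fderiv ℝ φ (t, x) (1, 0) := by
  have h1 : HasDerivAt (fun s : ℝ => (s, x)) ((1 : ℝ), (0 : Fin d → ℝ)) t :=
    (hasDerivAt_id t).prodMk (hasDerivAt_const t x)
  exact ((hφ.differentiable (by norm_num) (t, x)).hasFDerivAt.comp_hasDerivAt t h1).deriv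

lemma fderiv_space_eq (hφ : ContDiff ℝ 2 φ) (t : ℝ) (x : Fin d → ℝ) :
    fderiv ℝ (fun y => φ (t, y)) x
      = (fderiv ℝ φ (t, x)).comp (ContinuousLinearMap.inr ℝ ℝ (Fin d → ℝ)) :=
  ((hφ.differentiable (by norm_num) (t, x)).hasFDerivAt.comp x (hasFDerivAt_prodMk_right t x)).fderiv

lemma spaceGrad_eq (hφ : ContDiff ℝ 2 φ) (t : ℝ) (x : Fin d → ℝ) (i : Fin d) :
    spaceGrad φ t x i = fderiv ℝ φ (t, x) (0, Pi.single i 1) := by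
  rw [spaceGrad, fderiv_space_eq hφ]
  simp

lemma spaceHess_eq (hφ : ContDiff ℝ 2 φ) (t : ℝ) (x : Fin d → ℝ) (i j : Fin d) :
    spaceHess φ t x i j
      = fderiv ℝ (fderiv ℝ φ) (t, x) (0, Pi.single i 1) (0, Pi.single j 1) := by
  rw [spaceHess, Matrix.of_apply, iteratedFDeriv_two_apply]
  simp only [Matrix.cons_val_zero, Matrix.cons_val_one]
  have h1 : fderiv ℝ (fun y => φ (t, y))
      = fun y => (fderiv ℝ φ (t, y)).comp (ContinuousLinearMap.inr ℝ ℝ (Fin d → ℝ)) :=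
    funext fun y => fderiv_space_eq hφ t y
  have h2 : HasFDerivAt (fun y => fderiv ℝ φ (t, y))
      ((fderiv ℝ (fderiv ℝ φ) (t, x)).comp (ContinuousLinearMap.inr ℝ ℝ (Fin d → ℝ))) x :=
    (((hφ.fderiv_right (m := 1) (by norm_num)).differentiable (by norm_num)
      (t, x)).hasFDerivAt).comp x (hasFDerivAt_prodMk_right t x)
  have h3 := (h2.clm_comp (hasFDerivAt_const (ContinuousLinearMap.inr ℝ ℝ (Fin d → ℝ)) x)).fderiv
  rw [h1, h3]
  simp

lemma fderiv_space_apply (hφ : ContDiff ℝ 2 φ) (t : ℝ) (x y : Fin d → ℝ) :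
    fderiv ℝ φ (t, x) (0, y) = y ⬝ᵥ spaceGrad φ t x := by
  have h : ((0 : ℝ), y) = ∑ i, y i • ((0 : ℝ), (Pi.single i 1 : Fin d → ℝ)) := by
    refine Prod.ext ?_ ?_
    · simp [Prod.fst_sum]
    · rw [Prod.snd_sum]
      simpa using pi_eq_sum_univ' y
  rw [h, map_sum]
  simp only [map_smul, smul_eq_mul, dotProduct, spaceGrad_eq hφ]

lemma fderiv_fderiv_space_apply (hφ : ContDiff ℝ 2 φ) (t : ℝ) (x y : Fin d → ℝ) :
    fderiv ℝ (fderiv ℝ φ) (t, x) (0, y) (0, y) = y ⬝ᵥ spaceHess φ t x *ᵥ y := by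
  have h : ((0 : ℝ), y) = ∑ i, y i • ((0 : ℝ), (Pi.single i 1 : Fin d → ℝ)) := by
    refine Prod.ext ?_ ?_
    · simp [Prod.fst_sum]
    · rw [Prod.snd_sum]
      simpa using pi_eq_sum_univ' y
  rw [h]
  simp only [map_sum, map_smul, sum_apply, smul_apply,
    smul_eq_mul, dotProduct, Matrix.mulVec, spaceHess_eq hφ, Finset.mul_sum]
  rw [Finset.sum_comm]
  exact Finset.sum_congr rfl fun i _ => Finset.sum_congr rfl fun j _ => by ring

end TestFunctions

/-! ### Consistency of the scheme -/

lemma integral_quadratic_mul_weight {d l : ℕ} (S : Matrix (Fin d) (Fin l) ℝ) (k : ℕ)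
    (Q : Matrix (Fin d) (Fin d) ℝ) :
    Integrable (fun z => (z ⬝ᵥ Q *ᵥ z) * (1 + poly2 S k z)) (stdLaw d) ∧
    ∫ z, (z ⬝ᵥ Q *ᵥ z) * (1 + poly2 S k z) ∂(stdLaw d) = (Q * (1 + S * Sᵀ)).trace := by
  have h1 : ∀ a b, Integrable (fun z : Fin d → ℝ => z a * z b) (stdLaw d) := fun a b => by
    have := integrable_eval_stdLaw (MvPolynomial.X a * MvPolynomial.X b)
    simpa only [map_mul, MvPolynomial.eval_X] using this
  have h2 : ∀ a b, Integrable (fun z : Fin d → ℝ =>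
      Q a b * (z b * z a + z b * z a * poly2 S k z)) (stdLaw d) := fun a b =>
    ((h1 b a).add (integrable_coord_mul_coord_mul_poly2 S k b a)).const_mul _
  have h3 : ∀ z : Fin d → ℝ, (z ⬝ᵥ Q *ᵥ z) * (1 + poly2 S k z)
      = ∑ a, ∑ b, Q a b * (z b * z a + z b * z a * poly2 S k z) := fun z => by
    simp only [dotProduct, Matrix.mulVec, Finset.mul_sum, Finset.sum_mul]
    exact Finset.sum_congr rfl fun a _ => Finset.sum_congr rfl fun b _ => by ring
  simp only [h3]
  refine ⟨integrable_finsetSum _ fun a _ => integrable_finsetSum _ fun b _ => h2 a b, ?_⟩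
  rw [integral_finsetSum]
  swap
  · exact fun a _ => integrable_finsetSum _ fun b _ => h2 a b
  simp only [Matrix.trace, Matrix.diag, Matrix.mul_apply (M := Q)]
  refine Finset.sum_congr rfl fun a _ => ?_
  rw [integral_finsetSum]
  swap
  · exact fun b _ => h2 a b
  refine Finset.sum_congr rfl fun b _ => ?_
  rw [integral_const_mul, integral_add (h1 b a) (integrable_coord_mul_coord_mul_poly2 S k b a),
    integral_mul_stdLaw, integral_coord_mul_coord_mul_poly2, Matrix.add_apply, Matrix.one_apply]

lemma integral_linear_mul_poly1 {d : ℕ} (g p : Fin d → ℝ) :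
    Integrable (fun z => (z ⬝ᵥ p) * poly1 g z) (stdLaw d) ∧
    ∫ z, (z ⬝ᵥ p) * poly1 g z ∂(stdLaw d) = g ⬝ᵥ p := by
  have h : ∀ z : Fin d → ℝ, (z ⬝ᵥ p) * poly1 g z = ∑ a, p a * (z a * poly1 g z) := fun z => by
    simp only [dotProduct, Finset.sum_mul]
    exact Finset.sum_congr rfl fun a _ => by ring
  simp only [h]
  refine ⟨integrable_finsetSum _ fun a _ => (integrable_coord_mul_poly1 g a).const_mul _, ?_⟩
  rw [integral_finsetSum]
  swap
  · exact fun a _ => (integrable_coord_mul_poly1 g a).const_mul _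
  simp only [integral_const_mul, integral_coord_mul_poly1, dotProduct]
  exact Finset.sum_congr rfl fun a _ => mul_comm _ _

namespace Coef

variable {d l : ℕ}

/-- The Hamiltonian for given coefficients. -/
def ham (θ : Coef d l) (r : ℝ) (p : Fin d → ℝ) (Γ : Matrix (Fin d) (Fin d) ℝ) : ℝ :=
  (1 / 2) * (θ.diff * (1 + θ.S * θ.Sᵀ) * θ.diffᵀ * Γ).trace
    + (θ.drift + θ.diff *ᵥ θ.g) ⬝ᵥ p - θ.disc * r + θ.cost

lemma continuous_ham (p : Fin d → ℝ) (Γ : Matrix (Fin d) (Fin d) ℝ) :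
    Continuous fun q : Coef d l × ℝ => q.1.ham q.2 p Γ := by
  unfold ham
  have hσ : Continuous fun q : Coef d l × ℝ => q.1.diff := by fun_prop
  have hS : Continuous fun q : Coef d l × ℝ => q.1.S := by fun_prop
  have hg : Continuous fun q : Coef d l × ℝ => q.1.g := by fun_prop
  have hf : Continuous fun q : Coef d l × ℝ => q.1.drift := by fun_prop
  have h1 : Continuous fun q : Coef d l × ℝ =>
      (q.1.diff * (1 + q.1.S * q.1.Sᵀ) * q.1.diffᵀ * Γ).trace :=
    ((((hσ.matrix_mul (continuous_const.add (hS.matrix_mul hS.matrix_transpose))).matrix_mul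
      hσ.matrix_transpose).matrix_mul continuous_const)).matrix_trace
  have h2 : Continuous fun q : Coef d l × ℝ => (q.1.drift + q.1.diff *ᵥ q.1.g) ⬝ᵥ p :=
    (hf.add (hσ.matrix_mulVec hg)).dotProduct continuous_const
  fun_prop

/-- The scaled displacement in time and space. -/
def disp (h : ℝ) (θ : Coef d l) (z : Fin d → ℝ) : ℝ × (Fin d → ℝ) :=
  (Real.sqrt h, Real.sqrt h • θ.drift + θ.diff *ᵥ z)

lemma disp_tendsto {ι : Type*} {L : Filter ι} {h : ι → ℝ} {θ : ι → Coef d l} {θ₀ : Coef d l}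
    (hh : Tendsto h L (𝓝 0)) (hθ : Tendsto θ L (𝓝 θ₀)) (z : Fin d → ℝ) :
    Tendsto (fun i => (θ i).disp (h i) z) L (𝓝 (0, θ₀.diff *ᵥ z)) := by
  have hc : Continuous fun q : ℝ × Coef d l => q.2.disp q.1 z := by
    unfold disp
    refine Continuous.prodMk (by fun_prop) (continuous_pi fun i => ?_)
    simp only [Pi.add_apply, Pi.smul_apply, Matrix.mulVec, dotProduct, Matrix.of_apply]
    fun_prop
  have := (hc.tendsto (0, θ₀)).comp (hh.prodMk_nhds hθ)
  have e : θ₀.disp 0 z = (0, θ₀.diff *ᵥ z) := by simp [disp]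
  rw [← e]
  exact this

lemma norm_diff_mulVec_le (θ : Coef d l) (z : Fin d → ℝ) : ‖θ.diff *ᵥ z‖ ≤ d * ‖θ‖ * ‖z‖ := by
  refine (pi_norm_le_iff_of_nonneg (by positivity)).2 fun i => ?_
  simp only [Matrix.mulVec, dotProduct, Matrix.of_apply]
  refine (norm_sum_le _ _).trans ?_
  calc ∑ j, ‖θ.2.1 i j * z j‖ ≤ ∑ _j : Fin d, ‖θ‖ * ‖z‖ := by
        refine Finset.sum_le_sum fun j _ => ?_
        rw [norm_mul]
        refine mul_le_mul ?_ (norm_le_pi_norm z j) (norm_nonneg _) (norm_nonneg _)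
        exact (norm_le_pi_norm _ j).trans ((norm_le_pi_norm _ i).trans
          ((norm_fst_le θ.2).trans (norm_snd_le θ)))
    _ = _ := by simp; ring

lemma norm_disp_le {h : ℝ} (hh : h ≤ 1) (θ : Coef d l) (z : Fin d → ℝ) :
    ‖θ.disp h z‖ ≤ (1 + (d + 1) * ‖θ‖) * (1 + ‖z‖) := by
  have hs : Real.sqrt h ≤ 1 := Real.sqrt_le_one.2 hh
  have hs0 := Real.sqrt_nonneg h
  have hz := norm_nonneg z
  have hθ := norm_nonneg θ
  have hd : (0 : ℝ) ≤ d := Nat.cast_nonneg d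
  rw [disp, Prod.norm_def, sup_le_iff]
  constructor
  · rw [Real.norm_of_nonneg hs0]
    have : 1 * 1 ≤ (1 + (d + 1) * ‖θ‖) * (1 + ‖z‖) := by
      refine mul_le_mul ?_ (by linarith) zero_le_one (by positivity)
      have := mul_nonneg (by positivity : (0 : ℝ) ≤ d + 1) hθ
      linarith
    linarith
  · refine (norm_add_le _ _).trans ?_
    rw [norm_smul, Real.norm_of_nonneg hs0]
    have h1 : Real.sqrt h * ‖θ.drift‖ ≤ 1 * ‖θ‖ := mul_le_mul hs (norm_fst_le θ) (norm_nonneg _)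
      zero_le_one
    have h2 := norm_diff_mulVec_le θ z
    have h3 := mul_nonneg hθ hz
    have h4 := mul_nonneg hd hθ
    nlinarith [mul_nonneg h4 hz]

/-- The part of the normalized increment of a test function that remains after its odd part is
removed. -/
def evenPart (k : ℕ) (Φ : ℝ × (Fin d → ℝ) → ℝ) (h : ℝ) (q : ℝ × (Fin d → ℝ)) (θ : Coef d l)
    (z : Fin d → ℝ) : ℝ :=
  h⁻¹ * ((Φ (q.1 + h, θ.move h q.2 z) - Φ q) * θ.weight k h z)
    - (Real.sqrt h)⁻¹ * (fderiv ℝ Φ q (0, θ.diff *ᵥ z) * (1 + poly2 θ.S k z))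

variable {Φ : ℝ × (Fin d → ℝ) → ℝ}

/-- Apply the second-order Taylor formula to the displacement `√h • disp`. The gradient term is of
order `√h`: against `1 + P²` it is the subtracted odd part, while against `√h P¹` it is of order `h`
and survives division by `h`. -/
lemma evenPart_eq (k : ℕ) (hΦ : ContDiff ℝ 2 Φ) {h : ℝ} (hh : 0 < h) (q : ℝ × (Fin d → ℝ))
    (θ : Coef d l) (z : Fin d → ℝ) : ∃ s ∈ Icc (0 : ℝ) 1, evenPart k Φ h q θ z =
      (fderiv ℝ Φ q (1, θ.drift) + (1 / 2) * fderiv ℝ (fderiv ℝ Φ)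
        (q + s • Real.sqrt h • θ.disp h z) (θ.disp h z) (θ.disp h z)) * θ.weight k h z
      + fderiv ℝ Φ q (0, θ.diff *ᵥ z) * poly1 θ.g z := by
  obtain ⟨s, hs, h1⟩ := exists_taylor_two hΦ q (Real.sqrt h • θ.disp h z)
  refine ⟨s, hs, ?_⟩
  have hsq : Real.sqrt h * Real.sqrt h = h := Real.mul_self_sqrt hh.le
  have hs0 : Real.sqrt h ≠ 0 := (Real.sqrt_pos.2 hh).ne'
  have e1 : (q.1 + h, θ.move h q.2 z) = q + Real.sqrt h • θ.disp h z := by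
    refine Prod.ext ?_ ?_
    · simp [disp, hsq]
    · simp [disp, move, smul_smul, hsq, add_assoc]
  have e2 : Real.sqrt h • θ.disp h z
      = h • ((1 : ℝ), θ.drift) + Real.sqrt h • ((0 : ℝ), θ.diff *ᵥ z) := by
    refine Prod.ext ?_ ?_
    · simp [disp, hsq]
    · simp [disp, smul_smul, hsq]
  have e3 : fderiv ℝ Φ q (Real.sqrt h • θ.disp h z)
      = h * fderiv ℝ Φ q (1, θ.drift) + Real.sqrt h * fderiv ℝ Φ q (0, θ.diff *ᵥ z) := by
    rw [e2, map_add, map_smul, map_smul, smul_eq_mul, smul_eq_mul]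
  set D₂ := fderiv ℝ (fderiv ℝ Φ) (q + s • Real.sqrt h • θ.disp h z)
  have e4 : D₂ (Real.sqrt h • θ.disp h z) (Real.sqrt h • θ.disp h z)
      = h * D₂ (θ.disp h z) (θ.disp h z) := by
    rw [(D₂ _).map_smul, D₂.map_smul, smul_apply, smul_smul, hsq, smul_eq_mul]
  rw [e3, e4] at h1
  rw [evenPart, e1, h1, weight]
  have hinv : (Real.sqrt h)⁻¹ = h⁻¹ * Real.sqrt h := by
    field_simp
    exact (Real.sq_sqrt hh.le).symm
  rw [hinv]
  set D₁ := fderiv ℝ Φ q (1, θ.drift)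
  set E₁ := fderiv ℝ Φ q (0, θ.diff *ᵥ z)
  set B := D₂ (θ.disp h z) (θ.disp h z)
  have hi : h⁻¹ * h = 1 := inv_mul_cancel₀ hh.ne'
  calc _ = h⁻¹ * h * ((D₁ + 1 / 2 * B) * (1 + Real.sqrt h * poly1 θ.g z + poly2 θ.S k z))
        + h⁻¹ * (Real.sqrt h * Real.sqrt h) * (E₁ * poly1 θ.g z) := by ring
    _ = _ := by rw [hsq, hi]; ring

/-- The limit of `evenPart`. -/
def evenLimit (k : ℕ) (Φ : ℝ × (Fin d → ℝ) → ℝ) (q : ℝ × (Fin d → ℝ)) (θ : Coef d l)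
    (z : Fin d → ℝ) : ℝ :=
  (fderiv ℝ Φ q (1, θ.drift) + (1 / 2) * fderiv ℝ (fderiv ℝ Φ) q (0, θ.diff *ᵥ z)
    (0, θ.diff *ᵥ z)) * (1 + poly2 θ.S k z) + fderiv ℝ Φ q (0, θ.diff *ᵥ z) * poly1 θ.g z

lemma evenPart_tendsto {ι : Type*} {L : Filter ι} (k : ℕ) (hΦ : ContDiff ℝ 2 Φ) {h : ι → ℝ}
    {q : ι → ℝ × (Fin d → ℝ)} {θ : ι → Coef d l} {q₀ : ℝ × (Fin d → ℝ)} {θ₀ : Coef d l}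
    (hpos : ∀ᶠ i in L, 0 < h i) (hh : Tendsto h L (𝓝 0)) (hq : Tendsto q L (𝓝 q₀))
    (hθ : Tendsto θ L (𝓝 θ₀)) (z : Fin d → ℝ) :
    Tendsto (fun i => evenPart k Φ (h i) (q i) (θ i) z) L (𝓝 (evenLimit k Φ q₀ θ₀ z)) := by
  have hs : ∀ i, ∃ s ∈ Icc (0 : ℝ) 1, 0 < h i → evenPart k Φ (h i) (q i) (θ i) z =
      (fderiv ℝ Φ (q i) (1, (θ i).drift) + (1 / 2) * fderiv ℝ (fderiv ℝ Φ)
        (q i + s • Real.sqrt (h i) • (θ i).disp (h i) z) ((θ i).disp (h i) z)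
          ((θ i).disp (h i) z)) * (θ i).weight k (h i) z
      + fderiv ℝ Φ (q i) (0, (θ i).diff *ᵥ z) * poly1 (θ i).g z := fun i => by
    by_cases hi : 0 < h i
    · obtain ⟨s, hs, h1⟩ := evenPart_eq k hΦ hi (q i) (θ i) z
      exact ⟨s, hs, fun _ => h1⟩
    · exact ⟨0, by simp, fun h => absurd h hi⟩
  choose s hs hsE using hs
  have hc1 : Continuous (fderiv ℝ Φ) := hΦ.continuous_fderiv (by norm_num)
  have hc2 : Continuous (fderiv ℝ (fderiv ℝ Φ)) :=
    (hΦ.fderiv_right (m := 1) (by norm_num)).continuous_fderiv (by norm_num)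
  have hdisp := disp_tendsto hh hθ z
  have hsqrt : Tendsto (fun i => Real.sqrt (h i)) L (𝓝 0) := by
    have := (Real.continuous_sqrt.tendsto 0).comp hh
    rw [Real.sqrt_zero] at this
    exact this
  have hsmall : Tendsto (fun i => s i • Real.sqrt (h i) • (θ i).disp (h i) z) L (𝓝 0) := by
    have h0 : Tendsto (fun i => ‖Real.sqrt (h i) • (θ i).disp (h i) z‖) L (𝓝 0) := by
      simpa using (hsqrt.smul hdisp).norm
    refine squeeze_zero_norm (fun i => ?_) h0
    rw [norm_smul, Real.norm_of_nonneg (hs i).1]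
    exact mul_le_of_le_one_left (norm_nonneg _) (hs i).2
  have hqs : Tendsto (fun i => q i + s i • Real.sqrt (h i) • (θ i).disp (h i) z) L (𝓝 q₀) := by
    simpa using hq.add hsmall
  have hf : Tendsto (fun i => ((1 : ℝ), (θ i).drift)) L (𝓝 ((1 : ℝ), θ₀.drift)) :=
    tendsto_const_nhds.prodMk_nhds ((continuous_fst.tendsto θ₀).comp hθ)
  have hσc : Continuous fun θ : Coef d l => ((0 : ℝ), θ.diff *ᵥ z) := by
    have : Continuous fun θ : Coef d l => θ.diff := by fun_prop
    exact continuous_const.prodMk (this.matrix_mulVec continuous_const)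
  have hσ := (hσc.tendsto θ₀).comp hθ
  have hg : Tendsto (fun i => poly1 (θ i).g z) L (𝓝 (poly1 θ₀.g z)) := by
    have : Continuous fun θ : Coef d l => poly1 θ.g z :=
      continuous_poly1.comp (f := fun θ : Coef d l => (θ.g, z)) (by fun_prop)
    exact (this.tendsto θ₀).comp hθ
  have hw := weight_tendsto (k := k) hh hθ z
  have hw0 : θ₀.weight k 0 z = 1 + poly2 θ₀.S k z := by simp [weight]
  rw [hw0] at hw
  have hD := (hc1.tendsto q₀).comp hq
  have hD2 := (hc2.tendsto q₀).comp hqs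
  have happ : ∀ {G : Type} [NormedAddCommGroup G] [NormedSpace ℝ G]
      {a : ι → (ℝ × (Fin d → ℝ)) →L[ℝ] G} {a₀ : (ℝ × (Fin d → ℝ)) →L[ℝ] G}
      {u : ι → ℝ × (Fin d → ℝ)} {u₀ : ℝ × (Fin d → ℝ)}, Tendsto a L (𝓝 a₀) →
      Tendsto u L (𝓝 u₀) → Tendsto (fun i => a i (u i)) L (𝓝 (a₀ u₀)) := by
    intro G _ _ a a₀ u u₀ ha hu
    exact (isBoundedBilinearMap_apply.continuous.tendsto (a₀, u₀)).comp (ha.prodMk_nhds hu)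
  have key := (((happ hD hf).add ((happ (happ hD2 hdisp) hdisp).const_mul
    (1 / 2))).mul hw).add ((happ hD hσ).mul hg)
  refine key.congr' ?_
  filter_upwards [hpos] with i hi
  rw [hsE i hi]
  rfl

/-- The dominating function for the limit under the integral, uniform in small `h` and in bounded
coefficients. Two powers come from the squared displacement and `4k + 2` from the weight. -/
lemma abs_evenPart_le (k : ℕ) (hΦ : ContDiff ℝ 2 Φ) {C₁ C₂ B W : ℝ}
    (hC₁ : ∀ q, ‖fderiv ℝ Φ q‖ ≤ C₁) (hC₂ : ∀ q, ‖fderiv ℝ (fderiv ℝ Φ) q‖ ≤ C₂)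
    {h : ℝ} (hh : 0 < h) (hh1 : h ≤ 1) (q : ℝ × (Fin d → ℝ)) {θ : Coef d l} (hθ : ‖θ‖ ≤ B)
    (hW : θ.weightBound k h ≤ W) (z : Fin d → ℝ) :
    |evenPart k Φ h q θ z| ≤ ((C₁ * (1 + B) + C₂ * (1 + (d + 1) * B) ^ 2) * W
      + C₁ * (d * B) * (2 * d * B)) * (1 + ‖z‖) ^ (4 * k + 4) := by
  obtain ⟨s, -, e⟩ := evenPart_eq k hΦ hh q θ z
  rw [e]
  have hC₁0 : 0 ≤ C₁ := (norm_nonneg _).trans (hC₁ 0)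
  have hC₂0 : 0 ≤ C₂ := (norm_nonneg (fderiv ℝ (fderiv ℝ Φ) 0)).trans (hC₂ 0)
  have hB0 : 0 ≤ B := (norm_nonneg _).trans hθ
  have hz := norm_nonneg z
  have hz1 : (1 : ℝ) ≤ 1 + ‖z‖ := by linarith
  have a1 : |fderiv ℝ Φ q (1, θ.drift)| ≤ C₁ * (1 + B) * (1 + ‖z‖) ^ 2 := by
    have h1 : ‖((1 : ℝ), θ.drift)‖ ≤ 1 + B := by
      rw [Prod.norm_def, sup_le_iff]
      exact ⟨by simpa using hB0, ((norm_fst_le θ).trans hθ).trans (by linarith)⟩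
    have h2 : ‖fderiv ℝ Φ q (1, θ.drift)‖ ≤ C₁ * (1 + B) :=
      ((fderiv ℝ Φ q).le_opNorm _).trans (mul_le_mul (hC₁ q) h1 (norm_nonneg _) hC₁0)
    exact h2.trans (le_mul_of_one_le_right (by positivity) (one_le_pow₀ hz1))
  have a2 : ∀ q', |(1 / 2) * fderiv ℝ (fderiv ℝ Φ) q' (θ.disp h z) (θ.disp h z)|
      ≤ C₂ * (1 + (d + 1) * B) ^ 2 * (1 + ‖z‖) ^ 2 := fun q' => by
    have h1 : ‖θ.disp h z‖ ≤ (1 + (d + 1) * B) * (1 + ‖z‖) :=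
      (norm_disp_le hh1 θ z).trans (by gcongr)
    have h2 : ‖fderiv ℝ (fderiv ℝ Φ) q' (θ.disp h z) (θ.disp h z)‖
        ≤ C₂ * ((1 + (d + 1) * B) * (1 + ‖z‖)) * ((1 + (d + 1) * B) * (1 + ‖z‖)) := by
      refine ((fderiv ℝ (fderiv ℝ Φ) q').le_opNorm₂ _ _).trans ?_
      have := hC₂ q'
      gcongr
    rw [abs_mul, abs_of_pos (by norm_num : (0 : ℝ) < 1 / 2)]
    rw [Real.norm_eq_abs] at h2
    have h3 := abs_nonneg (fderiv ℝ (fderiv ℝ Φ) q' (θ.disp h z) (θ.disp h z))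
    calc _ ≤ |fderiv ℝ (fderiv ℝ Φ) q' (θ.disp h z) (θ.disp h z)| := by linarith
      _ ≤ _ := h2
      _ = _ := by ring
  have a3 : |θ.weight k h z| ≤ W * (1 + ‖z‖) ^ (4 * k + 2) :=
    (abs_weight_le k h θ z).trans (by gcongr)
  have a4 : |fderiv ℝ Φ q (0, θ.diff *ᵥ z)| ≤ C₁ * (d * B) * (1 + ‖z‖) := by
    have h1 : ‖((0 : ℝ), θ.diff *ᵥ z)‖ ≤ d * B * (1 + ‖z‖) := by
      rw [Prod.norm_def, sup_le_iff]
      refine ⟨by simp; positivity, (norm_diff_mulVec_le θ z).trans ?_⟩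
      gcongr
      linarith
    have h2 : ‖fderiv ℝ Φ q (0, θ.diff *ᵥ z)‖ ≤ C₁ * (d * B * (1 + ‖z‖)) :=
      ((fderiv ℝ Φ q).le_opNorm _).trans (mul_le_mul (hC₁ q) h1 (norm_nonneg _) hC₁0)
    rw [Real.norm_eq_abs] at h2
    linarith
  have a5 : |poly1 θ.g z| ≤ 2 * d * B * (1 + ‖z‖) := by
    rw [abs_of_nonneg (poly1_nonneg _ _)]
    refine (poly1_le θ.g z).trans ?_
    have : ‖θ.g‖ ≤ B :=
      ((norm_fst_le θ.2.2).trans ((norm_snd_le θ.2).trans (norm_snd_le θ))).trans hθ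
    gcongr
    linarith
  have hW0 : 0 ≤ W := by
    have := (abs_nonneg _).trans (a3)
    exact nonneg_of_mul_nonneg_left this (by positivity)
  refine (abs_add_le _ _).trans ?_
  rw [abs_mul, abs_mul, add_mul]
  refine add_le_add ?_ ?_
  · calc _ ≤ (C₁ * (1 + B) * (1 + ‖z‖) ^ 2 + C₂ * (1 + (d + 1) * B) ^ 2 * (1 + ‖z‖) ^ 2)
          * (W * (1 + ‖z‖) ^ (4 * k + 2)) :=
          mul_le_mul ((abs_add_le _ _).trans (add_le_add a1 (a2 _))) a3 (abs_nonneg _)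
            (by positivity)
      _ = _ := by ring
  · calc _ ≤ C₁ * (d * B) * (1 + ‖z‖) * (2 * d * B * (1 + ‖z‖)) :=
          mul_le_mul a4 a5 (abs_nonneg _) (by positivity)
      _ = C₁ * (d * B) * (2 * d * B) * (1 + ‖z‖) ^ 2 := by ring
      _ ≤ _ := by
          refine mul_le_mul_of_nonneg_left ?_ (by positivity)
          exact pow_le_pow_right₀ hz1 (by omega)

end Coef

namespace Coef

variable {d l : ℕ} {Φ : ℝ × (Fin d → ℝ) → ℝ}

/-- The factor `1 + P²` has mean one and second moments `1 + Σ Σᵀ`, which give the time derivative,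
the uncontrolled drift and the second-order term. The `P¹` term supplies the remaining drift `σ₀ g`.
Taking `r = 0` and removing the reward leaves only the derivative part of the Hamiltonian. -/
lemma integral_evenLimit (k : ℕ) (hΦ : ContDiff ℝ 2 Φ) (t : ℝ) (x : Fin d → ℝ) (θ : Coef d l) :
    ∫ z, evenLimit k Φ (t, x) θ z ∂(stdLaw d) = deriv (fun s => Φ (s, x)) t
      + θ.ham 0 (spaceGrad Φ t x) (spaceHess Φ t x) - θ.cost := by
  set p := spaceGrad Φ t x with hp
  set Γ := spaceHess Φ t x with hΓ
  have hdot : ∀ z w : Fin d → ℝ, (θ.diff *ᵥ z) ⬝ᵥ w = z ⬝ᵥ θ.diffᵀ *ᵥ w := fun z w => by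
    rw [Matrix.dotProduct_mulVec, Matrix.vecMul_transpose]
  have e1 : fderiv ℝ Φ (t, x) (1, θ.drift) = deriv (fun s => Φ (s, x)) t + θ.drift ⬝ᵥ p := by
    have : ((1 : ℝ), θ.drift) = (1, 0) + (0, θ.drift) := by simp
    rw [this, map_add, deriv_time_eq hΦ, fderiv_space_apply hΦ]
  have e2 : ∀ z, fderiv ℝ Φ (t, x) (0, θ.diff *ᵥ z) = z ⬝ᵥ θ.diffᵀ *ᵥ p := fun z => by
    rw [fderiv_space_apply hΦ, hdot]
  have e3 : ∀ z, fderiv ℝ (fderiv ℝ Φ) (t, x) (0, θ.diff *ᵥ z) (0, θ.diff *ᵥ z)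
      = z ⬝ᵥ (θ.diffᵀ * Γ * θ.diff) *ᵥ z := fun z => by
    rw [fderiv_fderiv_space_apply hΦ, hdot, Matrix.mulVec_mulVec, Matrix.mulVec_mulVec,
      Matrix.mul_assoc]
  obtain ⟨i1, h1⟩ := integral_quadratic_mul_weight θ.S k (θ.diffᵀ * Γ * θ.diff)
  obtain ⟨i2, h2⟩ := integral_linear_mul_poly1 θ.g (θ.diffᵀ *ᵥ p)
  have i3 : Integrable (fun z => 1 + poly2 θ.S k z) (stdLaw d) :=
    (integrable_const _).add (integrable_poly2 _ _)
  have h3 : ∫ z, (1 + poly2 θ.S k z) ∂(stdLaw d) = 1 := by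
    rw [integral_add (integrable_const _) (integrable_poly2 _ _), integral_poly2]
    simp
  have hre : ∀ z, evenLimit k Φ (t, x) θ z
      = ((deriv (fun s => Φ (s, x)) t + θ.drift ⬝ᵥ p) * (1 + poly2 θ.S k z)
        + (1 / 2) * ((z ⬝ᵥ (θ.diffᵀ * Γ * θ.diff) *ᵥ z) * (1 + poly2 θ.S k z)))
        + (z ⬝ᵥ θ.diffᵀ *ᵥ p) * poly1 θ.g z := fun z => by
    rw [evenLimit, e1, e2, e3]
    ring
  have i4 : Integrable (fun z => (deriv (fun s => Φ (s, x)) t + θ.drift ⬝ᵥ p)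
      * (1 + poly2 θ.S k z) + (1 / 2) * ((z ⬝ᵥ (θ.diffᵀ * Γ * θ.diff) *ᵥ z)
      * (1 + poly2 θ.S k z))) (stdLaw d) := (i3.const_mul _).add (i1.const_mul _)
  simp only [hre]
  rw [integral_add i4 i2, integral_add (i3.const_mul _) (i1.const_mul _), integral_const_mul,
    integral_const_mul, h1, h2, h3, ham, ← hdot, add_dotProduct]
  have htr : (θ.diffᵀ * Γ * θ.diff * (1 + θ.S * θ.Sᵀ)).trace
      = (θ.diff * (1 + θ.S * θ.Sᵀ) * θ.diffᵀ * Γ).trace := by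
    rw [Matrix.mul_assoc (θ.diffᵀ * Γ), Matrix.trace_mul_comm, Matrix.mul_assoc _ θ.diffᵀ Γ]
  rw [htr]
  ring

lemma exists_fderiv_bound {E G : Type*} [NormedAddCommGroup E] [NormedSpace ℝ E]
    [NormedAddCommGroup G] [NormedSpace ℝ G] {f : E → G} (hc : HasCompactSupport f)
    (hf : ContDiff ℝ 1 f) : ∃ C, ∀ q, ‖fderiv ℝ f q‖ ≤ C :=
  (hc.fderiv ℝ).exists_bound_of_continuous (hf.continuous_fderiv (by norm_num))

lemma exists_bounds_of_hasCompactSupport (hΦ : ContDiff ℝ 2 Φ) {c : ℝ}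
    (hc : HasCompactSupport fun q => Φ q - c) :
    ∃ B C₁ C₂, (∀ q, |Φ q| ≤ B) ∧ (∀ q, ‖fderiv ℝ Φ q‖ ≤ C₁) ∧
      ∀ q, ‖fderiv ℝ (fderiv ℝ Φ) q‖ ≤ C₂ := by
  have h0 : Continuous fun q => Φ q - c := hΦ.continuous.sub continuous_const
  obtain ⟨B, hB⟩ := hc.exists_bound_of_continuous h0
  have h1 : fderiv ℝ (fun q => Φ q - c) = fderiv ℝ Φ := by
    funext q
    rw [fderiv_sub_const]
  have hc1 : HasCompactSupport (fderiv ℝ Φ) := by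
    rw [← h1]
    exact hc.fderiv ℝ
  have hΦ1 : ContDiff ℝ 1 (fderiv ℝ Φ) := hΦ.fderiv_right (by norm_num)
  obtain ⟨C₁, hC₁⟩ := hc1.exists_bound_of_continuous hΦ1.continuous
  obtain ⟨C₂, hC₂⟩ := exists_fderiv_bound hc1 hΦ1
  refine ⟨B + |c|, C₁, C₂, fun q => ?_, hC₁, hC₂⟩
  have h2 : |Φ q - c| ≤ B := hB q
  have h3 := abs_add_le (Φ q - c) c
  rw [sub_add_cancel] at h3
  linarith

lemma aestronglyMeasurable_evenPart (k : ℕ) (hΦ : ContDiff ℝ 2 Φ) (h : ℝ) (q : ℝ × (Fin d → ℝ))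
    (θ : Coef d l) : AEStronglyMeasurable (evenPart k Φ h q θ) (stdLaw d) := by
  have h1 : Measurable fun z => Φ (q.1 + h, θ.move h q.2 z) :=
    hΦ.continuous.measurable.comp (measurable_const.prodMk (measurable_move h θ q.2))
  have h2 := measurable_weight k h θ
  have h3 : Measurable fun z : Fin d → ℝ => fderiv ℝ Φ q (0, θ.diff *ᵥ z) :=
    ((fderiv ℝ Φ q).continuous.comp
      (continuous_const.prodMk (by fun_prop : Continuous fun z => θ.diff *ᵥ z))).measurable
  have h4 := measurable_poly2 θ.S k
  unfold evenPart
  exact (((h1.sub_const _).mul h2).const_mul _ |>.sub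
    ((h3.mul (h4.const_add 1)).const_mul _)).aestronglyMeasurable

/-- The singular term subtracted in `evenPart` is linear in `z` times an even function, so its
integral vanishes; only the weighted increment remains. -/
lemma integral_evenPart (k : ℕ) (hΦ : ContDiff ℝ 2 Φ) {B : ℝ} (hB : ∀ q, |Φ q| ≤ B) (h : ℝ)
    (q : ℝ × (Fin d → ℝ)) (θ : Coef d l) :
    ∫ z, evenPart k Φ h q θ z ∂(stdLaw d)
      = h⁻¹ * (θ.mean k h q.2 (fun y => Φ (q.1 + h, y)) - Φ q * θ.mass h) := by
  have hm : Measurable fun y => Φ (q.1 + h, y) :=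
    hΦ.continuous.measurable.comp measurable_prodMk_left
  have i1 := integrable_mean k h θ q.2 hm (fun y => hB _)
  have i2 := (integrable_weight k h θ).const_mul (Φ q)
  have i3 : Integrable (fun z => h⁻¹ * ((Φ (q.1 + h, θ.move h q.2 z) - Φ q) * θ.weight k h z))
      (stdLaw d) := by
    simp only [sub_mul]
    exact (i1.sub i2).const_mul _
  have hσm : Measurable fun z : Fin d → ℝ => fderiv ℝ Φ q (0, θ.diff *ᵥ z) :=
    ((fderiv ℝ Φ q).continuous.comp
      (continuous_const.prodMk (by fun_prop : Continuous fun z => θ.diff *ᵥ z))).measurable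
  have i4 : Integrable (fun z => fderiv ℝ Φ q (0, θ.diff *ᵥ z) * (1 + poly2 θ.S k z))
      (stdLaw d) := by
    refine integrable_of_norm_le_pow (hσm.mul ((measurable_poly2 θ.S k).const_add 1))
      (‖fderiv ℝ Φ q‖ * (d * ‖θ‖) * θ.weightBound k 0) (1 + (4 * k + 2)) fun z => ?_
    have h1 : |fderiv ℝ Φ q (0, θ.diff *ᵥ z)| ≤ ‖fderiv ℝ Φ q‖ * (d * ‖θ‖) * (1 + ‖z‖) := by
      rw [← Real.norm_eq_abs]
      refine ((fderiv ℝ Φ q).le_opNorm _).trans ?_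
      rw [mul_assoc]
      refine mul_le_mul_of_nonneg_left ?_ (norm_nonneg _)
      rw [Prod.norm_def, sup_le_iff]
      refine ⟨by simp; positivity, (norm_diff_mulVec_le θ z).trans ?_⟩
      gcongr
      linarith
    -- At `h = 0` the weight reduces to `1 + poly2`, so its growth bound can be reused.
    have h2 := abs_weight_le k 0 θ z
    have h3 : θ.weight k 0 z = 1 + poly2 θ.S k z := by simp [weight]
    rw [h3] at h2
    rw [abs_mul, pow_add, pow_one]
    calc _ ≤ (‖fderiv ℝ Φ q‖ * (d * ‖θ‖) * (1 + ‖z‖)) * (θ.weightBound k 0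
          * (1 + ‖z‖) ^ (4 * k + 2)) := mul_le_mul h1 h2 (abs_nonneg _) (by positivity)
      _ = _ := by ring
  have hodd : ∫ z, fderiv ℝ Φ q (0, θ.diff *ᵥ z) * (1 + poly2 θ.S k z) ∂(stdLaw d) = 0 := by
    refine integral_eq_zero_of_odd fun z => ?_
    have : ((0 : ℝ), -(θ.diff *ᵥ z)) = -(0, θ.diff *ᵥ z) := by simp
    rw [poly2_neg, Matrix.mulVec_neg, this, map_neg, neg_mul]
  unfold evenPart
  rw [integral_sub i3 (i4.const_mul _), integral_const_mul, integral_const_mul, hodd]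
  simp only [sub_mul]
  rw [integral_sub i1 i2, integral_const_mul, integral_weight, mul_zero, sub_zero]
  rfl

lemma mass_tendsto {ι : Type*} {L : Filter ι} {h : ι → ℝ} {θ : ι → Coef d l} {θ₀ : Coef d l}
    (hh : Tendsto h L (𝓝 0)) (hθ : Tendsto θ L (𝓝 θ₀)) :
    Tendsto (fun i => (θ i).mass (h i)) L (𝓝 1) := by
  -- The mass at `h` minus one is `√h` times the mass at step size `1` minus one; the latter stays
  -- bounded by continuity in `θ`.
  have h1 := ((continuous_mass (d := d) (l := l) 1).tendsto θ₀).comp hθ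
  have h2 := (Real.continuous_sqrt.tendsto 0).comp hh
  rw [Real.sqrt_zero] at h2
  have h3 := (h2.mul (h1.sub_const 1)).const_add 1
  rw [zero_mul, add_zero] at h3
  refine h3.congr fun i => ?_
  simp [mass]

/-- Consistency of the scheme. -/
lemma step_tendsto {ι : Type*} {L : Filter ι} [L.IsCountablyGenerated] (k : ℕ)
    (hΦ : ContDiff ℝ 2 Φ) {c : ℝ} (hc : HasCompactSupport fun q => Φ q - c) {h r e : ι → ℝ}
    {q : ι → ℝ × (Fin d → ℝ)} {θ : ι → Coef d l} {t₀ r₀ : ℝ} {x₀ : Fin d → ℝ} {θ₀ : Coef d l}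
    (hpos : ∀ᶠ i in L, 0 < h i) (hh : Tendsto h L (𝓝 0)) (hq : Tendsto q L (𝓝 (t₀, x₀)))
    (hθ : Tendsto θ L (𝓝 θ₀)) (hr : Tendsto r L (𝓝 r₀))
    (he : Tendsto (fun i => (h i)⁻¹ * e i) L (𝓝 0)) :
    Tendsto (fun i => (θ i).step k (h i) (q i).2 (r i)
      (fun y => Φ ((q i).1 + h i, y) + (r i - Φ (q i) + e i))) L
      (𝓝 (deriv (fun s => Φ (s, x₀)) t₀
        + θ₀.ham r₀ (spaceGrad Φ t₀ x₀) (spaceHess Φ t₀ x₀))) := by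
  obtain ⟨B, C₁, C₂, hB, hC₁, hC₂⟩ := exists_bounds_of_hasCompactSupport hΦ hc
  have hlim : Tendsto (fun i => ∫ z, evenPart k Φ (h i) (q i) (θ i) z ∂(stdLaw d)) L
      (𝓝 (∫ z, evenLimit k Φ (t₀, x₀) θ₀ z ∂(stdLaw d))) := by
    have hθn : ∀ᶠ i in L, ‖θ i‖ ≤ ‖θ₀‖ + 1 := hθ.norm.eventually_le_const (by linarith)
    refine tendsto_integral_filter_of_dominated_convergence (fun z =>
      ((C₁ * (1 + (‖θ₀‖ + 1)) + C₂ * (1 + (d + 1) * (‖θ₀‖ + 1)) ^ 2)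
        * (θ₀.weightBound k 0 + 1) + C₁ * (d * (‖θ₀‖ + 1)) * (2 * d * (‖θ₀‖ + 1)))
        * (1 + ‖z‖) ^ (4 * k + 4)) ?_ ?_ ?_ ?_
    · exact Eventually.of_forall fun i => aestronglyMeasurable_evenPart k hΦ _ _ _
    · filter_upwards [hpos, hh.eventually_le_const zero_lt_one, hθn,
        weightBound_eventually (k := k) hh hθ] with i h1 h2 h3 h4
      exact Eventually.of_forall fun z => abs_evenPart_le k hΦ hC₁ hC₂ h1 h2 (q i) h3 h4 z
    · exact (integrable_one_add_norm_pow_stdLaw _).const_mul _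
    · exact Eventually.of_forall fun z => evenPart_tendsto k hΦ hpos hh hq hθ z
  have hmass := he.mul (mass_tendsto hh hθ)
  have hdc : Continuous fun θ : Coef d l => θ.disc := by fun_prop
  have hcc : Continuous fun θ : Coef d l => θ.cost := by fun_prop
  have hdisc : Tendsto (fun i => (θ i).disc) L (𝓝 θ₀.disc) := (hdc.tendsto θ₀).comp hθ
  have hcost : Tendsto (fun i => (θ i).cost) L (𝓝 θ₀.cost) := (hcc.tendsto θ₀).comp hθ
  -- Adding the constant `r - Φ(q) + e` to `φ` cancels `h⁻¹ * mass * r` and leaves the normalized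
  -- increment, `h⁻¹ e` times the mass, the discount and the reward.
  have key := ((hlim.add hmass).sub (hdisc.mul hr)).add hcost
  rw [integral_evenLimit k hΦ] at key
  have e0 : deriv (fun s => Φ (s, x₀)) t₀ + θ₀.ham 0 (spaceGrad Φ t₀ x₀) (spaceHess Φ t₀ x₀)
      - θ₀.cost + 0 * 1 - θ₀.disc * r₀ + θ₀.cost
      = deriv (fun s => Φ (s, x₀)) t₀
        + θ₀.ham r₀ (spaceGrad Φ t₀ x₀) (spaceHess Φ t₀ x₀) := by
    unfold ham
    ring
  rw [e0] at key
  refine key.congr fun i => ?_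
  have hm : Measurable fun y => Φ ((q i).1 + h i, y) :=
    hΦ.continuous.measurable.comp measurable_prodMk_left
  rw [integral_evenPart k hΦ hB, step, mean_add_const k (h i) (θ i) (q i).2 hm fun y => hB _]
  ring

lemma step_mono {k : ℕ} {θ : Coef d l} (hθ : (θ.S * θ.Sᵀ).trace ≤ 4 * (k : ℝ) + 2) {h : ℝ}
    (hh : 0 < h) (x : Fin d → ℝ) (r : ℝ) {φ₁ φ₂ : (Fin d → ℝ) → ℝ} (hφ₁ : Measurable φ₁)
    (hφ₂ : Measurable φ₂) {B₁ B₂ : ℝ} (hB₁ : ∀ y, |φ₁ y| ≤ B₁) (hB₂ : ∀ y, |φ₂ y| ≤ B₂)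
    (hle : ∀ y, φ₁ y ≤ φ₂ y) : θ.step k h x r φ₁ ≤ θ.step k h x r φ₂ := by
  have := mul_le_mul_of_nonneg_left (mean_mono hθ h x hφ₁ hφ₂ hB₁ hB₂ hle) (inv_pos.2 hh).le
  unfold step
  linarith

end Coef

/-- The decomposition gives `f = f₀ + σ₀ g` and `σ σᵀ = σ₀ (1 + Σ Σᵀ) σ₀ᵀ`, so the Hamiltonian
depends only on the coefficients used by the scheme. -/
lemma hamiltonianAt_eq_ham {d l : ℕ} {M U : Type*} {P : ControlProblem d M U}
    {A : SchemeData d l M U} (hdec : IsDecomposition P A) (c : M × U) (x : Fin d → ℝ) (r : ℝ)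
    (p : Fin d → ℝ) (Γ : Matrix (Fin d) (Fin d) ℝ) :
    P.hamiltonianAt c.1 c.2 x r p Γ = (coef P A c x).ham r p Γ := by
  have h1 : P.f c.1 x c.2 = A.f₀ c.1 x + A.σ₀ c.1 x *ᵥ A.g c.1 x c.2 := by
    rw [← hdec.drift]
    abel
  have h2 : P.σ c.1 x c.2 * (P.σ c.1 x c.2)ᵀ
      = A.σ₀ c.1 x * (1 + A.S c.1 x c.2 * (A.S c.1 x c.2)ᵀ) * (A.σ₀ c.1 x)ᵀ := by
    rw [sub_eq_iff_eq_add.1 (hdec.diffusion c.1 x c.2)]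
    simp only [mul_add, add_mul, mul_one, Matrix.mul_assoc]
    abel
  rw [ControlProblem.hamiltonianAt, h1, h2]
  rfl

/-! ### The time grid and the interpolation -/

/-- The points of `ℝ × ℝ^d` whose time lies on the grid with step `T / n`. -/
def grid (d : ℕ) (T : ℝ) (n : ℕ) : Set (ℝ × (Fin d → ℝ)) :=
  {q | ∃ i : Fin (n + 1), q.1 = (i : ℝ) * (T / n)}

lemma grid_subset_slab {d : ℕ} {T : ℝ} (hT : 0 < T) (n : ℕ) : grid d T n ⊆ slab d T := by
  rintro ⟨t, x⟩ ⟨i, rfl⟩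
  refine ⟨⟨by positivity, ?_⟩, mem_univ _⟩
  rcases Nat.eq_zero_or_pos n with rfl | hn
  · simpa using hT.le
  · have : (i : ℝ) ≤ n := by exact_mod_cast Nat.lt_succ_iff.1 i.2
    change (i : ℝ) * (T / n) ≤ T
    rw [mul_div_assoc', div_le_iff₀ (by positivity), mul_comm T]
    exact mul_le_mul_of_nonneg_right this hT.le

lemma exists_grid_near {d : ℕ} {T : ℝ} (hT : 0 < T) {n : ℕ} (hn : 0 < n) {q : ℝ × (Fin d → ℝ)}
    (hq : q ∈ slab d T) : ∃ p ∈ grid d T n, dist p q ≤ T / n := by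
  obtain ⟨⟨h0, h1⟩, -⟩ := hq
  have hh : 0 < T / n := by positivity
  set m := ⌊q.1 / (T / n)⌋₊ with hm
  have hm1 : (m : ℝ) ≤ q.1 / (T / n) := Nat.floor_le (by positivity)
  have hm2 : q.1 / (T / n) < m + 1 := Nat.lt_floor_add_one _
  rw [le_div_iff₀ hh] at hm1
  rw [div_lt_iff₀ hh] at hm2
  have hmn : m < n + 1 := by
    have h2 : (m : ℝ) * (T / n) ≤ n * (T / n) := by
      refine hm1.trans (h1.trans_eq ?_)
      field_simp
    exact Nat.lt_succ_iff.2 (by exact_mod_cast le_of_mul_le_mul_right h2 hh)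
  refine ⟨((m : ℝ) * (T / n), q.2), ⟨⟨m, hmn⟩, rfl⟩, ?_⟩
  rw [Prod.dist_eq, dist_self, Real.dist_eq]
  refine max_le (abs_le.2 ⟨?_, ?_⟩) hh.le <;> linarith

lemma tendsto_const_div_natCast (T : ℝ) : Tendsto (fun n : ℕ => T / n) atTop (𝓝 0) :=
  tendsto_const_div_atTop_nhds_zero_nat T

lemma neBot_relFilter_grid {d : ℕ} {T : ℝ} (hT : 0 < T) {q : ℝ × (Fin d → ℝ)}
    (hq : q ∈ slab d T) : (relFilter (grid d T) q).NeBot := by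
  refine neBot_iff.2 fun h => ?_
  have hF : ∀ᶠ _ in relFilter (grid d T) q, False := by simp [h]
  obtain ⟨N, ε, hε, hN⟩ := eventually_relFilter_iff.1 hF
  obtain ⟨n, h1, h2, h3⟩ := ((eventually_ge_atTop N).and ((eventually_gt_atTop 0).and
    ((tendsto_const_div_natCast T).eventually_lt_const hε))).exists
  obtain ⟨p, hp, hpq⟩ := exists_grid_near hT h2 hq
  exact hN n h1 p hp (hpq.trans_lt h3)

lemma sum_hat_eq_one (n : ℕ) {s : ℝ} (h0 : 0 ≤ s) (hn : s ≤ n) :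
    ∑ i ∈ Finset.range (n + 1), max 0 (1 - |s - (i : ℝ)|) = 1 := by
  induction n with
  | zero =>
    have : s = 0 := le_antisymm (by simpa using hn) h0
    simp [this]
  | succ n ih =>
    rw [Finset.sum_range_succ]
    push_cast at hn ⊢
    -- For `s ≤ n` the new hat vanishes. For `s` between `n` and `n + 1` only the last two hats are
    -- active, with weights summing to one.
    rcases le_total s n with h | h
    · rw [ih h, max_eq_left]
      · simp
      · rw [abs_of_nonpos (by linarith)]
        linarith
    · rw [Finset.sum_range_succ, Finset.sum_eq_zero, max_eq_right, max_eq_right]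
      · rw [abs_of_nonneg (by linarith), abs_of_nonpos (by linarith)]
        ring
      · rw [abs_of_nonpos (by linarith)]
        linarith
      · rw [abs_of_nonneg (by linarith)]
        linarith
      · intro i hi
        have : (i : ℝ) + 1 ≤ n := by exact_mod_cast Finset.mem_range.1 hi
        rw [max_eq_left]
        rw [abs_of_nonneg (by linarith)]
        linarith

lemma timeInterp_grid {d : ℕ} {T : ℝ} (hT : 0 < T) {n : ℕ} (hn : 0 < n)
    (w : Fin (n + 1) → (Fin d → ℝ) → ℝ) (i : Fin (n + 1)) (x : Fin d → ℝ) :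
    timeInterp T n w ((i : ℝ) * (T / n), x) = w i x := by
  have hn' : (n : ℝ) ≠ 0 := by positivity
  have e : (i : ℝ) * (T / n) * n / T = i := by field_simp
  rw [timeInterp]
  simp only [e]
  rw [Finset.sum_eq_single i]
  · simp
  · intro j _ hj
    have h1 : 1 ≤ |(i : ℝ) - (j : ℝ)| := by
      have h2 : (i : ℤ) - (j : ℤ) ≠ 0 := fun h => hj (Fin.ext (by omega))
      have h3 := Int.one_le_abs h2
      exact_mod_cast h3
    rw [max_eq_left (by linarith), zero_mul]
  · simp

/-- The hats form a partition of unity on the slab, so the interpolation is a convex combination of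
values at grid times less than one step away. -/
lemma abs_timeInterp_sub_le {d : ℕ} {T : ℝ} (hT : 0 < T) {n : ℕ} (hn : 0 < n)
    (w : Fin (n + 1) → (Fin d → ℝ) → ℝ) {q : ℝ × (Fin d → ℝ)} (hq : q ∈ slab d T) {v ε : ℝ}
    (h : ∀ i : Fin (n + 1), |(i : ℝ) * (T / n) - q.1| < T / n → |w i q.2 - v| ≤ ε) :
    |timeInterp T n w q - v| ≤ ε := by
  obtain ⟨⟨h0, h1⟩, -⟩ := hq
  have hn' : (0 : ℝ) < n := by positivity
  have hsum : ∑ i : Fin (n + 1), max 0 (1 - |q.1 * n / T - (i : ℝ)|) = 1 := by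
    rw [Fin.sum_univ_eq_sum_range (fun i : ℕ => max 0 (1 - |q.1 * n / T - (i : ℝ)|)) (n + 1)]
    refine sum_hat_eq_one n (by positivity) ?_
    rw [div_le_iff₀ hT, mul_comm]
    exact mul_le_mul_of_nonneg_left h1 hn'.le
  have e : timeInterp T n w q - v
      = ∑ i : Fin (n + 1), max 0 (1 - |q.1 * n / T - (i : ℝ)|) * (w i q.2 - v) := by
    simp only [mul_sub, Finset.sum_sub_distrib]
    rw [← Finset.sum_mul, hsum, one_mul]
    rfl
  rw [e]
  refine (Finset.abs_sum_le_sum_abs _ _).trans ?_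
  calc _ ≤ ∑ i : Fin (n + 1), max 0 (1 - |q.1 * n / T - (i : ℝ)|) * ε := by
        refine Finset.sum_le_sum fun i _ => ?_
        rw [abs_mul, abs_of_nonneg (le_max_left _ _)]
        by_cases hi : |q.1 * n / T - (i : ℝ)| < 1
        · refine mul_le_mul_of_nonneg_left (h i ?_) (le_max_left _ _)
          have e2 : (i : ℝ) * (T / n) - q.1 = -((q.1 * n / T - (i : ℝ)) * (T / n)) := by
            field_simp
            ring
          rw [e2, abs_neg, abs_mul, abs_of_pos (show 0 < T / n by positivity)]
          exact mul_lt_of_lt_one_left (by positivity) hi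
        · rw [max_eq_left (by linarith [not_lt.1 hi]), zero_mul, zero_mul]
    _ = ε := by rw [← Finset.sum_mul, hsum, one_mul]

/-- Convergence on the grid implies locally uniform convergence of the interpolation. -/
lemma tendstoLocallyUniformlyOn_timeInterp {d : ℕ} {T : ℝ} (hT : 0 < T)
    {w : (n : ℕ) → Fin (n + 1) → (Fin d → ℝ) → ℝ} {v : ℝ × (Fin d → ℝ) → ℝ}
    (hv : ContinuousOn v (slab d T))
    (h : ∀ q ∈ slab d T, Tendsto (fun z : ℕ × (ℝ × (Fin d → ℝ)) => timeInterp T z.1 (w z.1) z.2)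
      (relFilter (grid d T) q) (𝓝 (v q))) :
    TendstoLocallyUniformlyOn (fun n => timeInterp T n (w n)) v atTop (slab d T) := by
  rw [Metric.tendstoLocallyUniformlyOn_iff]
  intro ε hε q hq
  obtain ⟨N, r, hr, hN⟩ := eventually_relFilter_iff.1
    ((Metric.tendsto_nhds.1 (h q hq)) (ε / 4) (by positivity))
  obtain ⟨r', hr', hvr⟩ := Metric.continuousWithinAt_iff.1 (hv q hq) (ε / 4) (by positivity)
  refine ⟨slab d T ∩ Metric.ball q (min (r / 2) r'), inter_mem self_mem_nhdsWithin
    (mem_nhdsWithin_of_mem_nhds (Metric.ball_mem_nhds _ (by positivity))), ?_⟩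
  filter_upwards [eventually_ge_atTop N, eventually_gt_atTop 0,
    (tendsto_const_div_natCast T).eventually_lt_const (show 0 < r / 2 by positivity)]
    with n hnN hn0 hnr p hp
  obtain ⟨hpΩ, hpq⟩ := hp
  rw [Metric.mem_ball, lt_min_iff] at hpq
  have h1 : |timeInterp T n (w n) p - v q| ≤ ε / 4 := by
    refine abs_timeInterp_sub_le hT hn0 (w n) hpΩ fun i hi => ?_
    have h2 := hN n hnN ((i : ℝ) * (T / n), p.2) ⟨i, rfl⟩ (by
      have h3 : dist ((i : ℝ) * (T / n), p.2) p ≤ T / n := by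
        rw [Prod.dist_eq, dist_self, Real.dist_eq]
        exact max_le hi.le (by positivity)
      linarith [dist_triangle ((i : ℝ) * (T / n), p.2) p q])
    simp only [timeInterp_grid hT hn0, Real.dist_eq] at h2
    exact h2.le
  have h2 := hvr hpΩ hpq.2
  rw [Real.dist_eq] at h2 ⊢
  have h3 := abs_sub_le (v p) (v q) (timeInterp T n (w n) p)
  rw [abs_sub_comm (v q)] at h3
  linarith

lemma isClosed_slab (d : ℕ) (T : ℝ) : IsClosed (slab d T) := isClosed_Icc.prod isClosed_univ

/-- A test function for an upper half-relaxed limit, with near-maximizers on the grids. -/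
lemma exists_test_sequence {d : ℕ} {T C : ℝ} (hT : 0 < T) {V : ℕ → ℝ × (Fin d → ℝ) → ℝ}
    (hV : ∀ᶠ n in atTop, ∀ p ∈ grid d T n, |V n p| ≤ C) {q₀ : ℝ × (Fin d → ℝ)}
    (hq₀ : q₀ ∈ slab d T) {φ : ℝ × (Fin d → ℝ) → ℝ} (hφ : ContDiff ℝ 2 φ)
    (hmax : IsLocalMaxOn (fun q => upperLim (grid d T) V q - φ q) (slab d T) q₀) :
    ∃ (Φ : ℝ × (Fin d → ℝ) → ℝ) (c : ℝ) (ν : ℕ → ℕ) (p : ℕ → ℝ × (Fin d → ℝ)),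
      ContDiff ℝ 2 Φ ∧ HasCompactSupport (fun q => Φ q - c) ∧
      fderiv ℝ Φ q₀ = fderiv ℝ φ q₀ ∧
      fderiv ℝ (fderiv ℝ Φ) q₀ = fderiv ℝ (fderiv ℝ φ) q₀ ∧ Tendsto ν atTop atTop ∧
      (∀ j, p j ∈ grid d T (ν j)) ∧ Tendsto p atTop (𝓝 q₀) ∧
      Tendsto (fun j => V (ν j) (p j)) atTop (𝓝 (upperLim (grid d T) V q₀)) ∧
      ∀ j, ∀ p' ∈ grid d T (ν j), V (ν j) p' - Φ p'
        ≤ V (ν j) (p j) - Φ (p j) + (1 / (ν j : ℝ)) ^ 2 := by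
  have hne : ∀ q ∈ slab d T, (relFilter (grid d T) q).NeBot := fun q hq =>
    neBot_relFilter_grid hT hq
  obtain ⟨Φ, c, ρ, hΦ, hc, h0, h1, h2, hstrict, hout⟩ := exists_global_test (C := C)
    (fun q hq => by have := hne q hq; exact abs_upperLim_le hV q) hφ hmax
  obtain ⟨B, -, -, hB, -, -⟩ := Coef.exists_bounds_of_hasCompactSupport hΦ hc
  have := hne q₀ hq₀
  -- The tolerance must be `o(h)` with `h = T / n`, since the scheme divides it by `h`.
  have hlim : Tendsto (fun n : ℕ => (1 / (n : ℝ)) ^ 2) atTop (𝓝 0) := by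
    have := (tendsto_const_div_natCast 1).pow 2
    simpa using this
  obtain ⟨ν, p, h3, h4, h5, h6, h7⟩ := exists_near_maximizers hV (isClosed_slab d T)
    (grid_subset_slab hT) hΦ.continuous (by rw [h0]) hstrict hout
    (fun q => (abs_le.1 (hB q)).1) (ε := fun n : ℕ => (1 / (n : ℝ)) ^ 2)
    ((eventually_gt_atTop 0).mono fun n hn => by positivity) hlim
  exact ⟨Φ, c, ν, p, hΦ, hc, h1, h2, h3, h4, h5, h6, h7⟩

/-! ### Half-relaxed limits of the discrete solutions -/

section Limits

variable {d l : ℕ} {M U : Type*} {P : ControlProblem d M U} {A : SchemeData d l M U} {k : ℕ}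
  {R T : ℝ}

/-- The interpolated solution of the discretized equation. -/
def interpSol (P : ControlProblem d M U) (A : SchemeData d l M U) (k : ℕ) (T : ℝ) (n : ℕ) :
    ℝ × (Fin d → ℝ) → ℝ :=
  timeInterp T n (gridSol P A k T n)

lemma eventually_step_small (R T : ℝ) :
    ∀ᶠ n : ℕ in atTop, 0 < n ∧ R * (T / n) ≤ 1 / 2 := by
  have h := (tendsto_const_div_natCast T).const_mul R
  rw [mul_zero] at h
  exact (eventually_gt_atTop 0).and (h.eventually_le_const (by norm_num))

lemma interpSol_terminal (hT : 0 < T) {n : ℕ} (hn : 0 < n) {p : ℝ × (Fin d → ℝ)}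
    (hp : p.1 = T) : interpSol P A k T n p = P.ψ p.2 := by
  have e : p = (((Fin.last n : Fin (n + 1)) : ℝ) * (T / n), p.2) := by
    refine Prod.ext ?_ rfl
    simp only [Fin.val_last, hp]
    field_simp
  rw [e, interpSol, timeInterp_grid hT hn]
  simp [gridSol]

variable [Finite M] [Nonempty M] [Nonempty U]

lemma abs_interpSol_le (hR : CoefBound P A k R) (hcont : UniformlyContinuousData P A)
    (hT : 0 < T) : ∀ᶠ n in atTop, ∀ p ∈ grid d T n,
      |interpSol P A k T n p| ≤ Real.exp (2 * (R * T)) * (R + R * T) := by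
  filter_upwards [eventually_step_small R T] with n hn
  rintro ⟨t, x⟩ ⟨i, rfl⟩
  rw [interpSol, timeInterp_grid hT hn.1]
  exact abs_gridSol_le hR hcont hT hn.1 hn.2 i x

/-- The scheme at a grid point before the terminal time. -/
lemma iSup_step_interpSol (hR : CoefBound P A k R) (hcont : UniformlyContinuousData P A)
    (hT : 0 < T) {n : ℕ} (hn : 0 < n) (hRh : R * (T / n) ≤ 1 / 2) {p : ℝ × (Fin d → ℝ)}
    (hp : p ∈ grid d T n) (hpT : p.1 ≠ T) :
    Measurable (fun y => interpSol P A k T n (p.1 + T / n, y)) ∧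
    (∀ y, |interpSol P A k T n (p.1 + T / n, y)| ≤ Real.exp (2 * (R * T)) * (R + R * T)) ∧
    (∀ y, (p.1 + T / n, y) ∈ grid d T n) ∧
    ⨆ c, (coef P A c p.2).step k (T / n) p.2 (interpSol P A k T n p)
      (fun y => interpSol P A k T n (p.1 + T / n, y)) = 0 := by
  obtain ⟨t, x⟩ := p
  obtain ⟨i, rfl⟩ := hp
  induction i using Fin.lastCases with
  | last =>
    refine absurd ?_ hpT
    simp only [Fin.val_last]
    field_simp
  | cast i =>
    have e : ∀ y : Fin d → ℝ, (((i.castSucc : Fin (n + 1)) : ℝ) * (T / n) + T / n, y)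
        = (((i.succ : Fin (n + 1)) : ℝ) * (T / n), y) := fun y => by
      refine Prod.ext ?_ rfl
      simp only [Fin.val_castSucc, Fin.val_succ]
      push_cast
      ring
    have e2 : (fun y => interpSol P A k T n
        (((i.castSucc : Fin (n + 1)) : ℝ) * (T / n) + T / n, y)) = gridSol P A k T n i.succ := by
      funext y
      rw [e, interpSol, timeInterp_grid hT hn]
    have hm : Measurable (gridSol P A k T n i.succ) :=
      (gridSol_continuous hR hcont hT hn hRh i.succ).measurable
    have hb := abs_gridSol_le hR hcont hT hn hRh i.succ
    have e3 : ∀ y, interpSol P A k T n (((i.castSucc : Fin (n + 1)) : ℝ) * (T / n) + T / n, y)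
        = gridSol P A k T n i.succ y := fun y => congrFun e2 y
    refine ⟨by simpa only [e2] using hm, fun y => by simpa only [e3] using hb y,
      fun y => ⟨i.succ, congrArg Prod.fst (e y)⟩, ?_⟩
    have hsol := ((isDiscreteSolution_iff hR hcont hT hn hRh _).2 rfl).2 i x
    rw [K_eq_iSup_step P A k (by positivity) x _ hm hb, neg_eq_zero] at hsol
    have e4 : interpSol P A k T n (((i.castSucc : Fin (n + 1)) : ℝ) * (T / n), x)
        = gridSol P A k T n i.castSucc x := by rw [interpSol, timeInterp_grid hT hn]
    simp only [e3, e4]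
    exact hsol

end Limits

/-- The viscosity inequality sees the test function only through its first and second derivatives at
the point, so the globalized test function may replace the original one. -/
lemma jet_congr {d : ℕ} {φ Φ : ℝ × (Fin d → ℝ) → ℝ} (hφ : ContDiff ℝ 2 φ) (hΦ : ContDiff ℝ 2 Φ)
    {t : ℝ} {x : Fin d → ℝ} (h1 : fderiv ℝ Φ (t, x) = fderiv ℝ φ (t, x))
    (h2 : fderiv ℝ (fderiv ℝ Φ) (t, x) = fderiv ℝ (fderiv ℝ φ) (t, x)) :
    deriv (fun s => Φ (s, x)) t = deriv (fun s => φ (s, x)) t ∧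
      spaceGrad Φ t x = spaceGrad φ t x ∧ spaceHess Φ t x = spaceHess φ t x := by
  refine ⟨?_, ?_, ?_⟩
  · rw [deriv_time_eq hΦ, deriv_time_eq hφ, h1]
  · funext i
    rw [spaceGrad_eq hΦ, spaceGrad_eq hφ, h1]
  · ext i j
    rw [spaceHess_eq hΦ, spaceHess_eq hφ, h2]

lemma tendsto_inv_mul_sq {T : ℝ} (hT : 0 < T) {ν : ℕ → ℕ} (hν : Tendsto ν atTop atTop) :
    Tendsto (fun j => (T / ν j)⁻¹ * (1 / (ν j : ℝ)) ^ 2) atTop (𝓝 0) := by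
  refine ((tendsto_const_div_natCast T⁻¹).comp hν).congr fun j => ?_
  simp only [Function.comp]
  rcases eq_or_ne (ν j : ℝ) 0 with h | h
  · simp [h]
  · field_simp

/-! ### Viscosity inequalities for the half-relaxed limits. -/

section Viscosity

variable {d l : ℕ} {M U : Type*} {P : ControlProblem d M U} {A : SchemeData d l M U} {k : ℕ}
  {R T : ℝ}

lemma Coef.continuous_const_add_ham (a r : ℝ) (p : Fin d → ℝ) (Γ : Matrix (Fin d) (Fin d) ℝ) :
    Continuous fun θ : Coef d l => a + θ.ham r p Γ := by
  have h1 : Continuous fun θ : Coef d l => (θ, r) := by fun_prop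
  have h2 := (Coef.continuous_ham p Γ).comp h1
  simp only [Function.comp_def] at h2
  exact continuous_const.add h2

/-- The Hamiltonian is continuous in the coefficients, whose values at `x` lie in a compact set; in
particular `Γ` need not be symmetric. -/
lemma bddAbove_ham (hR : CoefBound P A k R) (x : Fin d → ℝ) (r : ℝ) (p : Fin d → ℝ)
    (Γ : Matrix (Fin d) (Fin d) ℝ) (a : ℝ) :
    BddAbove (range fun c => a + (coef P A c x).ham r p Γ) := by
  refine (((hR.isBounded_range x).isCompact_closure.image
    (Coef.continuous_const_add_ham a r p Γ)).bddAbove).mono ?_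
  rintro _ ⟨c, rfl⟩
  exact ⟨_, subset_closure ⟨c, rfl⟩, rfl⟩

variable [Nonempty M] [Nonempty U]

lemma hjb_eq (hR : CoefBound P A k R) (hdec : IsDecomposition P A) (φ : ℝ × (Fin d → ℝ) → ℝ)
    (t : ℝ) (x : Fin d → ℝ) (r : ℝ) :
    P.hjb φ t x r = -⨆ c, (deriv (fun s => φ (s, x)) t
      + (coef P A c x).ham r (spaceGrad φ t x) (spaceHess φ t x)) := by
  have hb := bddAbove_ham hR x r (spaceGrad φ t x) (spaceHess φ t x) 0
  simp only [zero_add] at hb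
  rw [← add_ciSup hb, ControlProblem.hjb, ControlProblem.hamiltonian]
  simp only [hamiltonianAt_eq_ham hdec]
  ring

variable [Finite M]

/-- At a near-maximizer `p`, the discrete solution lies below the test function shifted by a
constant to agree at `p` up to `o(h)`. By monotonicity the scheme's supremum, which is zero, is at
most that of the shifted test function. Its limit is the operator for the test function, because
convergence is uniform over the controls. -/
lemma upperLim_subsolution (hR : CoefBound P A k R) (hcont : UniformlyContinuousData P A)
    (hdec : IsDecomposition P A) (hT : 0 < T) {t₀ : ℝ} {x₀ : Fin d → ℝ}
    (hq₀ : (t₀, x₀) ∈ slab d T) {φ : ℝ × (Fin d → ℝ) → ℝ} (hφ : ContDiff ℝ 2 φ)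
    (hmax : IsLocalMaxOn (fun q => upperLim (grid d T) (interpSol P A k T) q - φ q) (slab d T)
      (t₀, x₀)) :
    (t₀ = T ∧ upperLim (grid d T) (interpSol P A k T) (t₀, x₀) ≤ P.ψ x₀) ∨
      P.hjb φ t₀ x₀ (upperLim (grid d T) (interpSol P A k T) (t₀, x₀)) ≤ 0 := by
  have hV := abs_interpSol_le hR hcont hT
  obtain ⟨Φ, c, ν, p, hΦ, hc, hd1, hd2, hν, hp, hp0, hVp, hle⟩ :=
    exists_test_sequence hT hV hq₀ hφ hmax
  set u := upperLim (grid d T) (interpSol P A k T) (t₀, x₀)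
  have hpt : Tendsto (fun j => (p j).1) atTop (𝓝 t₀) := (continuous_fst.tendsto _).comp hp0
  have hpx : Tendsto (fun j => (p j).2) atTop (𝓝 x₀) := (continuous_snd.tendsto _).comp hp0
  have hgood := hν.eventually (eventually_step_small R T)
  -- If terminal grid points recur, the terminal datum passes to the limit. Otherwise the
  -- near-maximizers eventually precede `T`, where the scheme equation is available even when `t₀ =
  -- T`.
  by_cases hfreq : ∃ᶠ j in atTop, (p j).1 = T
  · left
    refine ⟨tendsto_nhds_unique_of_frequently_eq hpt tendsto_const_nhds hfreq, ?_⟩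
    refine (tendsto_nhds_unique_of_frequently_eq hVp
      ((hcont.ψ.continuous.tendsto x₀).comp hpx) ?_).le
    exact (hfreq.and_eventually hgood).mono fun j hj => interpSol_terminal hT hj.2.1 hj.1
  · right
    rw [not_frequently] at hfreq
    obtain ⟨e1, e2, e3⟩ := jet_congr hφ hΦ hd1 hd2
    rw [hjb_eq hR hdec, ← e1, ← e2, ← e3, neg_nonpos]
    have hh : Tendsto (fun j => T / (ν j : ℝ)) atTop (𝓝 0) := (tendsto_const_div_natCast T).comp hν
    have hpos : ∀ᶠ j in atTop, 0 < T / (ν j : ℝ) := hgood.mono fun j hj => by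
      have := hj.1
      positivity
    set F : ℕ → Coef d l → ℝ := fun j θ => θ.step k (T / ν j) (p j).2
      (interpSol P A k T (ν j) (p j)) (fun y => Φ ((p j).1 + T / ν j, y)
        + (interpSol P A k T (ν j) (p j) - Φ (p j) + (1 / (ν j : ℝ)) ^ 2)) with hF
    have hFlim : ∀ a : Coef d l, Tendsto (fun z : ℕ × Coef d l => F z.1 z.2) (atTop ×ˢ 𝓝 a)
        (𝓝 (deriv (fun s => Φ (s, x₀)) t₀
          + a.ham u (spaceGrad Φ t₀ x₀) (spaceHess Φ t₀ x₀))) := fun a =>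
      Coef.step_tendsto k hΦ hc (tendsto_fst.eventually hpos) (hh.comp tendsto_fst)
        (hp0.comp tendsto_fst) tendsto_snd (hVp.comp tendsto_fst)
        ((tendsto_inv_mul_sq hT hν).comp tendsto_fst)
    have hF' : Continuous fun θ : Coef d l => deriv (fun s => Φ (s, x₀)) t₀
        + θ.ham u (spaceGrad Φ t₀ x₀) (spaceHess Φ t₀ x₀) :=
      Coef.continuous_const_add_ham _ _ _ _
    have hθ : TendstoUniformly (fun j c => coef P A c (p j).2) (fun c => coef P A c x₀) atTop :=
      fun W hW => hpx.eventually (tendstoUniformly_coef hcont x₀ W hW)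
    have hsup := tendsto_iSup_of_tendstoUniformly
      (tendstoUniformly_comp_of_continuous_convergence hF' hFlim hθ (hR.isBounded_range x₀))
      (bddAbove_ham hR x₀ u _ _ _)
    refine ge_of_tendsto hsup ?_
    obtain ⟨B, -, -, hB, -, -⟩ := Coef.exists_bounds_of_hasCompactSupport hΦ hc
    filter_upwards [hgood, hfreq] with j hj hjT
    obtain ⟨hm, hb, hgrid, hzero⟩ := iSup_step_interpSol hR hcont hT hj.1 hj.2 (hp j) hjT
    have hh0 : 0 < T / (ν j : ℝ) := by
      have := hj.1
      positivity
    have hm' : Measurable fun y => Φ ((p j).1 + T / ν j, y)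
        + (interpSol P A k T (ν j) (p j) - Φ (p j) + (1 / (ν j : ℝ)) ^ 2) :=
      (hΦ.continuous.measurable.comp measurable_prodMk_left).add_const _
    have hb' : ∀ y, |Φ ((p j).1 + T / ν j, y)
        + (interpSol P A k T (ν j) (p j) - Φ (p j) + (1 / (ν j : ℝ)) ^ 2)|
        ≤ B + |interpSol P A k T (ν j) (p j) - Φ (p j) + (1 / (ν j : ℝ)) ^ 2| := fun y =>
      (abs_add_le _ _).trans (by linarith [hB ((p j).1 + T / ν j, y)])
    rw [← hzero]
    refine ciSup_mono (hR.bddAbove_step hh0 hm' hb' _ _) fun c => ?_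
    refine Coef.step_mono (hR.trace c _) hh0 _ _ hm hm' hb hb' fun y => ?_
    linarith [hle j _ (hgrid y)]

/-- The subsolution argument is applied to the near-maximizers of the negated solutions, with the
inequalities reversed. -/
lemma lowerLim_supersolution (hR : CoefBound P A k R) (hcont : UniformlyContinuousData P A)
    (hdec : IsDecomposition P A) (hT : 0 < T) {t₀ : ℝ} {x₀ : Fin d → ℝ}
    (hq₀ : (t₀, x₀) ∈ slab d T) {φ : ℝ × (Fin d → ℝ) → ℝ} (hφ : ContDiff ℝ 2 φ)
    (hmin : IsLocalMinOn (fun q => -upperLim (grid d T) (fun n q => -interpSol P A k T n q) q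
      - φ q) (slab d T) (t₀, x₀)) :
    (t₀ = T ∧ P.ψ x₀ ≤ -upperLim (grid d T) (fun n q => -interpSol P A k T n q) (t₀, x₀)) ∨
      0 ≤ P.hjb φ t₀ x₀ (-upperLim (grid d T) (fun n q => -interpSol P A k T n q) (t₀, x₀)) := by
  have hV : ∀ᶠ n in atTop, ∀ p ∈ grid d T n, |-interpSol P A k T n p|
      ≤ Real.exp (2 * (R * T)) * (R + R * T) := by
    simpa only [abs_neg] using abs_interpSol_le hR hcont hT
  have hmax : IsLocalMaxOn (fun q => upperLim (grid d T) (fun n q => -interpSol P A k T n q) q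
      - (-φ q)) (slab d T) (t₀, x₀) := by
    refine hmin.mono fun q hq => ?_
    simp only at hq ⊢
    linarith
  obtain ⟨Φ', c, ν, p, hΦ', hc, hd1, hd2, hν, hp, hp0, hVp, hle⟩ :=
    exists_test_sequence hT hV hq₀ hφ.neg hmax
  set u := upperLim (grid d T) (fun n q => -interpSol P A k T n q) (t₀, x₀)
  set Φ : ℝ × (Fin d → ℝ) → ℝ := fun q => -Φ' q with hΦdef
  have hΦ : ContDiff ℝ 2 Φ := hΦ'.neg
  have hcΦ : HasCompactSupport fun q => Φ q - (-c) := by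
    have e : (fun q => Φ q - (-c)) = fun q => -(Φ' q - c) := by
      funext q
      simp only [hΦdef]
      ring
    rw [e]
    exact hc.neg
  have hneg : ∀ f : ℝ × (Fin d → ℝ) → ℝ, fderiv ℝ (fun q => -f q) = fun q => -fderiv ℝ f q :=
    fun f => funext fun q => fderiv_fun_neg
  have hd1' : fderiv ℝ Φ (t₀, x₀) = fderiv ℝ φ (t₀, x₀) := by
    rw [hΦdef, hneg]
    beta_reduce
    rw [hd1, hneg, neg_neg]
  have hd2' : fderiv ℝ (fderiv ℝ Φ) (t₀, x₀) = fderiv ℝ (fderiv ℝ φ) (t₀, x₀) := by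
    rw [hΦdef, hneg, fderiv_fun_neg, hd2, hneg, fderiv_fun_neg, neg_neg]
  have hVp' : Tendsto (fun j => interpSol P A k T (ν j) (p j)) atTop (𝓝 (-u)) := by
    simpa only [neg_neg] using hVp.neg
  have hpt : Tendsto (fun j => (p j).1) atTop (𝓝 t₀) := (continuous_fst.tendsto _).comp hp0
  have hpx : Tendsto (fun j => (p j).2) atTop (𝓝 x₀) := (continuous_snd.tendsto _).comp hp0
  have hgood := hν.eventually (eventually_step_small R T)
  by_cases hfreq : ∃ᶠ j in atTop, (p j).1 = T
  · left
    refine ⟨tendsto_nhds_unique_of_frequently_eq hpt tendsto_const_nhds hfreq, ?_⟩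
    refine (tendsto_nhds_unique_of_frequently_eq hVp'
      ((hcont.ψ.continuous.tendsto x₀).comp hpx) ?_).ge
    exact (hfreq.and_eventually hgood).mono fun j hj => interpSol_terminal hT hj.2.1 hj.1
  · right
    rw [not_frequently] at hfreq
    obtain ⟨e1, e2, e3⟩ := jet_congr hφ hΦ hd1' hd2'
    rw [hjb_eq hR hdec, ← e1, ← e2, ← e3, neg_nonneg]
    have hh : Tendsto (fun j => T / (ν j : ℝ)) atTop (𝓝 0) := (tendsto_const_div_natCast T).comp hν
    have hpos : ∀ᶠ j in atTop, 0 < T / (ν j : ℝ) := hgood.mono fun j hj => by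
      have := hj.1
      positivity
    -- Here each control can be treated separately: its value for the shifted test function is at
    -- most the supremum for the discrete solution, which is zero. Pointwise consistency suffices,
    -- without uniformity over the controls.
    refine ciSup_le fun c => ?_
    have hθ : Tendsto (fun j => coef P A c (p j).2) atTop (𝓝 (coef P A c x₀)) :=
      ((tendstoUniformly_coef hcont x₀).tendsto_at c).comp hpx
    have he : Tendsto (fun j => (T / ν j)⁻¹ * -(1 / (ν j : ℝ)) ^ 2) atTop (𝓝 0) := by
      simpa only [mul_neg, neg_zero] using (tendsto_inv_mul_sq hT hν).neg
    have hlim := Coef.step_tendsto k hΦ hcΦ hpos hh hp0 hθ hVp' he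
    refine le_of_tendsto hlim ?_
    obtain ⟨B, -, -, hB, -, -⟩ := Coef.exists_bounds_of_hasCompactSupport hΦ hcΦ
    filter_upwards [hgood, hfreq] with j hj hjT
    obtain ⟨hm, hb, hgrid, hzero⟩ := iSup_step_interpSol hR hcont hT hj.1 hj.2 (hp j) hjT
    have hh0 : 0 < T / (ν j : ℝ) := by
      have := hj.1
      positivity
    have hm' : Measurable fun y => Φ ((p j).1 + T / ν j, y)
        + (interpSol P A k T (ν j) (p j) - Φ (p j) + -(1 / (ν j : ℝ)) ^ 2) :=
      (hΦ.continuous.measurable.comp measurable_prodMk_left).add_const _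
    have hb' : ∀ y, |Φ ((p j).1 + T / ν j, y)
        + (interpSol P A k T (ν j) (p j) - Φ (p j) + -(1 / (ν j : ℝ)) ^ 2)|
        ≤ B + |interpSol P A k T (ν j) (p j) - Φ (p j) + -(1 / (ν j : ℝ)) ^ 2| := fun y =>
      (abs_add_le _ _).trans (by linarith [hB ((p j).1 + T / ν j, y)])
    rw [← hzero]
    refine le_trans ?_ (le_ciSup (hR.bddAbove_step hh0 hm hb _ _) c)
    refine Coef.step_mono (hR.trace c _) hh0 _ _ hm' hm hb' hb fun y => ?_
    have := hle j _ (hgrid y)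
    simp only [hΦdef]
    linarith

end Viscosity

/-! ### Convergence of the scheme -/

lemma UpperSemicontinuousOn.neg_real {X : Type*} [TopologicalSpace X] {f : X → ℝ} {s : Set X}
    (hf : UpperSemicontinuousOn f s) : LowerSemicontinuousOn (fun x => -f x) s :=
  fun x hx y hy => (hf x hx (-y) (lt_neg.1 hy)).mono fun _ hz => lt_neg.1 hz

namespace ControlProblem

variable {d : ℕ} {M U : Type*} {P : ControlProblem d M U} {T : ℝ}

/-- The two half-relaxed limits are shown to agree only on the slab, which is enough because every
condition is relative to it. This transfers the supersolution property to the upper limit. -/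
lemma IsSupersolution.congr {w w' : ℝ × (Fin d → ℝ) → ℝ} (hT : 0 < T)
    (hw : P.IsSupersolution T w) (h : EqOn w w' (slab d T)) : P.IsSupersolution T w' := by
  have key : ∀ {q : ℝ × (Fin d → ℝ)} {φ : ℝ × (Fin d → ℝ) → ℝ}, q ∈ slab d T →
      IsLocalMinOn (fun q => w' q - φ q) (slab d T) q →
      IsLocalMinOn (fun q => w q - φ q) (slab d T) q := by
    intro q φ hq hmin
    filter_upwards [hmin, self_mem_nhdsWithin] with z hz hzs
    rwa [h hq, h hzs]
  have hmem : ∀ {t : ℝ} (x : Fin d → ℝ), t ∈ Icc 0 T → (t, x) ∈ slab d T := fun x ht =>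
    ⟨ht, mem_univ _⟩
  refine ⟨fun q hq y hy => ?_, fun t ht x φ hφ hmin => ?_, fun x φ hφ hmin => ?_⟩
  · have hy' : y < w q := (h hq).symm ▸ hy
    filter_upwards [hw.lsc q hq y hy', self_mem_nhdsWithin] with z hz hzs
    exact h hzs ▸ hz
  · have hq := hmem x (Ico_subset_Icc_self ht)
    rw [← h hq]
    exact hw.interior t ht x φ hφ (key hq hmin)
  · have hq := hmem x (right_mem_Icc.2 hT.le)
    rw [← h hq]
    exact hw.terminal x φ hφ (key hq hmin)

end ControlProblem

section Convergence

variable {d l : ℕ} {M U : Type*} [Finite M] [Nonempty M] [Nonempty U] {P : ControlProblem d M U}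
  {A : SchemeData d l M U} {k : ℕ} {R T : ℝ}

lemma isSubsolution_upperLim (hR : CoefBound P A k R) (hcont : UniformlyContinuousData P A)
    (hdec : IsDecomposition P A) (hT : 0 < T) :
    P.IsSubsolution T (upperLim (grid d T) (interpSol P A k T)) := by
  refine ⟨upperSemicontinuousOn_upperLim (abs_interpSol_le hR hcont hT)
    fun q hq => neBot_relFilter_grid hT hq, fun t ht x φ hφ hmax => ?_, fun x φ hφ hmax => ?_⟩
  · exact (upperLim_subsolution hR hcont hdec hT ⟨Ico_subset_Icc_self ht, mem_univ _⟩ hφ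
      hmax).resolve_left fun h => ht.2.ne h.1
  · rcases upperLim_subsolution hR hcont hdec hT ⟨right_mem_Icc.2 hT.le, mem_univ _⟩ hφ hmax
      with h | h
    · exact min_le_of_right_le (sub_nonpos.2 h.2)
    · exact min_le_of_left_le h

lemma isSupersolution_lowerLim (hR : CoefBound P A k R) (hcont : UniformlyContinuousData P A)
    (hdec : IsDecomposition P A) (hT : 0 < T) :
    P.IsSupersolution T
      (fun q => -upperLim (grid d T) (fun n q => -interpSol P A k T n q) q) := by
  have hV : ∀ᶠ n in atTop, ∀ p ∈ grid d T n, |-interpSol P A k T n p|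
      ≤ Real.exp (2 * (R * T)) * (R + R * T) := by
    simpa only [abs_neg] using abs_interpSol_le hR hcont hT
  refine ⟨(upperSemicontinuousOn_upperLim hV fun q hq => neBot_relFilter_grid hT hq).neg_real,
    fun t ht x φ hφ hmin => ?_, fun x φ hφ hmin => ?_⟩
  · exact (lowerLim_supersolution hR hcont hdec hT ⟨Ico_subset_Icc_self ht, mem_univ _⟩ hφ
      hmin).resolve_left fun h => ht.2.ne h.1
  · rcases lowerLim_supersolution hR hcont hdec hT ⟨right_mem_Icc.2 hT.le, mem_univ _⟩ hφ hmin
      with h | h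
    · exact le_max_of_le_right (sub_nonneg.2 h.2)
    · exact le_max_of_le_left h

/-- Under strong uniqueness, the two half-relaxed limits coincide. -/
lemma lowerLim_eq_upperLim (hR : CoefBound P A k R) (hcont : UniformlyContinuousData P A)
    (hdec : IsDecomposition P A) (hT : 0 < T) (huniq : P.StrongUniqueness T) :
    EqOn (fun q => -upperLim (grid d T) (fun n q => -interpSol P A k T n q) q)
      (upperLim (grid d T) (interpSol P A k T)) (slab d T) := by
  have hV := abs_interpSol_le hR hcont hT
  have hV' : ∀ᶠ n in atTop, ∀ p ∈ grid d T n, |-interpSol P A k T n p|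
      ≤ Real.exp (2 * (R * T)) * (R + R * T) := by
    simpa only [abs_neg] using hV
  intro q hq
  have := neBot_relFilter_grid hT hq
  refine le_antisymm (neg_upperLim_neg_le hV q) (huniq _ _
    ⟨Real.exp (2 * (R * T)) * (R + R * T), fun p hp => ?_⟩
    ⟨Real.exp (2 * (R * T)) * (R + R * T), fun p hp => ?_⟩ (isSubsolution_upperLim hR hcont hdec hT)
    (isSupersolution_lowerLim hR hcont hdec hT) q hq)
  · have := neBot_relFilter_grid hT hp
    exact abs_upperLim_le hV p
  · have := neBot_relFilter_grid hT hp
    rw [abs_neg]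
    exact abs_upperLim_le hV' p

lemma tendsto_interpSol (hR : CoefBound P A k R) (hcont : UniformlyContinuousData P A)
    (hdec : IsDecomposition P A) (hT : 0 < T) (huniq : P.StrongUniqueness T)
    {q : ℝ × (Fin d → ℝ)} (hq : q ∈ slab d T) :
    Tendsto (fun z : ℕ × (ℝ × (Fin d → ℝ)) => interpSol P A k T z.1 z.2)
      (relFilter (grid d T) q) (𝓝 (upperLim (grid d T) (interpSol P A k T) q)) :=
  tendsto_relFilter (abs_interpSol_le hR hcont hT) rfl
    (lowerLim_eq_upperLim hR hcont hdec hT huniq hq)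

lemma upperLim_continuousOn (hR : CoefBound P A k R) (hcont : UniformlyContinuousData P A)
    (hdec : IsDecomposition P A) (hT : 0 < T) (huniq : P.StrongUniqueness T) :
    ContinuousOn (upperLim (grid d T) (interpSol P A k T)) (slab d T) :=
  continuousOn_iff_lower_upperSemicontinuousOn.2
    ⟨((isSupersolution_lowerLim hR hcont hdec hT).congr hT
      (lowerLim_eq_upperLim hR hcont hdec hT huniq)).lsc,
      (isSubsolution_upperLim hR hcont hdec hT).usc⟩

lemma tendstoLocallyUniformlyOn_interpSol (hR : CoefBound P A k R)
    (hcont : UniformlyContinuousData P A) (hdec : IsDecomposition P A) (hT : 0 < T)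
    (huniq : P.StrongUniqueness T) :
    TendstoLocallyUniformlyOn (fun n => interpSol P A k T n)
      (upperLim (grid d T) (interpSol P A k T)) atTop (slab d T) :=
  tendstoLocallyUniformlyOn_timeInterp hT (upperLim_continuousOn hR hcont hdec hT huniq)
    fun _ hq => tendsto_interpSol hR hcont hdec hT huniq hq

lemma isViscositySolution_upperLim (hR : CoefBound P A k R)
    (hcont : UniformlyContinuousData P A) (hdec : IsDecomposition P A) (hT : 0 < T)
    (huniq : P.StrongUniqueness T) :
    P.IsViscositySolution T (upperLim (grid d T) (interpSol P A k T)) := by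
  refine ⟨upperLim_continuousOn hR hcont hdec hT huniq,
    ⟨Real.exp (2 * (R * T)) * (R + R * T), fun q hq => ?_⟩,
    isSubsolution_upperLim hR hcont hdec hT,
    (isSupersolution_lowerLim hR hcont hdec hT).congr hT
      (lowerLim_eq_upperLim hR hcont hdec hT huniq), fun x => ?_⟩
  · have := neBot_relFilter_grid hT hq
    exact abs_upperLim_le (abs_interpSol_le hR hcont hT) q
  -- The relaxed terminal conditions do not state `v(T, ·) = ψ` directly. It follows because the
  -- interpolated solutions equal `ψ` at time `T` and converge there.
  · have h := (tendstoLocallyUniformlyOn_interpSol hR hcont hdec hT huniq).tendsto_at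
      (show (T, x) ∈ slab d T from ⟨right_mem_Icc.2 hT.le, mem_univ _⟩)
    refine tendsto_nhds_unique h (tendsto_const_nhds.congr' ?_)
    filter_upwards [eventually_gt_atTop 0] with n hn
    exact (interpSol_terminal hT hn (p := (T, x)) rfl).symm

end Convergence

end

theorem mainTheorem2 {d l : ℕ} {M U : Type*} [Finite M] [Nonempty M] [Nonempty U]
    (P : ControlProblem d M U) (A : SchemeData d l M U) (T : ℝ) (hT : 0 < T) (k : ℕ)
    (hfin : P.FiniteHamiltonian)
    (hdec : IsDecomposition P A)
    (hbdd : BoundedData P A)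
    (hk : ∀ m x u, (A.S m x u * (A.S m x u)ᵀ).trace ≤ 4 * (k : ℝ) + 2)
    (hcont : UniformlyContinuousData P A)
    (huniq : P.StrongUniqueness T) :
    (∀ᶠ n : ℕ in atTop, ∃! w : Fin (n + 1) → (Fin d → ℝ) → ℝ,
        SchemeData.IsDiscreteSolution P A k T n w) ∧
    ∃ v : ℝ × (Fin d → ℝ) → ℝ,
      P.IsViscositySolution T v ∧
      (∀ v' : ℝ × (Fin d → ℝ) → ℝ, P.IsViscositySolution T v' → EqOn v' v (slab d T)) ∧
      ∀ vh : (n : ℕ) → Fin (n + 1) → (Fin d → ℝ) → ℝ,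
        (∀ᶠ n : ℕ in atTop, SchemeData.IsDiscreteSolution P A k T n (vh n)) →
        TendstoLocallyUniformlyOn (fun n => timeInterp T n (vh n)) v atTop (slab d T) := by
  obtain ⟨R, hR⟩ := exists_coefBound hfin hbdd hk
  have hsmall := eventually_step_small R T
  have hv := isViscositySolution_upperLim hR hcont hdec hT huniq
  refine ⟨?_, _, hv, fun v' hv' q hq => ?_, fun vh hvh => ?_⟩
  · filter_upwards [hsmall] with n hn
    have h := isDiscreteSolution_iff hR hcont hT hn.1 hn.2
    exact ⟨_, (h _).2 rfl, fun w hw => (h w).1 hw⟩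
  · exact le_antisymm (huniq _ _ hv'.bounded hv.bounded hv'.sub hv.super q hq)
      (huniq _ _ hv.bounded hv'.bounded hv.sub hv'.super q hq)
  · intro W hW q hq
    obtain ⟨t, ht, h⟩ := tendstoLocallyUniformlyOn_interpSol hR hcont hdec hT huniq W hW q hq
    refine ⟨t, ht, ?_⟩
    filter_upwards [h, hsmall, hvh] with n h1 hn hsol
    -- For large `n` uniqueness identifies the given discrete solution with the constructed one.
    rwa [(isDiscreteSolution_iff hR hcont hT hn.1 hn.2 _).1 hsol]
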